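/- Let $n\ge 2$, $c\in\mathbb R\setminus\{0\}$ and $\varepsilon\in\{1,-1\}$. The ambient space $\mathcal M$ is one of the following. (i) Case $\varepsilon=1$: the pseudo-Riemannian complex space form $\mathbb{CP}^n_p$ of holomorphic curvature $4c$, that is, the quotient of the hyperquadric $\{z\in\mathbb C^{n+1}: \langle z,z\rangle=1/c\}$ by $z\sim(\cos\theta,\sin\theta)z$ ($\theta\in\mathbb R$), where $\langle z,w\rangle=\mathrm{Re}\big(-\sum_{j\le p}z_j\bar w_j+\sum_{j>p}z_j\bar w_j\big)$. (ii) Case $\varepsilon=-1$: the para-complex space form of para-holomorphic curvature $4c$, that is, the quotient of $\{z\in\mathbb D^{n+1}:\langle z,z\rangle=-1/c\}$ by $z\sim(\cosh\theta,\sinh\theta)z$ ($\theta\in\mathbb R$), where $\mathbb D=\{x+\tau y\}$, $\tau^2=1$, are the para-complex numbers and $\langle z,w\rangle=\sum_{j=1}^{n+1}(x_jx_j'-y_jy_j')$ for $z_j=x_j+\tau y_j$, $w_j=x_j'+\tau y_j'$ (so $c=1$ gives $\mathbb{DP}^n$ and $c=-1$ its polar space). In both cases $\mathcal M$ carries the pseudo-Riemannian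 metric that makes the projection a pseudo-Riemannian submersion, its Levi-Civita connection $\nabla$, and the induced complex or para-complex structure $J$, $J^2=-\varepsilon\,\mathrm{Id}$. Let $\Sigma$ be a connected smooth immersed real hypersurface of $\mathcal M$ whose induced metric is non-degenerate. For a (local) smooth unit normal field $N$, $\langle N,N\rangle=\pm1$, let $A$ be the shape operator, $\nabla_XN=-AX$, and let $\xi=-\varepsilon JN$ be the structure vector field. Suppose that $\Sigma$ is Hopf, i.e. $\xi$ is everywhere a principal direction, $A\xi=a\xi$. Then the Hopf principal curvature $a$ is constant. Precisely, there is $a_0\in\mathbb R$ such that for every unit normal field $N$ on a connected open subset $U$ of $\Sigma$ (in particular on $U=\Sigma$, if $N$ is globally defined) the function $a$ is constant on $U$, equal to $a_0$ or to $-a_0$ (the sign of $a$ changes with that of $N$). -/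

import Mathlib

open scoped Manifold ContDiff Topology

noncomputable section

namespace SpaceForms

/-! ### Complex and para-complex numbers, written as pairs of real numbers -/

/-- The two families of ambient spaces: `cplx p` for the pseudo-Riemannian complex space forms
built on `ℂ^{n+1}` with `p` negative complex directions, and `para` for the para-complex space
forms built on `𝔻^{n+1}`. -/
inductive Kind where
  | cplx (p : ℕ) : Kind
  | para : Kind

/-- `ε`, where `J² = -ε`: it is `1` in the complex case and `-1` in the para-complex case. -/
def Kind.eps : Kind → ℝ
  | .cplx _ => 1
  | .para => -1

/-- The sign of the `j`-th (para-)complex direction in the pseudo-Hermitian form. -/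
def Kind.sgn : Kind → ℕ → ℝ
  | .cplx p, j => if j < p then -1 else 1
  | .para, _ => 1

/-- The product of complex (`ε = 1`), resp. para-complex (`ε = -1`), numbers. -/
def mul (κ : Kind) (a b : ℝ × ℝ) : ℝ × ℝ :=
  (a.1 * b.1 - κ.eps * (a.2 * b.2), a.1 * b.2 + a.2 * b.1)

/-- The (possibly negative) square norm `a ā`. -/
def nu (κ : Kind) (a : ℝ × ℝ) : ℝ := a.1 ^ 2 + κ.eps * a.2 ^ 2

/-- The inverse of `a`, when `nu κ a ≠ 0`. -/
def inv (κ : Kind) (a : ℝ × ℝ) : ℝ × ℝ := (a.1 / nu κ a, -a.2 / nu κ a)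

/-- `(cos θ, sin θ)`, resp. `(cosh θ, sinh θ)`. -/
def unit : Kind → ℝ → ℝ × ℝ
  | .cplx _, θ => (Real.cos θ, Real.sin θ)
  | .para, θ => (Real.cosh θ, Real.sinh θ)

/-- The numbers `ρ · unit θ` with `ρ > 0`. -/
def Pos : Kind → (ℝ × ℝ) → Prop
  | .cplx p, a => 0 < nu (.cplx p) a
  | .para, a => 0 < nu .para a ∧ 0 < a.1

section arith

variable (κ : Kind)

lemma eps_sq : κ.eps * κ.eps = 1 := by cases κ <;> simp [Kind.eps]

lemma eps_ne : κ.eps ≠ 0 := by cases κ <;> simp [Kind.eps]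

lemma mul_comm' (a b : ℝ × ℝ) : mul κ a b = mul κ b a := by
  ext <;> simp only [mul] <;> ring

lemma mul_assoc' (a b d : ℝ × ℝ) : mul κ (mul κ a b) d = mul κ a (mul κ b d) := by
  ext <;> simp only [mul] <;> ring

lemma mul_left_comm' (a b d : ℝ × ℝ) : mul κ a (mul κ b d) = mul κ b (mul κ a d) := by
  ext <;> simp only [mul] <;> ring

lemma one_mul' (a : ℝ × ℝ) : mul κ (1, 0) a = a := by
  ext <;> simp [mul]

lemma mul_smul' (t : ℝ) (a b : ℝ × ℝ) : mul κ a (t • b) = t • mul κ a b := by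
  ext <;> simp only [mul, Prod.smul_fst, Prod.smul_snd, smul_eq_mul] <;> ring

lemma smul_mul' (t : ℝ) (a b : ℝ × ℝ) : mul κ (t • a) b = t • mul κ a b := by
  ext <;> simp only [mul, Prod.smul_fst, Prod.smul_snd, smul_eq_mul] <;> ring

lemma nu_mul (a b : ℝ × ℝ) : nu κ (mul κ a b) = nu κ a * nu κ b := by
  have h := eps_sq κ
  simp only [mul, nu]
  linear_combination (a.2 ^ 2 * b.2 ^ 2) * (h - h)

lemma nu_smul (t : ℝ) (a : ℝ × ℝ) : nu κ (t • a) = t ^ 2 * nu κ a := by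
  simp only [nu, Prod.smul_fst, Prod.smul_snd, smul_eq_mul]; ring

lemma nu_unit (θ : ℝ) : nu κ (unit κ θ) = 1 := by
  cases κ with
  | cplx p => simp [nu, unit, Kind.eps]
  | para =>
    have := Real.cosh_sq θ
    simp only [nu, unit, Kind.eps]; linarith

lemma inv_mul {a : ℝ × ℝ} (h : nu κ a ≠ 0) : mul κ (inv κ a) a = (1, 0) := by
  have h' := h
  simp only [nu] at h'
  ext
  · simp only [mul, inv, nu]; field_simp; ring
  · simp only [mul, inv, nu]; field_simp; ring

lemma nu_inv (a : ℝ × ℝ) : nu κ (inv κ a) = (nu κ a)⁻¹ := by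
  by_cases h : nu κ a = 0
  · simp [inv, h]; simp [nu]
  · have := nu_mul κ (inv κ a) a
    rw [inv_mul κ h] at this
    have h1 : nu κ (1, 0) = 1 := by simp [nu]
    rw [h1] at this
    exact eq_inv_of_mul_eq_one_left this.symm

/-- A quotient does not change when both terms are multiplied by an invertible number. -/
lemma div_mul_mul {u : ℝ × ℝ} (hu : nu κ u ≠ 0) {b : ℝ × ℝ} (hb : nu κ b ≠ 0) (a : ℝ × ℝ) :
    mul κ (inv κ (mul κ u b)) (mul κ u a) = mul κ (inv κ b) a := by
  have hub : nu κ (mul κ u b) ≠ 0 := by rw [nu_mul]; exact mul_ne_zero hu hb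
  have e1 : mul κ (mul κ u b) (mul κ (inv κ (mul κ u b)) (mul κ u a)) = mul κ u a := by
    rw [← mul_assoc', mul_comm' κ (mul κ u b), inv_mul κ hub, one_mul']
  have e2 : mul κ (mul κ u b) (mul κ (inv κ b) a) = mul κ u a := by
    rw [mul_assoc', ← mul_assoc' κ b, mul_comm' κ b, inv_mul κ hb, one_mul']
  have := e1.trans e2.symm
  have := congrArg (mul κ (inv κ (mul κ u b))) this
  rwa [← mul_assoc' κ (inv κ (mul κ u b)) (mul κ u b), inv_mul κ hub, one_mul',
    ← mul_assoc' κ (inv κ (mul κ u b)) (mul κ u b), inv_mul κ hub, one_mul'] at this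

lemma Pos.nu_pos {κ : Kind} {a : ℝ × ℝ} (h : Pos κ a) : 0 < nu κ a := by
  cases κ with
  | cplx p => exact h
  | para => exact h.1

lemma Pos.mul {κ : Kind} {a b : ℝ × ℝ} (ha : Pos κ a) (hb : Pos κ b) :
    Pos κ (SpaceForms.mul κ a b) := by
  have hn : 0 < nu κ (SpaceForms.mul κ a b) := by
    rw [nu_mul]; exact mul_pos ha.nu_pos hb.nu_pos
  cases κ with
  | cplx p => exact hn
  | para =>
    refine ⟨hn, ?_⟩
    obtain ⟨ha1, ha2⟩ := ha
    obtain ⟨hb1, hb2⟩ := hb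
    simp only [nu, Kind.eps] at ha1 hb1
    have h1 : |a.2| < a.1 := abs_lt_of_sq_lt_sq (by linarith) ha2.le
    have h2 : |b.2| < b.1 := abs_lt_of_sq_lt_sq (by linarith) hb2.le
    have h3 : |a.2 * b.2| < a.1 * b.1 := by
      rw [abs_mul]; exact mul_lt_mul'' h1 h2 (abs_nonneg _) (abs_nonneg _)
    have h4 := (abs_lt.mp h3).1
    simp only [SpaceForms.mul, Kind.eps]
    linarith

lemma Pos.inv {κ : Kind} {a : ℝ × ℝ} (ha : Pos κ a) : Pos κ (SpaceForms.inv κ a) := by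
  have hn : 0 < nu κ (SpaceForms.inv κ a) := by rw [nu_inv]; exact inv_pos.mpr ha.nu_pos
  cases κ with
  | cplx p => exact hn
  | para => exact ⟨hn, div_pos ha.2 ha.1⟩

lemma Pos.smul {κ : Kind} {a : ℝ × ℝ} (ha : Pos κ a) {t : ℝ} (ht : 0 < t) : Pos κ (t • a) := by
  have hn : 0 < nu κ (t • a) := by rw [nu_smul]; exact mul_pos (pow_pos ht 2) ha.nu_pos
  cases κ with
  | cplx p => exact hn
  | para => exact ⟨hn, mul_pos ht ha.2⟩

lemma pos_one : Pos κ (1, 0) := by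
  cases κ <;> simp [Pos, nu]

lemma pos_unit (θ : ℝ) : Pos κ (unit κ θ) := by
  have hn : 0 < nu κ (unit κ θ) := by rw [nu_unit]; exact one_pos
  cases κ with
  | cplx p => exact hn
  | para => exact ⟨hn, Real.cosh_pos θ⟩

lemma Pos.exists_unit {κ : Kind} {a : ℝ × ℝ} (ha : Pos κ a) (h1 : nu κ a = 1) :
    ∃ θ, a = unit κ θ := by
  cases κ with
  | cplx p =>
    simp only [nu, Kind.eps, one_mul] at h1
    have hn : ‖(⟨a.1, a.2⟩ : ℂ)‖ = 1 := by
      have h2 : ‖(⟨a.1, a.2⟩ : ℂ)‖ ^ 2 = 1 := by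
        rw [Complex.sq_norm, Complex.normSq_mk]; linarith
      have h3 := norm_nonneg (⟨a.1, a.2⟩ : ℂ)
      nlinarith
    have h0 : (⟨a.1, a.2⟩ : ℂ) ≠ 0 := by
      intro h; rw [h] at hn; simp at hn
    refine ⟨Complex.arg ⟨a.1, a.2⟩, ?_⟩
    ext
    · simp [unit, Complex.cos_arg h0, hn]
    · simp [unit, Complex.sin_arg, hn]
  | para =>
    obtain ⟨-, ha2⟩ := ha
    simp only [nu, Kind.eps] at h1
    refine ⟨Real.arsinh a.2, ?_⟩
    ext
    · simp only [unit, Real.cosh_arsinh]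
      rw [show 1 + a.2 ^ 2 = a.1 ^ 2 by linarith, Real.sqrt_sq ha2.le]
    · simp [unit]

lemma unit_zero : unit κ 0 = (1, 0) := by cases κ <;> simp [unit]

lemma unit_add (s t : ℝ) : unit κ (s + t) = mul κ (unit κ s) (unit κ t) := by
  cases κ
  · simp [unit, mul, Kind.eps, Real.cos_add, Real.sin_add]; ring
  · simp [unit, mul, Kind.eps, Real.cosh_add, Real.sinh_add]; ring

lemma continuous_nu : Continuous (nu κ) := by unfold nu; fun_prop

lemma continuous_mul (a : ℝ × ℝ) : Continuous (mul κ a) := by unfold mul; fun_prop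

lemma isOpen_pos : IsOpen {a | Pos κ a} := by
  cases κ with
  | cplx p => exact isOpen_lt continuous_const (continuous_nu _)
  | para =>
    exact (isOpen_lt continuous_const (continuous_nu _)).inter
      (isOpen_lt continuous_const continuous_fst)

end arith

/-! ### The hyperquadrics and their quotients -/

/-- `ℂ^{n+1}`, resp. `𝔻^{n+1}`. -/
abbrev Vec (n : ℕ) := Fin (n + 1) → ℝ × ℝ

/-- The real `2n`-dimensional model space of the quotient. -/
abbrev Model (n : ℕ) := Fin n → ℝ × ℝ

/-- The real part of the (para-)pseudo-Hermitian form: `∑ ± (x x' + ε y y')`. -/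
def form (κ : Kind) {n : ℕ} (z w : Vec n) : ℝ :=
  ∑ j : Fin (n + 1), κ.sgn j * ((z j).1 * (w j).1 + κ.eps * ((z j).2 * (w j).2))

/-- Multiplication by a (para-)complex scalar. -/
def scal (κ : Kind) {n : ℕ} (a : ℝ × ℝ) (z : Vec n) : Vec n := fun j => mul κ a (z j)

/-- The (para-)complex structure of the vector space: `J (x, y) = (-ε y, x)`. -/
def vecJ (κ : Kind) {n : ℕ} (z : Vec n) : Vec n := scal κ (0, 1) z

/-- The hyperquadric `⟨z, z⟩ = ε / c`. -/
abbrev Quadric (κ : Kind) (n : ℕ) (c : ℝ) := {z : Vec n // form κ z z = κ.eps / c}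

lemma form_scal (κ : Kind) {n : ℕ} (a : ℝ × ℝ) (z : Vec n) :
    form κ (scal κ a z) (scal κ a z) = nu κ a * form κ z z := by
  simp only [form, Finset.mul_sum]
  refine Finset.sum_congr rfl fun j _ => ?_
  simp only [scal, mul, nu]
  ring

lemma form_smul (κ : Kind) {n : ℕ} (t : ℝ) (z : Vec n) :
    form κ (t • z) (t • z) = t ^ 2 * form κ z z := by
  simp only [form, Finset.mul_sum]
  refine Finset.sum_congr rfl fun j _ => ?_
  simp only [Pi.smul_apply, Prod.smul_fst, Prod.smul_snd, smul_eq_mul]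
  ring

lemma form_eq_sum_nu (κ : Kind) {n : ℕ} (z : Vec n) :
    form κ z z = ∑ j : Fin (n + 1), κ.sgn j * nu κ (z j) := by
  refine Finset.sum_congr rfl fun j _ => ?_
  simp only [nu]; ring

lemma continuous_form (κ : Kind) {n : ℕ} : Continuous fun z : Vec n => form κ z z := by
  unfold form; fun_prop

/-- `z ∼ z'` when `z' = (cos θ, sin θ) z`, resp. `z' = (cosh θ, sinh θ) z`, for some `θ`. -/
instance quadricSetoid (κ : Kind) (n : ℕ) (c : ℝ) : Setoid (Quadric κ n c) where
  r z z' := ∃ θ : ℝ, z'.1 = scal κ (unit κ θ) z.1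
  iseqv :=
    { refl := fun z => ⟨0, by funext j; simp [scal, unit_zero, one_mul']⟩
      symm := by
        rintro z z' ⟨θ, h⟩
        refine ⟨-θ, ?_⟩
        funext j
        rw [h]
        simp only [scal]
        rw [← mul_assoc', ← unit_add, neg_add_cancel, unit_zero, one_mul']
      trans := by
        rintro z z' z'' ⟨θ, h⟩ ⟨θ', h'⟩
        refine ⟨θ' + θ, ?_⟩
        funext j
        rw [h', h]
        simp only [scal]
        rw [← mul_assoc', ← unit_add] }

/-- The space form of constant (para-)holomorphic curvature `4c`, as the quotient of the
hyperquadric. For `c = ±1` it is `ℂP^n_{p,c}` in the case `cplx p`; in the case `para` it is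
`𝔻P^n` for `c = 1` and its polar space for `c = -1`. -/
def SpaceForm (κ : Kind) (n : ℕ) (c : ℝ) := Quotient (quadricSetoid κ n c)

instance (κ : Kind) (n : ℕ) (c : ℝ) : TopologicalSpace (SpaceForm κ n c) :=
  inferInstanceAs (TopologicalSpace (Quotient (quadricSetoid κ n c)))

/-- The projection of the hyperquadric onto the space form. -/
def pr (κ : Kind) (n : ℕ) (c : ℝ) (z : Quadric κ n c) : SpaceForm κ n c :=
  Quotient.mk _ z

/-- The extension `z ↦ π (z / √(c ε ⟨z, z⟩))` of the projection to the open cone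
`0 < c ε ⟨z, z⟩`. (Outside of the cone, the value is the irrelevant `q`.) -/
def proj (κ : Kind) (n : ℕ) (c : ℝ) (q : SpaceForm κ n c) (z : Vec n) : SpaceForm κ n c :=
  open Classical in
  if h : form κ (Real.sqrt (κ.eps / c / form κ z z) • z)
      (Real.sqrt (κ.eps / c / form κ z z) • z) = κ.eps / c then pr κ n c ⟨_, h⟩ else q

lemma isQuotientMap_pr (κ : Kind) (n : ℕ) (c : ℝ) : Topology.IsQuotientMap (pr κ n c) :=
  isQuotientMap_quotient_mk'

lemma scaled_mem {κ : Kind} {n : ℕ} {c : ℝ} {z : Vec n} (h : 0 < κ.eps / c * form κ z z) :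
    form κ (Real.sqrt (κ.eps / c / form κ z z) • z)
      (Real.sqrt (κ.eps / c / form κ z z) • z) = κ.eps / c := by
  have h0 : form κ z z ≠ 0 := by rintro h0; simp [h0] at h
  have h1 : 0 ≤ κ.eps / c / form κ z z := by
    rw [div_eq_mul_inv _ (form κ z z)]
    rcases lt_or_gt_of_ne h0 with h2 | h2
    · exact mul_nonneg_of_nonpos_of_nonpos (by nlinarith) (inv_nonpos.mpr h2.le)
    · exact mul_nonneg (by nlinarith) (inv_nonneg.mpr h2.le)
  rw [form_smul, Real.sq_sqrt h1, div_mul_cancel₀ _ h0]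

lemma proj_of_pos {κ : Kind} {n : ℕ} {c : ℝ} (q : SpaceForm κ n c) {z : Vec n}
    (h : 0 < κ.eps / c * form κ z z) : proj κ n c q z = pr κ n c ⟨_, scaled_mem h⟩ := by
  unfold proj
  rw [dif_pos (scaled_mem h)]

lemma continuousOn_proj (κ : Kind) (n : ℕ) (c : ℝ) (q : SpaceForm κ n c) :
    ContinuousOn (proj κ n c q) {z | 0 < κ.eps / c * form κ z z} := by
  rw [continuousOn_iff_continuous_domRestrict]
  have : Set.domRestrict {z | 0 < κ.eps / c * form κ z z} (proj κ n c q) =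
      fun z => pr κ n c ⟨_, scaled_mem z.2⟩ := by
    funext z; exact proj_of_pos q z.2
  rw [this]
  refine (isQuotientMap_pr κ n c).continuous.comp ?_
  refine Continuous.subtype_mk ?_ _
  have hc : Continuous fun z : {z : Vec n | 0 < κ.eps / c * form κ z z} =>
      form κ z.1 z.1 := (continuous_form κ).comp continuous_subtype_val
  refine Continuous.smul (Real.continuous_sqrt.comp (continuous_const.div hc ?_))
    continuous_subtype_val
  rintro ⟨z, hz⟩ h0
  simp only [Set.mem_ofPred_eq] at hz
  simp [h0] at hz

/-! ### The affine charts

For an index `k` and an invertible number `e`, the chart is defined on the classes of `z` whose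
coordinate `z k` is a positive multiple of some `unit θ · e`, and it sends the class of `z` to
the quotients `z j / z k`, `j ≠ k`. -/

/-- The affine coordinates of the class of `z`. -/
def affine (κ : Kind) {n : ℕ} (k : Fin (n + 1)) (z : Vec n) : Model n :=
  fun j => mul κ (inv κ (z k)) (z (k.succAbove j))

/-- The vector with `k`-th coordinate `e` and with affine coordinates `w`. -/
def homog (κ : Kind) {n : ℕ} (k : Fin (n + 1)) (e : ℝ × ℝ) (w : Model n) : Vec n :=
  scal κ e (k.insertNth (α := fun _ => ℝ × ℝ) (1, 0) w)

/-- The vectors whose classes form the domain of a chart. -/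
def chartDom (κ : Kind) {n : ℕ} (k : Fin (n + 1)) (e : ℝ × ℝ) : Set (Vec n) :=
  {z | Pos κ (mul κ (inv κ e) (z k))}

lemma homog_self (κ : Kind) {n : ℕ} (k : Fin (n + 1)) (e : ℝ × ℝ) (w : Model n) :
    homog κ k e w k = e := by
  simp [homog, scal, mul_comm' κ e, one_mul']

lemma homog_succAbove (κ : Kind) {n : ℕ} (k : Fin (n + 1)) (e : ℝ × ℝ) (w : Model n)
    (j : Fin n) : homog κ k e w (k.succAbove j) = mul κ e (w j) := by
  simp [homog, scal]

lemma nu_ne_of_chartDom {κ : Kind} {n : ℕ} {k : Fin (n + 1)} {e : ℝ × ℝ} {z : Vec n}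
    (hz : z ∈ chartDom κ k e) : nu κ (z k) ≠ 0 := by
  have := Pos.nu_pos hz
  rw [nu_mul] at this
  exact right_ne_zero_of_mul this.ne'

lemma affine_scal (κ : Kind) {n : ℕ} (k : Fin (n + 1)) {u : ℝ × ℝ} (hu : nu κ u ≠ 0)
    {z : Vec n} (hz : nu κ (z k) ≠ 0) : affine κ k (scal κ u z) = affine κ k z := by
  funext j
  exact div_mul_mul κ hu hz _

lemma smul_eq_scal (κ : Kind) {n : ℕ} (t : ℝ) (z : Vec n) : t • z = scal κ (t, 0) z := by
  funext j
  ext <;> simp [scal, mul]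

lemma nu_real (κ : Kind) (t : ℝ) : nu κ (t, 0) = t ^ 2 := by simp [nu]

lemma affine_homog (κ : Kind) {n : ℕ} (k : Fin (n + 1)) {e : ℝ × ℝ} (he : nu κ e ≠ 0)
    (w : Model n) : affine κ k (homog κ k e w) = w := by
  funext j
  simp only [affine, homog_self, homog_succAbove]
  rw [← mul_assoc', inv_mul κ he, one_mul']

lemma homog_affine (κ : Kind) {n : ℕ} (k : Fin (n + 1)) (e : ℝ × ℝ) {z : Vec n}
    (hz : nu κ (z k) ≠ 0) :
    homog κ k e (affine κ k z) = scal κ (mul κ e (inv κ (z k))) z := by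
  funext j
  rcases Fin.eq_self_or_eq_succAbove k j with rfl | ⟨i, rfl⟩
  · rw [homog_self]
    simp only [scal]
    rw [mul_assoc', inv_mul κ hz, mul_comm', one_mul']
  · rw [homog_succAbove]
    simp only [scal, affine]
    rw [mul_assoc']

lemma scal_scal (κ : Kind) {n : ℕ} (a b : ℝ × ℝ) (z : Vec n) :
    scal κ a (scal κ b z) = scal κ (mul κ a b) z := by
  funext j
  simp only [scal, mul_assoc']

lemma scal_mem_chartDom {κ : Kind} {n : ℕ} {k : Fin (n + 1)} {e a : ℝ × ℝ} {z : Vec n}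
    (ha : Pos κ a) (hz : z ∈ chartDom κ k e) : scal κ a z ∈ chartDom κ k e := by
  simp only [chartDom, Set.mem_ofPred_eq, scal] at hz ⊢
  rw [mul_left_comm']
  exact ha.mul hz

lemma scal_pos_of_chartDom {κ : Kind} {n : ℕ} {k : Fin (n + 1)} {e : ℝ × ℝ} (he : nu κ e ≠ 0)
    {z : Vec n} (hz : z ∈ chartDom κ k e) : Pos κ (mul κ e (inv κ (z k))) := by
  have hk := nu_ne_of_chartDom hz
  have h := Pos.inv hz
  have h2 : mul κ (inv κ (mul κ (inv κ e) (z k))) (mul κ (inv κ e) e) =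
      mul κ (inv κ (z k)) e :=
    div_mul_mul κ (by rw [nu_inv]; exact inv_ne_zero he) hk e
  rw [inv_mul κ he, mul_comm', one_mul'] at h2
  rw [mul_comm', ← h2]
  exact h

lemma continuous_homog (κ : Kind) {n : ℕ} (k : Fin (n + 1)) (e : ℝ × ℝ) :
    Continuous (homog κ k e) := by
  refine continuous_pi fun j => ?_
  rcases Fin.eq_self_or_eq_succAbove k j with rfl | ⟨i, rfl⟩
  · simp only [homog_self]; exact continuous_const
  · simp only [homog_succAbove]; exact (continuous_mul κ e).comp (continuous_apply i)

lemma continuousOn_affine (κ : Kind) {n : ℕ} (k : Fin (n + 1)) :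
    ContinuousOn (affine κ k) {z : Vec n | nu κ (z k) ≠ 0} := by
  have h : Continuous fun z : Vec n => nu κ (z k) := (continuous_nu κ).comp (continuous_apply k)
  refine continuousOn_pi.mpr fun j => ?_
  have e1 : ContinuousOn (fun z : Vec n => (z k).1 / nu κ (z k)) {z | nu κ (z k) ≠ 0} :=
    ContinuousOn.div (by fun_prop) h.continuousOn fun z hz => hz
  have e2 : ContinuousOn (fun z : Vec n => -(z k).2 / nu κ (z k)) {z | nu κ (z k) ≠ 0} :=
    ContinuousOn.div (by fun_prop) h.continuousOn fun z hz => hz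
  simp only [affine, mul, inv]
  fun_prop

lemma isOpen_chartDom (κ : Kind) {n : ℕ} (k : Fin (n + 1)) (e : ℝ × ℝ) :
    IsOpen (chartDom (n := n) κ k e) :=
  (isOpen_pos κ).preimage ((continuous_mul κ _).comp (continuous_apply k))

/-- The domain of a chart. -/
def chartSource (κ : Kind) (n : ℕ) (c : ℝ) (k : Fin (n + 1)) (e : ℝ × ℝ) :
    Set (SpaceForm κ n c) :=
  {q | ∃ z : Quadric κ n c, pr κ n c z = q ∧ z.1 ∈ chartDom κ k e}

lemma pr_eq_iff {κ : Kind} {n : ℕ} {c : ℝ} {z z' : Quadric κ n c} :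
    pr κ n c z = pr κ n c z' ↔ ∃ θ : ℝ, z'.1 = scal κ (unit κ θ) z.1 :=
  Quotient.eq

lemma pr_mem_chartSource {κ : Kind} {n : ℕ} {c : ℝ} {k : Fin (n + 1)} {e : ℝ × ℝ}
    {z : Quadric κ n c} : pr κ n c z ∈ chartSource κ n c k e ↔ z.1 ∈ chartDom κ k e := by
  constructor
  · rintro ⟨z', h, hz'⟩
    obtain ⟨θ, hθ⟩ := pr_eq_iff.mp h
    rw [hθ]
    exact scal_mem_chartDom (pos_unit κ θ) hz'
  · intro h
    exact ⟨z, rfl, h⟩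

open Classical in
/-- The affine coordinates on the quotient. (They do not depend on the representative where the
`k`-th coordinate is invertible; elsewhere the value is the irrelevant `0`.) -/
def chartFun (κ : Kind) (n : ℕ) (c : ℝ) (k : Fin (n + 1)) (q : SpaceForm κ n c) : Model n :=
  Quotient.lift
    (fun z : Quadric κ n c => if nu κ (z.1 k) ≠ 0 then affine κ k z.1 else 0)
    (by
      rintro z z' ⟨θ, h⟩
      have hu : nu κ (unit κ θ) ≠ 0 := by rw [nu_unit]; exact one_ne_zero
      have hn : nu κ (z'.1 k) = nu κ (z.1 k) := by
        rw [h]; simp only [scal, nu_mul, nu_unit, one_mul]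
      simp only [hn]
      split_ifs with h0
      · rw [h, affine_scal κ k hu h0]
      · rfl) q

lemma chartFun_pr {κ : Kind} {n : ℕ} {c : ℝ} {k : Fin (n + 1)} {z : Quadric κ n c}
    (hz : nu κ (z.1 k) ≠ 0) : chartFun κ n c k (pr κ n c z) = affine κ k z.1 :=
  if_pos hz

/-- The image of a chart. -/
def chartTarget (κ : Kind) (n : ℕ) (c : ℝ) (k : Fin (n + 1)) (e : ℝ × ℝ) : Set (Model n) :=
  {w | 0 < κ.eps / c * form κ (homog κ k e w) (homog κ k e w)}

lemma affine_mem_chartTarget {κ : Kind} {n : ℕ} {c : ℝ} [NeZero c] {k : Fin (n + 1)}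
    {e : ℝ × ℝ} (he : nu κ e ≠ 0) {z : Quadric κ n c} (hz : z.1 ∈ chartDom κ k e) :
    affine κ k z.1 ∈ chartTarget κ n c k e := by
  simp only [chartTarget, Set.mem_ofPred_eq]
  rw [homog_affine κ k e (nu_ne_of_chartDom hz), form_scal, z.2]
  have h1 := (scal_pos_of_chartDom he hz).nu_pos
  have h2 : κ.eps / c ≠ 0 := div_ne_zero (eps_ne κ) (NeZero.ne c)
  have h3 := mul_self_pos.mpr h2
  have := mul_pos h1 h3
  linarith

lemma ratio_pos {κ : Kind} {n : ℕ} {c : ℝ} {z : Vec n} (h : 0 < κ.eps / c * form κ z z) :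
    0 < Real.sqrt (κ.eps / c / form κ z z) := by
  have h0 : form κ z z ≠ 0 := by rintro h0; simp [h0] at h
  refine Real.sqrt_pos.mpr ?_
  have : κ.eps / c / form κ z z = (κ.eps / c * form κ z z) / (form κ z z) ^ 2 := by
    field_simp
  rw [this]
  exact div_pos h (by positivity)

lemma pos_real (κ : Kind) {t : ℝ} (ht : 0 < t) : Pos κ (t, 0) := by
  have := (pos_one κ).smul ht
  simpa using this

/-- The affine chart with index `k` on the component of `e`. -/
def chart (κ : Kind) (n : ℕ) (c : ℝ) [NeZero c] (q : SpaceForm κ n c) (k : Fin (n + 1))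
    (e : ℝ × ℝ) (he : nu κ e ≠ 0) : OpenPartialHomeomorph (SpaceForm κ n c) (Model n) where
  toFun := chartFun κ n c k
  invFun := fun w => proj κ n c q (homog κ k e w)
  source := chartSource κ n c k e
  target := chartTarget κ n c k e
  map_source' := by
    rintro _ ⟨z, rfl, hz⟩
    rw [chartFun_pr (nu_ne_of_chartDom hz)]
    exact affine_mem_chartTarget he hz
  map_target' := by
    intro w (hw : 0 < κ.eps / c * form κ (homog κ k e w) (homog κ k e w))
    rw [proj_of_pos q hw, pr_mem_chartSource]
    simp only
    rw [smul_eq_scal κ]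
    refine scal_mem_chartDom (pos_real κ (ratio_pos hw)) ?_
    simp only [chartDom, Set.mem_ofPred_eq]
    rw [homog_self, inv_mul κ he]
    exact pos_one κ
  left_inv' := by
    rintro _ ⟨z, rfl, hz⟩
    have hw : 0 < κ.eps / c * form κ (homog κ k e (affine κ k z.1))
      (homog κ k e (affine κ k z.1)) := affine_mem_chartTarget he hz
    rw [chartFun_pr (nu_ne_of_chartDom hz), proj_of_pos q hw, eq_comm, pr_eq_iff]
    have hp := (pos_real κ (ratio_pos hw)).mul (scal_pos_of_chartDom he hz)
    have key := scaled_mem hw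
    have e1 := homog_affine κ k e (nu_ne_of_chartDom hz)
    have e2 : Real.sqrt (κ.eps / c / form κ (homog κ k e (affine κ k z.1))
          (homog κ k e (affine κ k z.1))) • homog κ k e (affine κ k z.1) =
        scal κ (mul κ (Real.sqrt (κ.eps / c / form κ (homog κ k e (affine κ k z.1))
          (homog κ k e (affine κ k z.1))), 0) (mul κ e (inv κ (z.1 k)))) z.1 := by
      rw [smul_eq_scal κ]
      nth_rw 3 [e1]
      rw [scal_scal]
    rw [e2, form_scal, z.2] at key
    have h2 : κ.eps / c ≠ 0 := div_ne_zero (eps_ne κ) (NeZero.ne c)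
    obtain ⟨θ, hθ⟩ := hp.exists_unit (mul_right_cancel₀ h2 (by rw [key, one_mul]))
    exact ⟨θ, by rw [← hθ]; exact e2⟩
  right_inv' := by
    intro w (hw : 0 < κ.eps / c * form κ (homog κ k e w) (homog κ k e w))
    have hr := ratio_pos hw
    have hk : nu κ (homog κ k e w k) ≠ 0 := by rw [homog_self]; exact he
    have hr' : nu κ (Real.sqrt (κ.eps / c / form κ (homog κ k e w) (homog κ k e w)), 0) ≠ 0 :=
      (pos_real κ hr).nu_pos.ne'
    rw [proj_of_pos q hw, chartFun_pr]
    · simp only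
      rw [smul_eq_scal κ, affine_scal κ k hr' hk, affine_homog κ k he]
    · simp only [smul_eq_scal κ, scal, nu_mul]
      exact mul_ne_zero hr' hk
  open_source := by
    rw [← (isQuotientMap_pr κ n c).isOpen_preimage]
    have : pr κ n c ⁻¹' chartSource κ n c k e = Subtype.val ⁻¹' chartDom κ k e := by
      ext z; exact pr_mem_chartSource
    rw [this]
    exact (isOpen_chartDom κ k e).preimage continuous_subtype_val
  open_target :=
    isOpen_lt continuous_const
      (continuous_const.mul ((continuous_form κ).comp (continuous_homog κ k e)))
  continuousOn_toFun := by
    have ho : IsOpen (chartSource κ n c k e) := by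
      rw [← (isQuotientMap_pr κ n c).isOpen_preimage]
      have : pr κ n c ⁻¹' chartSource κ n c k e = Subtype.val ⁻¹' chartDom κ k e := by
        ext z; exact pr_mem_chartSource
      rw [this]
      exact (isOpen_chartDom κ k e).preimage continuous_subtype_val
    rw [(isQuotientMap_pr κ n c).continuousOn_isOpen_iff ho]
    have h : ContinuousOn (fun z : Quadric κ n c => affine κ k z.1)
        (pr κ n c ⁻¹' chartSource κ n c k e) :=
      (continuousOn_affine κ k).comp continuous_subtype_val.continuousOn
        fun z hz => nu_ne_of_chartDom (pr_mem_chartSource.mp hz)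
    exact h.congr fun z hz => chartFun_pr (nu_ne_of_chartDom (pr_mem_chartSource.mp hz))
  continuousOn_invFun :=
    (continuousOn_proj κ n c q).comp (continuous_homog κ k e).continuousOn fun _ hw => hw

lemma exists_coord {κ : Kind} {n : ℕ} {c : ℝ} [NeZero c] (z : Quadric κ n c) :
    ∃ k, nu κ (z.1 k) ≠ 0 := by
  by_contra! h
  have h1 := z.2
  rw [form_eq_sum_nu, Finset.sum_eq_zero (fun j _ => by rw [h j, mul_zero])] at h1
  exact div_ne_zero (eps_ne κ) (NeZero.ne c) h1.symm

/-- An index of an invertible coordinate of a representative of `q`. -/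
def coordAt {κ : Kind} {n : ℕ} {c : ℝ} [NeZero c] (q : SpaceForm κ n c) : Fin (n + 1) :=
  (exists_coord (Quotient.out q)).choose

/-- The representative of `q` chosen by `Quotient.out`, as a vector. -/
def rep {κ : Kind} {n : ℕ} {c : ℝ} (q : SpaceForm κ n c) : Vec n := (Quotient.out q).1

/-- A chart around `q`. -/
def chartNear {κ : Kind} {n : ℕ} {c : ℝ} [NeZero c] (q : SpaceForm κ n c) :
    OpenPartialHomeomorph (SpaceForm κ n c) (Model n) :=
  chart κ n c q (coordAt q) (rep q (coordAt q)) (exists_coord (Quotient.out q)).choose_spec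

lemma mem_chartNear_source {κ : Kind} {n : ℕ} {c : ℝ} [NeZero c] (q : SpaceForm κ n c) :
    q ∈ (chartNear q).source := by
  refine ⟨Quotient.out q, Quotient.out_eq q, ?_⟩
  have h : nu κ (rep q (coordAt q)) ≠ 0 := (exists_coord (Quotient.out q)).choose_spec
  change Pos κ (mul κ (inv κ (rep q (coordAt q))) (rep q (coordAt q)))
  rw [inv_mul κ h]
  exact pos_one κ

instance (κ : Kind) (n : ℕ) (c : ℝ) [NeZero c] : ChartedSpace (Model n) (SpaceForm κ n c) where
  atlas := Set.range chartNear
  chartAt := chartNear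
  mem_chart_source := mem_chartNear_source
  chart_mem_atlas := Set.mem_range_self

lemma contDiffOn_transition (κ : Kind) {n : ℕ} (k l : Fin (n + 1)) (e : ℝ × ℝ) :
    ContDiffOn ℝ ∞ (fun w : Model n => affine κ l (homog κ k e w))
      {w | nu κ (homog κ k e w l) ≠ 0} := by
  have hh : ContDiff ℝ ∞ (homog (n := n) κ k e) := by
    refine contDiff_pi.mpr fun j => ?_
    rcases Fin.eq_self_or_eq_succAbove k j with rfl | ⟨i, rfl⟩
    · simp only [homog_self]; exact contDiff_const
    · simp only [homog_succAbove, mul]; fun_prop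
  have h1 : ∀ j, ContDiff ℝ ∞ fun w : Model n => homog κ k e w j := fun j =>
    contDiff_pi.mp hh j
  have h2 : ∀ j, ContDiff ℝ ∞ fun w : Model n => (homog κ k e w j).1 := fun j => (h1 j).fst
  have h3 : ∀ j, ContDiff ℝ ∞ fun w : Model n => (homog κ k e w j).2 := fun j => (h1 j).snd
  have h4 : ContDiff ℝ ∞ fun w : Model n => nu κ (homog κ k e w l) := by
    simp only [nu]
    exact ((h2 l).pow 2).add (contDiff_const.mul ((h3 l).pow 2))
  have e1 : ContDiffOn ℝ ∞ (fun w : Model n => (homog κ k e w l).1 / nu κ (homog κ k e w l))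
      {w | nu κ (homog κ k e w l) ≠ 0} :=
    (h2 l).contDiffOn.div h4.contDiffOn fun w hw => hw
  have e2 : ContDiffOn ℝ ∞ (fun w : Model n => -(homog κ k e w l).2 / nu κ (homog κ k e w l))
      {w | nu κ (homog κ k e w l) ≠ 0} :=
    (h3 l).neg.contDiffOn.div h4.contDiffOn fun w hw => hw
  refine contDiffOn_pi.mpr fun j => ?_
  have f1 := (h2 (l.succAbove j)).contDiffOn (s := {w | nu κ (homog κ k e w l) ≠ 0})
  have f2 := (h3 (l.succAbove j)).contDiffOn (s := {w | nu κ (homog κ k e w l) ≠ 0})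
  simp only [affine, mul, inv]
  exact ((e1.mul f1).sub (contDiffOn_const.mul (e2.mul f2))).prodMk ((e1.mul f2).add (e2.mul f1))

instance (κ : Kind) (n : ℕ) (c : ℝ) [NeZero c] :
    IsManifold 𝓘(ℝ, Model n) ∞ (SpaceForm κ n c) := by
  apply isManifold_of_contDiffOn
  rintro _ _ ⟨q, rfl⟩ ⟨q', rfl⟩
  simp only [modelWithCornersSelf_coe, modelWithCornersSelf_coe_symm, Set.range_id, Set.inter_univ,
    Set.preimage_id, Function.id_comp, Function.comp_id]
  have aux : ∀ w ∈ ((chartNear q).symm ≫ₕ chartNear q').source,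
      nu κ (homog κ (coordAt q) (rep q (coordAt q)) w (coordAt q')) ≠ 0 ∧
      ((chartNear q).symm ≫ₕ chartNear q') w =
        affine κ (coordAt q') (homog κ (coordAt q) (rep q (coordAt q)) w) := by
    intro w hw
    rw [OpenPartialHomeomorph.trans_source] at hw
    obtain ⟨hw1, hw2⟩ := hw
    have hw1 : 0 < κ.eps / c * form κ (homog κ (coordAt q) (rep q (coordAt q)) w)
      (homog κ (coordAt q) (rep q (coordAt q)) w) := hw1
    have hw2 : proj κ n c q (homog κ (coordAt q) (rep q (coordAt q)) w) ∈
      chartSource κ n c (coordAt q') (rep q' (coordAt q')) := hw2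
    rw [proj_of_pos q hw1, pr_mem_chartSource] at hw2
    have h3 := nu_ne_of_chartDom hw2
    have h4 : nu κ (homog κ (coordAt q) (rep q (coordAt q)) w (coordAt q')) ≠ 0 := by
      intro h0
      apply h3
      simp only
      rw [smul_eq_scal κ]
      simp only [scal, nu_mul, h0, mul_zero]
    refine ⟨h4, ?_⟩
    change chartFun κ n c (coordAt q')
      (proj κ n c q (homog κ (coordAt q) (rep q (coordAt q)) w)) = _
    rw [proj_of_pos q hw1, chartFun_pr h3]
    simp only
    rw [smul_eq_scal κ, affine_scal κ _ (pos_real κ (ratio_pos hw1)).nu_pos.ne' h4]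
  exact ((contDiffOn_transition κ _ _ _).mono fun w hw => (aux w hw).1).congr
    fun w hw => (aux w hw).2

/-! ### The metric and the (para-)complex structure of the quotient -/

section geometry

variable {κ : Kind} {n : ℕ} {c : ℝ} [NeZero c]

/-- The tangent space of the space form at `q`. -/
abbrev Tan (q : SpaceForm κ n c) := TangentSpace 𝓘(ℝ, Model n) q

/-- The differential at `rep q` of the projection, as a map to the tangent space at `q`. -/
def dproj (q : SpaceForm κ n c) (v : Vec n) : Tan q :=
  mfderiv 𝓘(ℝ, Vec n) 𝓘(ℝ, Model n) (proj κ n c q) (rep q) v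

/-- `v` is tangent to the hyperquadric at `rep q` and orthogonal to the fibre. -/
def IsHorizontal (q : SpaceForm κ n c) (v : Vec n) : Prop :=
  form κ (rep q) v = 0 ∧ form κ (vecJ κ (rep q)) v = 0

/-- The horizontal lift to `rep q` of a tangent vector at `q`. -/
def hlift (q : SpaceForm κ n c) (u : Tan q) : Vec n :=
  Classical.epsilon fun v => IsHorizontal q v ∧ dproj q v = u

/-- The metric that makes the projection a pseudo-Riemannian submersion. -/
def metric (q : SpaceForm κ n c) (u v : Tan q) : ℝ := form κ (hlift q u) (hlift q v)

/-- The (para-)complex structure `J` induced by the one of the vector space. -/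
def structJ (q : SpaceForm κ n c) (u : Tan q) : Tan q := dproj q (vecJ κ (hlift q u))

/-- An affine connection on the space form. -/
abbrev Connection (κ : Kind) (n : ℕ) (c : ℝ) [NeZero c] :=
  CovariantDerivative 𝓘(ℝ, Model n) (Model n)
    (TangentSpace 𝓘(ℝ, Model n) : SpaceForm κ n c → Type _)

/-- Differentiability of a vector field at a point. -/
def VFDiffAt (Y : Π q : SpaceForm κ n c, Tan q) (q : SpaceForm κ n c) : Prop :=
  MDifferentiableAt 𝓘(ℝ, Model n) 𝓘(ℝ, Model n).tangent
    (fun p => (⟨p, Y p⟩ : TangentBundle 𝓘(ℝ, Model n) (SpaceForm κ n c))) q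

/-- The Levi-Civita connection: torsion-free and compatible with the metric. Here `cov Y q u` is
`∇_u Y` at `q`. -/
def IsLeviCivita (cov : Connection κ n c) : Prop :=
  cov.torsion = 0 ∧
  ∀ (q : SpaceForm κ n c) (Y Z : Π q : SpaceForm κ n c, Tan q),
    VFDiffAt Y q → VFDiffAt Z q → ∀ u : Tan q,
      mvfderiv 𝓘(ℝ, Model n) (fun p => metric p (Y p) (Z p)) q u =
        metric q (cov Y q u) (Z q) + metric q (Y q) (cov Z q u)

/-! ### Real hypersurfaces -/

variable {S : Type*} [TopologicalSpace S] [ChartedSpace (EuclideanSpace ℝ (Fin (2 * n - 1))) S]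

/-- The differential of a map from a `(2n-1)`-dimensional manifold to the space form. -/
abbrev dmap (F : S → SpaceForm κ n c) (x : S) :
    TangentSpace (𝓡 (2 * n - 1)) x →L[ℝ] Tan (F x) :=
  mfderiv (𝓡 (2 * n - 1)) 𝓘(ℝ, Model n) F x

/-- `F` is an immersed real hypersurface whose induced metric is non-degenerate. -/
structure IsNondegenerateHypersurface (F : S → SpaceForm κ n c) : Prop where
  smooth : ContMDiff (𝓡 (2 * n - 1)) 𝓘(ℝ, Model n) ∞ F
  immersion : ∀ x, Function.Injective (dmap F x)
  nondegenerate : ∀ x (v : TangentSpace (𝓡 (2 * n - 1)) x),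
    (∀ w : TangentSpace (𝓡 (2 * n - 1)) x, metric (F x) (dmap F x v) (dmap F x w) = 0) → v = 0

/-- `N` is a smooth unit normal vector field, `⟨N, N⟩ = ±1`, along the open piece `U` of the
hypersurface. -/
structure IsUnitNormalOn (F : S → SpaceForm κ n c) (U : Set S) (N : Π x : S, Tan (F x)) :
    Prop where
  isOpen : IsOpen U
  smooth : ContMDiffOn (𝓡 (2 * n - 1)) 𝓘(ℝ, Model n).tangent ∞
    (fun x => (⟨F x, N x⟩ : TangentBundle 𝓘(ℝ, Model n) (SpaceForm κ n c))) U
  normal : ∀ x ∈ U, ∀ v : TangentSpace (𝓡 (2 * n - 1)) x, metric (F x) (dmap F x v) (N x) = 0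
  unit : ∀ x ∈ U, metric (F x) (N x) (N x) = 1 ∨ metric (F x) (N x) (N x) = -1

/-- `A` is the shape operator at `x` with respect to the unit normal field `N`, given by the
Weingarten formula `∇_X N = -A X`. Since `∇` acts on vector fields of the ambient space, `N` is
extended, near `x`, to such a field; the derivative in the direction of a tangent vector of the
hypersurface does not depend on the extension. -/
def IsShapeOperatorAt (cov : Connection κ n c) (F : S → SpaceForm κ n c)
    (N : Π x : S, Tan (F x)) (x : S)
    (A : TangentSpace (𝓡 (2 * n - 1)) x →ₗ[ℝ] TangentSpace (𝓡 (2 * n - 1)) x) : Prop :=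
  ∀ N' : Π q : SpaceForm κ n c, Tan q, VFDiffAt N' (F x) →
    (∀ᶠ y in 𝓝 x, N' (F y) = N y) →
    ∀ v : TangentSpace (𝓡 (2 * n - 1)) x, cov N' (F x) (dmap F x v) = -dmap F x (A v)

/-- `ξ` is the structure vector `-ε J N` at `x`. -/
def IsStructureVectorAt (F : S → SpaceForm κ n c) (N : Π x : S, Tan (F x)) (x : S)
    (ξ : TangentSpace (𝓡 (2 * n - 1)) x) : Prop :=
  dmap F x ξ = -κ.eps • structJ (F x) (N x)

/-- `A ξ = a ξ` at `x`: the structure vector is principal with principal curvature `a`. -/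
def IsHopfCurvatureAt (cov : Connection κ n c) (F : S → SpaceForm κ n c)
    (N : Π x : S, Tan (F x)) (x : S) (a : ℝ) : Prop :=
  ∃ A ξ, IsShapeOperatorAt cov F N x A ∧ IsStructureVectorAt F N x ξ ∧ A ξ = a • ξ

/-- The hypersurface is Hopf: the structure vector (of any local unit normal field) is
everywhere a principal direction. -/
def IsHopf (cov : Connection κ n c) (F : S → SpaceForm κ n c) : Prop :=
  ∀ (U : Set S) (N : Π x : S, Tan (F x)), IsUnitNormalOn F U N →
    ∀ x ∈ U, ∃ a : ℝ, IsHopfCurvatureAt cov F N x a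

end geometry

end SpaceForms

end

/-!
The space form is the quotient of a hyperquadric `⟨z, z⟩ = ε / c` in a flat vector space `V`, by the
flow of the vertical field `J z`. Everything is computed on local lifts. A hypersurface lifts to a map
`z` into the hyperquadric and a unit normal field to a horizontal field `ν`, so that `⟨ν, ν⟩ = σ = ±1`
and `ν` is orthogonal to `z`, `J z` and to the derivatives of `z`. The Levi-Civita connection is the
projection of the flat one (`dcoord_cov`), and `A ξ = a ξ` turns out to be an identity of 1-forms
(`hopf_identity`, `hopf_of_isHopfCurvatureAt`):
`⟨dν, J ν⟩ - εσ θ = -a μ`, with `θ = c ⟨dz, J z⟩` and `μ = ⟨dz, J ν⟩`.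
This is the structure `IsHopfLift`, and the claim becomes `da = 0` for it
(`IsHopfLift.fderiv_a_eq_zero`).

The exterior derivative of the identity (`hopf_exterior`), contracted with the structure vector, gives
`da ∧ μ = 0` (`da_wedge`). If `da` is nonzero at a point, then near it `da = β μ` with `β ≠ 0`, and
one more exterior derivative and contraction show that the contact form is closed, `dμ = 0`
(`eventually_closed`). This is impossible (`false_of_closed`), by an argument which uses no
diagonalization of the shape operator and hence works for every signature:

* Let `A` be the shape operator on the orthogonal complement of `z`, `J z`, `ν`, `J ν`, and `P` the
  projection onto this complement. Closedness of `μ` says that `A J = -J A` (`shape_J`), and then the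
  identity above says that `A² = -εσc P` (`shape_shape`).
* The projected derivative of `A`, diminished by `τ J A` with `τ = 2θ - εσa μ`, is totally symmetric,
  by the Codazzi equation, and anticommutes with `A`. Moving `A` from one argument to another yields
  contradictory signs, so it vanishes (`perp_shape_deriv_eq`).
* Thus `dA = τ J A + (dP) A + A (dP)`, and `d²A = 0` is an algebraic condition on `A`
  (`integrability_connForm`). On a vector `X` of the complement it gives `⟨X, X⟩ ⟨A X, X⟩ = 0`. As
  the complement is nonzero and non-degenerate for `n ≥ 2`, this forces `A = 0`, against
  `A² = -εσc P`.

Globally, a non-degenerate hypersurface has unit normal fields near each point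
(`exists_isUnitNormalOn`), and two of them agree up to sign, so that `a²` does not depend on the choice
(`hopfCurvature_sq_eq`). It is therefore a locally constant function on the connected hypersurface,
and on a connected open piece the continuous function `a` is one of the two square roots.
-/

noncomputable section

/-! ### First-order data of the lift of a Hopf hypersurface -/

namespace SpaceForms

variable {E : Type*} [NormedAddCommGroup E] [NormedSpace ℝ E]

lemma hasFDerivAt_fderiv_apply {F : Type*} [NormedAddCommGroup F] [NormedSpace ℝ F] {f : E → F}
    {x : E} (hf : ContDiffAt ℝ 2 f x) (v : E) :
    HasFDerivAt (fun y => fderiv ℝ f y v) ((fderiv ℝ (fderiv ℝ f) x).flip v) x := by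
  have h : DifferentiableAt ℝ (fderiv ℝ f) x :=
    (hf.fderiv_right (m := 1) (by norm_num)).differentiableAt (by norm_num)
  exact ((ContinuousLinearMap.apply ℝ F v).hasFDerivAt.comp x h.hasFDerivAt)

lemma fderiv_fderiv_comm {F : Type*} [NormedAddCommGroup F] [NormedSpace ℝ F] {f : E → F}
    {x : E} (hf : ContDiffAt ℝ 2 f x) (u v : E) :
    fderiv ℝ (fderiv ℝ f) x u v = fderiv ℝ (fderiv ℝ f) x v u :=
  (hf.isSymmSndFDerivAt (by simp)) u v

/-- The integrability condition `d²A = 0` for a solution `A` of `dA = τ jA + (dP) A + A (dP)`, where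
`j` commutes with `dP`: the second derivatives of `P` cancel and `dτ` is expressed by the commutator
of `dP` with itself. -/
lemma integrability {R : Type*} [NormedRing R] [NormedAlgebra ℝ R] {A P : E → R} {τ : E → E →L[ℝ] ℝ}
    {j : R} {x : E} (hA : ContDiffAt ℝ 2 A x) (hP : ContDiffAt ℝ 2 P x)
    (hτ : DifferentiableAt ℝ τ x)
    (hd : ∀ᶠ y in 𝓝 x, ∀ u, fderiv ℝ A y u =
      τ y u • (j * A y) + fderiv ℝ P y u * A y + A y * fderiv ℝ P y u)
    (hjP : ∀ u, fderiv ℝ P x u * j = j * fderiv ℝ P x u) (u v : E) :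
    (fderiv ℝ τ x u v - fderiv ℝ τ x v u) • (j * A x) =
      (fderiv ℝ P x u * fderiv ℝ P x v - fderiv ℝ P x v * fderiv ℝ P x u) * A x -
      A x * (fderiv ℝ P x u * fderiv ℝ P x v - fderiv ℝ P x v * fderiv ℝ P x u) := by
  have hA1 : HasFDerivAt A (fderiv ℝ A x) x := (hA.differentiableAt (by norm_num)).hasFDerivAt
  have key : ∀ u v, fderiv ℝ (fderiv ℝ A) x u v =
      fderiv ℝ τ x u v • (j * A x) + τ x v • (j * fderiv ℝ A x u)
      + (fderiv ℝ (fderiv ℝ P) x u v * A x + fderiv ℝ P x v * fderiv ℝ A x u)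
      + (fderiv ℝ A x u * fderiv ℝ P x v + A x * fderiv ℝ (fderiv ℝ P) x u v) := by
    intro u v
    have h1 := hasFDerivAt_fderiv_apply hA v
    have hPv := hasFDerivAt_fderiv_apply hP v
    have hτv : HasFDerivAt (fun y => τ y v) ((fderiv ℝ τ x).flip v) x :=
      (ContinuousLinearMap.apply ℝ ℝ v).hasFDerivAt.comp x hτ.hasFDerivAt
    have h2 := ((hτv.smul (hA1.const_mul j)).add (hPv.mul' hA1)).add (hA1.mul' hPv)
    have h3 := (h2.congr_of_eventuallyEq (hd.mono fun y hy => hy v)).unique h1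
    have := congrArg (fun l => l u) h3
    simp at this
    rw [← this]
    abel
  have hs := fderiv_fderiv_comm hA u v
  have hsP := fderiv_fderiv_comm hP u v
  have hdx := hd.self_of_nhds
  rw [key u v, key v u, hdx u, hdx v, hsP] at hs
  have e2 : ∀ u (y : R), fderiv ℝ P x u * (j * y) = j * (fderiv ℝ P x u * y) := fun u y => by
    rw [← mul_assoc, hjP, mul_assoc]
  rw [← sub_eq_zero] at hs ⊢
  rw [← hs]
  simp only [mul_add, add_mul, mul_smul_comm, smul_mul_assoc, sub_mul, mul_sub, mul_assoc, e2]
  module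

variable {V : Type*} [NormedAddCommGroup V] [NormedSpace ℝ V]

/-- `B` is a non-degenerate symmetric form and `J` a `B`-skew operator with `J² = -ε`, where
`ε = ±1`. -/
structure IsPseudoHermitian (B : V →L[ℝ] V →L[ℝ] ℝ) (J : V →L[ℝ] V) (ε : ℝ) : Prop where
  symm : ∀ x y, B x y = B y x
  nondeg : ∀ x, (∀ y, B x y = 0) → x = 0
  sq : ∀ x, J (J x) = -(ε • x)
  skew : ∀ x y, B (J x) y = -B x (J y)
  eps : ε * ε = 1

namespace IsPseudoHermitian

variable {B : V →L[ℝ] V →L[ℝ] ℝ} {J : V →L[ℝ] V} {ε : ℝ}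

lemma J_J (h : IsPseudoHermitian B J ε) (x y : V) : B (J x) (J y) = ε * B x y := by
  rw [h.skew, h.sq]; simp

lemma J_self (h : IsPseudoHermitian B J ε) (x : V) : B x (J x) = 0 := by
  have h1 := h.skew x x
  rw [h.symm (J x) x] at h1; linarith

lemma ext (h : IsPseudoHermitian B J ε) {x y : V} (hxy : ∀ w, B x w = B y w) : x = y := by
  rw [← sub_eq_zero]
  exact h.nondeg _ fun w => by simp [hxy w]

end IsPseudoHermitian

/-- The `B`-orthogonal projection along the (para-)complex span of `z` and `ν`, when
`⟨z, z⟩ = ε / c`, `⟨ν, ν⟩ = σ = ±1`, and `z`, `J z` are orthogonal to `ν`. -/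
def perpProj (B : V →L[ℝ] V →L[ℝ] ℝ) (J : V →L[ℝ] V) (ε c σ : ℝ) (z ν : V) : V →L[ℝ] V :=
  ContinuousLinearMap.id ℝ V - ((ε * c) • (B z).smulRight z + c • (B (J z)).smulRight (J z) +
    σ • (B ν).smulRight ν + (ε * σ) • (B (J ν)).smulRight (J ν))

/-- The first-order data at a point of the lift `z` of a Hopf hypersurface to the quadric
`⟨z, z⟩ = ε / c` and of its horizontally lifted unit normal `ν`, with derivatives `z'`, `ν'`. The
last field is the Hopf condition, as an identity between linear forms. -/
structure HopfJet (B : V →L[ℝ] V →L[ℝ] ℝ) (J : V →L[ℝ] V) (ε c σ : ℝ) (z ν : V)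
    (z' ν' : E →L[ℝ] V) (a : ℝ) : Prop where
  zz : c * B z z = ε
  zν : B z ν = 0
  Jzν : B (J z) ν = 0
  νν : B ν ν = σ
  z'z : ∀ u, B (z' u) z = 0
  z'ν : ∀ u, B (z' u) ν = 0
  ν'z : ∀ u, B (ν' u) z = 0
  ν'ν : ∀ u, B (ν' u) ν = 0
  ν'Jz : ∀ u, B (ν' u) (J z) = B (z' u) (J ν)
  symm : ∀ u v, B (ν' u) (z' v) = B (ν' v) (z' u)
  imm : ∀ u (β : ℝ), z' u = β • J z → u = 0
  hopf : ∀ u, B (ν' u) (J ν) - ε * σ * (c * B (z' u) (J z)) = -(a * B (z' u) (J ν))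

namespace HopfJet

variable {B : V →L[ℝ] V →L[ℝ] ℝ} {J : V →L[ℝ] V} {ε c σ a : ℝ} {z ν : V} {z' ν' : E →L[ℝ] V}

section K
variable (hB : IsPseudoHermitian B J ε) (hσ : σ * σ = 1)
  (h : HopfJet B J ε c σ z ν z' ν' a)
include hB h

lemma c_ne : c ≠ 0 := by
  rintro rfl
  have h1 := h.zz
  have h2 := hB.eps
  simp at h1
  simp [← h1] at h2

lemma cJzJz : c * B (J z) (J z) = 1 := by
  rw [hB.J_J, mul_left_comm, h.zz, hB.eps]

lemma zJν : B z (J ν) = 0 := by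
  have := hB.skew z ν
  rw [h.Jzν] at this; linarith

lemma JzJν : B (J z) (J ν) = 0 := by rw [hB.J_J, h.zν, mul_zero]

lemma JνJν : B (J ν) (J ν) = ε * σ := by rw [hB.J_J, h.νν]

omit h hB in
lemma perpProj_apply (w : V) : perpProj B J ε c σ z ν w =
    w - ((ε * c * B z w) • z + (c * B (J z) w) • J z + (σ * B ν w) • ν +
      (ε * σ * B (J ν) w) • J ν) := by
  simp [perpProj, smul_smul]

lemma perpProj_z : perpProj B J ε c σ z ν z = 0 := by
  rw [perpProj_apply, hB.symm (J z) z, hB.J_self, hB.symm ν z, h.zν, hB.symm (J ν) z, h.zJν hB,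
    mul_assoc, h.zz, hB.eps]
  simp

lemma perpProj_Jz : perpProj B J ε c σ z ν (J z) = 0 := by
  rw [perpProj_apply, hB.J_self, hB.symm ν, h.Jzν, hB.symm (J ν), h.JzJν hB, h.cJzJz hB]
  simp

include hσ in
lemma perpProj_ν : perpProj B J ε c σ z ν ν = 0 := by
  rw [perpProj_apply, hB.symm (J ν), hB.J_self, h.Jzν, h.zν, h.νν, hσ]
  simp

include hσ in
lemma perpProj_Jν : perpProj B J ε c σ z ν (J ν) = 0 := by
  rw [perpProj_apply, hB.J_self, h.zJν hB, h.JzJν hB, h.JνJν hB,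
    show ε * σ * (ε * σ) = (ε * ε) * (σ * σ) by ring, hB.eps, hσ]
  simp

omit h in
lemma perpProj_symm (p q : V) : B (perpProj B J ε c σ z ν p) q = B p (perpProj B J ε c σ z ν q) := by
  simp only [perpProj_apply, map_sub, map_add, map_smul, sub_apply,
    add_apply, smul_apply, smul_eq_mul]
  rw [hB.symm p z, hB.symm p ν, hB.symm p (J z), hB.symm p (J ν)]
  ring

lemma z_perpProj (p : V) : B z (perpProj B J ε c σ z ν p) = 0 := by
  rw [← perpProj_symm hB, h.perpProj_z hB]; simp

lemma Jz_perpProj (p : V) : B (J z) (perpProj B J ε c σ z ν p) = 0 := by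
  rw [← perpProj_symm hB, h.perpProj_Jz hB]; simp

include hσ in
lemma ν_perpProj (p : V) : B ν (perpProj B J ε c σ z ν p) = 0 := by
  rw [← perpProj_symm hB, h.perpProj_ν hB hσ]; simp

include hσ in
lemma Jν_perpProj (p : V) : B (J ν) (perpProj B J ε c σ z ν p) = 0 := by
  rw [← perpProj_symm hB, h.perpProj_Jν hB hσ]; simp

omit h in
lemma perpProj_J (p : V) :
    perpProj B J ε c σ z ν (J p) = J (perpProj B J ε c σ z ν p) := by
  have e1 : ∀ x, B x (J p) = -B (J x) p := fun x => by rw [hB.skew]; simp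
  simp only [perpProj_apply, map_sub, map_add, map_smul, hB.J_J, hB.sq, e1]
  have := hB.eps
  match_scalars
  · ring
  · ring
  · ring
  · linear_combination (-(σ * B (J ν) p)) * this
  · linear_combination (-(σ * B ν p)) * this

include hσ in
lemma perpProj_perpProj (p : V) : perpProj B J ε c σ z ν (perpProj B J ε c σ z ν p) =
    perpProj B J ε c σ z ν p := by
  conv_lhs => rw [perpProj_apply, h.z_perpProj hB, h.Jz_perpProj hB, h.ν_perpProj hB hσ,
    h.Jν_perpProj hB hσ]
  simp

lemma perpProj_z' (u : E) : perpProj B J ε c σ z ν (z' u) =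
    z' u - ((c * B (z' u) (J z)) • J z + (ε * σ * B (z' u) (J ν)) • J ν) := by
  rw [perpProj_apply, hB.symm z, h.z'z, hB.symm ν, h.z'ν, hB.symm (J z), hB.symm (J ν)]
  simp

lemma perpProj_ν' (u : E) : perpProj B J ε c σ z ν (ν' u) =
    ν' u - ((c * B (z' u) (J ν)) • J z + (ε * σ * B (ν' u) (J ν)) • J ν) := by
  rw [perpProj_apply, hB.symm z, h.ν'z, hB.symm ν, h.ν'ν, hB.symm (J z), hB.symm (J ν), h.ν'Jz]
  simp

end K
end HopfJet
end SpaceForms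

end

noncomputable section

/-! ### Adapted frames and the structure vector -/

namespace SpaceForms
open Module

variable {E : Type*} [NormedAddCommGroup E] [NormedSpace ℝ E]
variable {V : Type*} [NormedAddCommGroup V] [NormedSpace ℝ V]

/-- The linear map `(u, α, β, γ) ↦ z' u + α z + β J z + γ ν`. -/
def frame (J : V →L[ℝ] V) (z ν : V) (z' : E →L[ℝ] V) : E × ℝ × ℝ × ℝ →L[ℝ] V :=
  z'.coprod ((ContinuousLinearMap.toSpanSingleton ℝ z).coprod
    ((ContinuousLinearMap.toSpanSingleton ℝ (J z)).coprod
      (ContinuousLinearMap.toSpanSingleton ℝ ν)))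

@[simp]
lemma frame_apply (J : V →L[ℝ] V) (z ν : V) (z' : E →L[ℝ] V) (u : E) (α β γ : ℝ) :
    frame J z ν z' (u, α, β, γ) = z' u + (α • z + (β • J z + γ • ν)) := by
  simp [frame, ContinuousLinearMap.toSpanSingleton_apply]

/-- The shape operator of the hypersurface on the orthogonal complement of the (para-)complex span
of `z` and `ν`, extended by zero. -/
def shape (B : V →L[ℝ] V →L[ℝ] ℝ) (J : V →L[ℝ] V) (ε c σ : ℝ) (z ν : V) (z' ν' : E →L[ℝ] V) :
    V →L[ℝ] V :=
  -((perpProj B J ε c σ z ν ∘L ν' ∘L ContinuousLinearMap.fst ℝ E (ℝ × ℝ × ℝ)) ∘L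
    (frame J z ν z').inverse)

namespace HopfJet

variable {B : V →L[ℝ] V →L[ℝ] ℝ} {J : V →L[ℝ] V} {ε c σ a : ℝ} {z ν : V} {z' ν' : E →L[ℝ] V}

variable [FiniteDimensional ℝ V] [FiniteDimensional ℝ E]
  (hB : IsPseudoHermitian B J ε) (hσ : σ * σ = 1) (hd : finrank ℝ V = finrank ℝ E + 3)
  (h : HopfJet B J ε c σ z ν z' ν' a)
include hB hσ hd h

/-- Pairing with `z` and `ν` kills the coefficients along these vectors, and `imm` takes care of the
rest; surjectivity is a dimension count. -/
lemma frame_bijective : Function.Bijective (frame J z ν z') := by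
  have hdim : finrank ℝ (E × ℝ × ℝ × ℝ) = finrank ℝ V := by simp [hd]
  have hinj : Function.Injective (frame J z ν z') := by
    rw [injective_iff_map_eq_zero]
    rintro ⟨u, α, β, γ⟩ h0
    rw [frame_apply] at h0
    have e1 : B (J z) z = 0 := by rw [hB.symm, hB.J_self]
    have hc := h.c_ne hB
    have hε : ε ≠ 0 := fun h0 => by have := hB.eps; simp [h0] at this
    have hσ0 : σ ≠ 0 := fun h0 => by simp [h0] at hσ
    have h1 := congrArg (fun y => c * B y z) h0
    simp only [map_add, map_smul, add_apply, smul_apply, smul_eq_mul, h.z'z, e1, hB.symm ν z, h.zν,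
      mul_zero, zero_add, add_zero, map_zero, zero_apply, mul_left_comm c, h.zz, mul_eq_zero,
      hε, or_false] at h1
    have h2 := congrArg (fun y => B y ν) h0
    simp only [map_add, map_smul, add_apply, smul_apply, smul_eq_mul, h.z'ν, h.Jzν, h.νν, h.zν,
      mul_zero, zero_add, map_zero, zero_apply, mul_eq_zero, hσ0, or_false] at h2
    subst h1 h2
    have hu : u = 0 := h.imm u (-β) (by
      rw [neg_smul, eq_neg_iff_add_eq_zero]; simpa using h0)
    subst hu
    have hJz : J z ≠ 0 := fun h3 => by
      have := h.cJzJz hB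
      simp [h3] at this
    have : β = 0 := by simpa [hJz] using h0
    simp [this]
  refine ⟨hinj, ?_⟩
  exact (LinearMap.injective_iff_surjective_of_finrank_eq_finrank
    (f := (frame J z ν z').toLinearMap) hdim).mp hinj

lemma exists_decomp (p : V) : ∃ (u : E) (α β γ : ℝ), p = z' u + (α • z + (β • J z + γ • ν)) := by
  obtain ⟨⟨u, α, β, γ⟩, hp⟩ := (h.frame_bijective hB hσ hd).2 p
  exact ⟨u, α, β, γ, by rw [← hp, frame_apply]⟩

lemma isInvertible_frame : (frame J z ν z').IsInvertible :=
  ⟨(LinearEquiv.ofBijective (frame J z ν z').toLinearMap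
    (h.frame_bijective hB hσ hd)).toContinuousLinearEquiv, by ext <;> rfl⟩

/-- The vector whose image is the structure vector `-ε J ν`, up to a multiple of the vector `J z`
tangent to the fibres of the projection. -/
lemma exists_structureVector : ∃ (ξ : E) (t : ℝ), z' ξ = -(ε • J ν) + t • J z := by
  obtain ⟨u, α, β, γ, hp⟩ := h.exists_decomp hB hσ hd (J ν)
  have e1 : B (J z) z = 0 := by rw [hB.symm, hB.J_self]
  have hc := h.c_ne hB
  have hε : ε ≠ 0 := fun h0 => by have := hB.eps; simp [h0] at this
  have hσ0 : σ ≠ 0 := fun h0 => by simp [h0] at hσ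
  have h1 := congrArg (fun y => c * B y z) hp
  simp only [map_add, map_smul, add_apply, smul_apply, smul_eq_mul, h.z'z, e1, hB.symm ν z, h.zν,
    hB.symm (J ν) z, h.zJν hB,
    mul_zero, zero_add, add_zero, mul_left_comm c, h.zz, zero_eq_mul,
    hε, or_false] at h1
  have h2 := congrArg (fun y => B y ν) hp
  simp only [map_add, map_smul, add_apply, smul_apply, smul_eq_mul, h.z'ν, h.Jzν, h.νν, h.zν,
    hB.symm (J ν) ν, hB.J_self,
    mul_zero, zero_add, zero_eq_mul, hσ0, or_false] at h2
  subst h1 h2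
  refine ⟨-(ε • u), ε * β, ?_⟩
  rw [hp]
  simp [smul_smul]

lemma exists_perpProj_eq (p : V) : ∃ u, perpProj B J ε c σ z ν p = perpProj B J ε c σ z ν (z' u) := by
  obtain ⟨u, α, β, γ, hp⟩ := h.exists_decomp hB hσ hd p
  exact ⟨u, by rw [hp]; simp [h.perpProj_z hB, h.perpProj_Jz hB, h.perpProj_ν hB hσ]⟩

omit [FiniteDimensional ℝ V] [FiniteDimensional ℝ E] hd in
/-- Symmetry of the second fundamental form on the orthogonal complement of the span of `z`, `J z`,
`ν`, `J ν`: the Hopf condition makes the correction terms symmetric as well. -/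
lemma B_ν'_z'_symm (u v : E) : B (perpProj B J ε c σ z ν (ν' u)) (perpProj B J ε c σ z ν (z' v)) =
    B (perpProj B J ε c σ z ν (ν' v)) (perpProj B J ε c σ z ν (z' u)) := by
  have key : ∀ u v, B (perpProj B J ε c σ z ν (ν' u)) (perpProj B J ε c σ z ν (z' v)) =
      B (ν' u) (z' v) - c * B (z' v) (J z) * B (z' u) (J ν)
       - ε * σ * B (z' v) (J ν) * (ε * σ * (c * B (z' u) (J z)) - a * B (z' u) (J ν)) := by
    intro u v
    have h1 := h.hopf u
    rw [perpProj_symm hB, h.perpProj_perpProj hB hσ, h.perpProj_z' hB]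
    simp only [map_add, map_smul, map_sub, smul_eq_mul, h.ν'Jz]
    linear_combination -(ε * σ * B (z' v) (J ν)) * h1
  rw [key, key, h.symm u v]
  have : ε * σ * (ε * σ) = 1 := by linear_combination σ * σ * hB.eps + hσ
  linear_combination (-(c * B (z' v) (J ν) * B (z' u) (J z)) + c * B (z' u) (J ν) * B (z' v) (J z)) * this

/-- The structure vector is principal: the derivative of the normal in its direction has no component
in the complement of the span of `z`, `J z`, `ν`, `J ν`. -/
lemma perpProj_ν'_structureVector {ξ : E} {t : ℝ} (hξ : z' ξ = -(ε • J ν) + t • J z) :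
    perpProj B J ε c σ z ν (ν' ξ) = 0 := by
  refine hB.nondeg _ fun p => ?_
  obtain ⟨u, hu⟩ := h.exists_perpProj_eq hB hσ hd p
  rw [← h.perpProj_perpProj hB hσ, perpProj_symm hB, hu, h.B_ν'_z'_symm hB hσ, hξ]
  simp [h.perpProj_Jν hB hσ, h.perpProj_Jz hB]

omit [FiniteDimensional ℝ V] [FiniteDimensional ℝ E] hd hσ in
lemma B_J_z'_structureVector {ξ : E} {t : ℝ} (hξ : z' ξ = -(ε • J ν) + t • J z) :
    (∀ u, B (J (z' u)) (z' ξ) = 0) ∧ ∀ u, B (J (ν' u)) (z' ξ) = 0 := by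
  constructor <;> intro u <;> rw [hξ] <;>
    simp [hB.J_J, h.z'z, h.z'ν, h.ν'z, h.ν'ν]

lemma B_J_ν'_structureVector {ξ : E} {t : ℝ} (hξ : z' ξ = -(ε • J ν) + t • J z) :
    (∀ u, B (J (z' u)) (ν' ξ) = 0) ∧ ∀ u, B (J (ν' u)) (ν' ξ) = 0 := by
  have h1 := h.perpProj_ν'_structureVector hB hσ hd hξ
  rw [h.perpProj_ν' hB, sub_eq_zero] at h1
  constructor <;> intro u <;> rw [h1] <;>
    simp [hB.J_J, h.z'z, h.z'ν, h.ν'z, h.ν'ν]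

omit [FiniteDimensional ℝ V] [FiniteDimensional ℝ E] hd hσ in
lemma B_Jν_structureVector {ξ : E} {t : ℝ} (hξ : z' ξ = -(ε • J ν) + t • J z) :
    B (z' ξ) (J ν) = -σ := by
  rw [hξ]
  simp only [map_add, map_neg, map_smul, add_apply, neg_apply, smul_apply, smul_eq_mul,
    h.JνJν hB, h.JzJν hB]
  linear_combination -σ * hB.eps

end HopfJet
end SpaceForms

end

noncomputable section

/-! ### The shape operator at a point -/

namespace SpaceForms
open Module

variable {E : Type*} [NormedAddCommGroup E] [NormedSpace ℝ E]
variable {V : Type*} [NormedAddCommGroup V] [NormedSpace ℝ V]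

namespace HopfJet

variable {B : V →L[ℝ] V →L[ℝ] ℝ} {J : V →L[ℝ] V} {ε c σ a : ℝ} {z ν : V} {z' ν' : E →L[ℝ] V}

variable [FiniteDimensional ℝ V] [FiniteDimensional ℝ E]
  (hB : IsPseudoHermitian B J ε) (hσ : σ * σ = 1) (hd : finrank ℝ V = finrank ℝ E + 3)
  (h : HopfJet B J ε c σ z ν z' ν' a)
include hB hσ hd h

lemma shape_frame (u : E) (α β γ : ℝ) :
    shape B J ε c σ z ν z' ν' (z' u + (α • z + (β • J z + γ • ν))) =
      -perpProj B J ε c σ z ν (ν' u) := by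
  obtain ⟨e, he⟩ := h.isInvertible_frame hB hσ hd
  rw [← frame_apply]
  simp [shape, ← he]

lemma shape_z' (u : E) :
    shape B J ε c σ z ν z' ν' (z' u) = -perpProj B J ε c σ z ν (ν' u) := by
  simpa using h.shape_frame hB hσ hd u 0 0 0

lemma shape_z : shape B J ε c σ z ν z' ν' z = 0 := by
  simpa using h.shape_frame hB hσ hd 0 1 0 0

lemma shape_Jz : shape B J ε c σ z ν z' ν' (J z) = 0 := by
  simpa using h.shape_frame hB hσ hd 0 0 1 0

lemma shape_ν : shape B J ε c σ z ν z' ν' ν = 0 := by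
  simpa using h.shape_frame hB hσ hd 0 0 0 1

lemma shape_Jν : shape B J ε c σ z ν z' ν' (J ν) = 0 := by
  obtain ⟨ξ, t, hξ⟩ := h.exists_structureVector hB hσ hd
  have h1 := h.shape_z' hB hσ hd ξ
  have hε : ε ≠ 0 := fun h0 => by have := hB.eps; simp [h0] at this
  rw [h.perpProj_ν'_structureVector hB hσ hd hξ, hξ] at h1
  simpa [h.shape_Jz hB hσ hd, hε] using h1

lemma shape_perpProj (p : V) : shape B J ε c σ z ν z' ν' (perpProj B J ε c σ z ν p) =
    shape B J ε c σ z ν z' ν' p := by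
  rw [perpProj_apply]
  simp [h.shape_z hB hσ hd, h.shape_Jz hB hσ hd, h.shape_ν hB hσ hd, h.shape_Jν hB hσ hd]

omit [FiniteDimensional ℝ V] [FiniteDimensional ℝ E] hd in
lemma perpProj_shape (p : V) : perpProj B J ε c σ z ν (shape B J ε c σ z ν z' ν' p) =
    shape B J ε c σ z ν z' ν' p := by
  simp [shape, h.perpProj_perpProj hB hσ]

lemma exists_tangent (p : V) : ∃ u, perpProj B J ε c σ z ν p = perpProj B J ε c σ z ν (z' u) ∧
    shape B J ε c σ z ν z' ν' p = -perpProj B J ε c σ z ν (ν' u) := by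
  obtain ⟨u, hu⟩ := h.exists_perpProj_eq hB hσ hd p
  exact ⟨u, hu, by rw [← h.shape_perpProj hB hσ hd, hu, h.shape_perpProj hB hσ hd,
    h.shape_z' hB hσ hd]⟩

lemma shape_symm (p q : V) : B (shape B J ε c σ z ν z' ν' p) q =
    B p (shape B J ε c σ z ν z' ν' q) := by
  obtain ⟨u, hu, hu'⟩ := h.exists_tangent hB hσ hd p
  obtain ⟨v, hv, hv'⟩ := h.exists_tangent hB hσ hd q
  have h1 : B (shape B J ε c σ z ν z' ν' p) q =
      B (shape B J ε c σ z ν z' ν' p) (perpProj B J ε c σ z ν q) := by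
    rw [← perpProj_symm hB, h.perpProj_shape hB hσ]
  have h2 : B p (shape B J ε c σ z ν z' ν' q) =
      B (shape B J ε c σ z ν z' ν' q) (perpProj B J ε c σ z ν p) := by
    rw [← perpProj_symm hB, h.perpProj_shape hB hσ, hB.symm]
  rw [h1, h2, hu, hu', hv, hv']
  simp [h.B_ν'_z'_symm hB hσ u v]

omit [FiniteDimensional ℝ V] [FiniteDimensional ℝ E] hd hσ in
/-- Components along `J z` and `J ν` do not contribute to `⟨J x, y⟩` for `x`, `y` orthogonal to `z`
and `ν`. -/
lemma B_J_sub {x y : V} (hx : B x z = 0) (hx' : B x ν = 0) (hy : B y z = 0) (hy' : B y ν = 0)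
    (α β γ δ : ℝ) : B (J (x - (α • J z + β • J ν))) (y - (γ • J z + δ • J ν)) = B (J x) y := by
  have e1 : B ν (J z) = 0 := by rw [hB.symm, h.Jzν]
  rw [hB.symm] at hy hy'
  simp [hB.J_J, hB.sq, hB.J_self, hx, hx', hy, hy', e1, h.zJν hB]

omit [FiniteDimensional ℝ V] [FiniteDimensional ℝ E] hd hσ in
lemma B_J_perpProj_ν'_z' (u v : E) :
    B (J (perpProj B J ε c σ z ν (ν' u))) (perpProj B J ε c σ z ν (z' v)) =
      B (J (ν' u)) (z' v) := by
  rw [h.perpProj_ν' hB, h.perpProj_z' hB]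
  exact h.B_J_sub hB (h.ν'z u) (h.ν'ν u) (h.z'z v) (h.z'ν v) _ _ _ _

omit [FiniteDimensional ℝ V] [FiniteDimensional ℝ E] hd hσ in
lemma B_J_perpProj_ν'_ν' (u v : E) :
    B (J (perpProj B J ε c σ z ν (ν' u))) (perpProj B J ε c σ z ν (ν' v)) =
      B (J (ν' u)) (ν' v) := by
  rw [h.perpProj_ν' hB, h.perpProj_ν' hB]
  exact h.B_J_sub hB (h.ν'z u) (h.ν'ν u) (h.ν'z v) (h.ν'ν v) _ _ _ _

omit [FiniteDimensional ℝ V] [FiniteDimensional ℝ E] hd hσ in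
lemma B_J_perpProj_z'_z' (u v : E) :
    B (J (perpProj B J ε c σ z ν (z' u))) (perpProj B J ε c σ z ν (z' v)) =
      B (J (z' u)) (z' v) := by
  rw [h.perpProj_z' hB, h.perpProj_z' hB]
  exact h.B_J_sub hB (h.z'z u) (h.z'ν u) (h.z'z v) (h.z'ν v) _ _ _ _

/-- `J` anticommutes with the shape operator when the contact form is closed. -/
lemma shape_J (h1 : ∀ u v, B (J (ν' u)) (z' v) + B (J (z' u)) (ν' v) = 0) (p : V) :
    shape B J ε c σ z ν z' ν' (J p) = -J (shape B J ε c σ z ν z' ν' p) := by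
  rw [← sub_eq_zero, sub_neg_eq_add]
  refine hB.nondeg _ fun q => ?_
  obtain ⟨u, hu, hu'⟩ := h.exists_tangent hB hσ hd p
  obtain ⟨v, hv, hv'⟩ := h.exists_tangent hB hσ hd q
  have e1 : B (shape B J ε c σ z ν z' ν' (J p)) q =
      B (J (perpProj B J ε c σ z ν p)) (shape B J ε c σ z ν z' ν' q) := by
    rw [h.shape_symm hB hσ hd, ← perpProj_J hB, perpProj_symm hB, h.perpProj_shape hB hσ]
  have e2 : B (J (shape B J ε c σ z ν z' ν' p)) q =
      B (J (shape B J ε c σ z ν z' ν' p)) (perpProj B J ε c σ z ν q) := by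
    rw [← perpProj_symm hB, perpProj_J hB, h.perpProj_shape hB hσ]
  have e3 : B (J (perpProj B J ε c σ z ν (z' u))) (perpProj B J ε c σ z ν (ν' v)) =
      B (J (z' u)) (ν' v) := by
    rw [hB.symm, ← neg_eq_iff_eq_neg.mpr (hB.skew _ _), h.B_J_perpProj_ν'_z' hB, hB.skew, neg_neg,
      hB.symm]
  have := h1 u v
  rw [map_add, add_apply, e1, e2, hu, hu', hv, hv']
  simp only [map_neg, neg_apply, e3, h.B_J_perpProj_ν'_z' hB]
  linarith

/-- If, besides, the second exterior identity `h2` holds, then the square of the shape operator is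
the multiple `-εσc` of the projection: use `⟨J A X, A Y⟩ = εσc ⟨J X, Y⟩` and `A J = -J A`. -/
lemma shape_shape (h1 : ∀ u v, B (J (ν' u)) (z' v) + B (J (z' u)) (ν' v) = 0)
    (h2 : ∀ u v, B (J (ν' u)) (ν' v) = ε * σ * (c * B (J (z' u)) (z' v))) (p : V) :
    shape B J ε c σ z ν z' ν' (shape B J ε c σ z ν z' ν' p) =
      (-(ε * σ * c)) • perpProj B J ε c σ z ν p := by
  have hJ : ∀ x y, J x = J y → x = y := fun x y hxy => by
    have := congrArg J hxy
    have hε : ε ≠ 0 := fun h0 => by have := hB.eps; simp [h0] at this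
    simpa [hB.sq, hε] using this
  apply hJ
  refine hB.ext fun q => ?_
  obtain ⟨u, hu, hu'⟩ := h.exists_tangent hB hσ hd p
  obtain ⟨v, hv, hv'⟩ := h.exists_tangent hB hσ hd q
  have e1 : B (J (shape B J ε c σ z ν z' ν' (shape B J ε c σ z ν z' ν' p))) q =
      -B (J (shape B J ε c σ z ν z' ν' p)) (shape B J ε c σ z ν z' ν' q) := by
    rw [← h.shape_symm hB hσ hd, h.shape_J hB hσ hd h1]; simp
  have e2 : B (J (perpProj B J ε c σ z ν p)) q =
      B (J (perpProj B J ε c σ z ν p)) (perpProj B J ε c σ z ν q) := by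
    rw [← perpProj_symm hB, perpProj_J hB, h.perpProj_perpProj hB hσ]
  rw [e1, map_smul, map_smul, smul_apply, e2, hu, hu', hv, hv']
  simp only [map_neg, neg_apply, neg_neg, h.B_J_perpProj_ν'_ν' hB, h2, h.B_J_perpProj_z'_z' hB,
    smul_eq_mul]
  ring

end HopfJet
end SpaceForms

end

noncomputable section

/-! ### Lifts of Hopf hypersurfaces and exterior derivatives -/

namespace SpaceForms
open Module

variable {E : Type*} [NormedAddCommGroup E] [NormedSpace ℝ E]
variable {V : Type*} [NormedAddCommGroup V] [NormedSpace ℝ V]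

lemma fderiv_bilin (B : V →L[ℝ] V →L[ℝ] ℝ) {f g : E → V} {x : E} (hf : DifferentiableAt ℝ f x)
    (hg : DifferentiableAt ℝ g x) (u : E) :
    fderiv ℝ (fun y => B (f y) (g y)) x u = B (fderiv ℝ f x u) (g x) + B (f x) (fderiv ℝ g x u) := by
  rw [(B.hasFDerivAt_of_bilinear hf.hasFDerivAt hg.hasFDerivAt).fderiv]
  simp [add_comm]

lemma fderiv_clm_comp_apply (J : V →L[ℝ] V) {f : E → V} {x : E} (hf : DifferentiableAt ℝ f x)
    (u : E) : fderiv ℝ (fun y => J (f y)) x u = J (fderiv ℝ f x u) := by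
  have h : HasFDerivAt (fun y => J (f y)) (J ∘L fderiv ℝ f x) x :=
    J.hasFDerivAt.comp x hf.hasFDerivAt
  rw [h.fderiv]
  simp

lemma differentiableAt_clm_comp (J : V →L[ℝ] V) {f : E → V} {x : E}
    (hf : DifferentiableAt ℝ f x) : DifferentiableAt ℝ (fun y => J (f y)) x :=
  J.differentiableAt.comp x hf

/-- On the open set `O`, the map `z` is a lift to the quadric `⟨z, z⟩ = ε / c` of a Hopf
hypersurface, `ν` is the horizontal lift of a unit normal field, `⟨ν, ν⟩ = σ`, and `a` is the Hopf
principal curvature. The Hopf condition is written as an identity of 1-forms. -/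
structure IsHopfLift (B : V →L[ℝ] V →L[ℝ] ℝ) (J : V →L[ℝ] V) (ε c σ : ℝ) (O : Set E) (z ν : E → V)
    (a : E → ℝ) : Prop where
  isOpen : IsOpen O
  smooth_z : ContDiffOn ℝ ∞ z O
  smooth_ν : ContDiffOn ℝ ∞ ν O
  zz : ∀ x ∈ O, c * B (z x) (z x) = ε
  zν : ∀ x ∈ O, B (z x) (ν x) = 0
  Jzν : ∀ x ∈ O, B (J (z x)) (ν x) = 0
  νν : ∀ x ∈ O, B (ν x) (ν x) = σ
  normal : ∀ x ∈ O, ∀ u, B (fderiv ℝ z x u) (ν x) = 0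
  imm : ∀ x ∈ O, ∀ u (β : ℝ), fderiv ℝ z x u = β • J (z x) → u = 0
  hopf : ∀ x ∈ O, ∀ u, B (fderiv ℝ ν x u) (J (ν x)) - ε * σ * (c * B (fderiv ℝ z x u) (J (z x))) =
    -(a x * B (fderiv ℝ z x u) (J (ν x)))

namespace IsHopfLift

variable {B : V →L[ℝ] V →L[ℝ] ℝ} {J : V →L[ℝ] V} {ε c σ : ℝ} {O : Set E} {z ν : E → V} {a : E → ℝ}
  (h : IsHopfLift B J ε c σ O z ν a) {x : E} (hx : x ∈ O)
include h hx

lemma eventually : ∀ᶠ y in 𝓝 x, y ∈ O := h.isOpen.mem_nhds hx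

lemma contDiffAt_z : ContDiffAt ℝ ∞ z x := h.smooth_z.contDiffAt (h.isOpen.mem_nhds hx)
lemma contDiffAt_ν : ContDiffAt ℝ ∞ ν x := h.smooth_ν.contDiffAt (h.isOpen.mem_nhds hx)
lemma diff_z : DifferentiableAt ℝ z x := (h.contDiffAt_z hx).differentiableAt (by simp)
lemma diff_ν : DifferentiableAt ℝ ν x := (h.contDiffAt_ν hx).differentiableAt (by simp)

lemma contDiffAt_z' (u : E) : ContDiffAt ℝ ∞ (fun y => fderiv ℝ z y u) x :=
  ((h.contDiffAt_z hx).fderiv_right (m := ∞) (by simp)).clm_apply contDiffAt_const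
lemma contDiffAt_ν' (u : E) : ContDiffAt ℝ ∞ (fun y => fderiv ℝ ν y u) x :=
  ((h.contDiffAt_ν hx).fderiv_right (m := ∞) (by simp)).clm_apply contDiffAt_const
lemma diff_z' (u : E) : DifferentiableAt ℝ (fun y => fderiv ℝ z y u) x :=
  (h.contDiffAt_z' hx u).differentiableAt (by simp)
lemma diff_ν' (u : E) : DifferentiableAt ℝ (fun y => fderiv ℝ ν y u) x :=
  (h.contDiffAt_ν' hx u).differentiableAt (by simp)

lemma z''_comm (u v : E) : fderiv ℝ (fun y => fderiv ℝ z y u) x v =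
    fderiv ℝ (fun y => fderiv ℝ z y v) x u := by
  have h2 : ContDiffAt ℝ 2 z x := (h.contDiffAt_z hx).of_le (by norm_cast)
  rw [(hasFDerivAt_fderiv_apply h2 u).fderiv, (hasFDerivAt_fderiv_apply h2 v).fderiv]
  exact fderiv_fderiv_comm h2 v u

lemma ν''_comm (u v : E) : fderiv ℝ (fun y => fderiv ℝ ν y u) x v =
    fderiv ℝ (fun y => fderiv ℝ ν y v) x u := by
  have h2 : ContDiffAt ℝ 2 ν x := (h.contDiffAt_ν hx).of_le (by norm_cast)
  rw [(hasFDerivAt_fderiv_apply h2 u).fderiv, (hasFDerivAt_fderiv_apply h2 v).fderiv]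
  exact fderiv_fderiv_comm h2 v u

omit hx in
lemma fderiv_zero_of_eq {f : E → ℝ} {r : ℝ} (hx : x ∈ O) (hf : ∀ y ∈ O, f y = r) (u : E) :
    fderiv ℝ f x u = 0 := by
  have : f =ᶠ[𝓝 x] fun _ => r := (h.eventually hx).mono hf
  rw [this.fderiv_eq]; simp

lemma jet (hB : IsPseudoHermitian B J ε) :
    HopfJet B J ε c σ (z x) (ν x) (fderiv ℝ z x) (fderiv ℝ ν x) (a x) where
  zz := h.zz x hx
  zν := h.zν x hx
  Jzν := h.Jzν x hx
  νν := h.νν x hx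
  z'z u := by
    have hc : c ≠ 0 := by
      rintro rfl
      have h1 := h.zz x hx
      have h2 := hB.eps
      simp at h1
      simp [← h1] at h2
    have h1 := h.fderiv_zero_of_eq hx (f := fun y => B (z y) (z y)) (r := ε / c)
      (fun y hy => by rw [← h.zz y hy]; field_simp) u
    rw [fderiv_bilin B (h.diff_z hx) (h.diff_z hx), hB.symm (z x)] at h1
    linarith
  z'ν := h.normal x hx
  ν'z u := by
    have h1 := h.fderiv_zero_of_eq hx h.zν u
    rw [fderiv_bilin B (h.diff_z hx) (h.diff_ν hx), h.normal x hx, zero_add, hB.symm] at h1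
    exact h1
  ν'ν u := by
    have h1 := h.fderiv_zero_of_eq hx h.νν u
    rw [fderiv_bilin B (h.diff_ν hx) (h.diff_ν hx), hB.symm (ν x)] at h1
    linarith
  ν'Jz u := by
    have h1 := h.fderiv_zero_of_eq hx h.Jzν u
    rw [fderiv_bilin B (differentiableAt_clm_comp J (h.diff_z hx)) (h.diff_ν hx),
      fderiv_clm_comp_apply J (h.diff_z hx), hB.skew, hB.symm (J (z x))] at h1
    linarith
  symm u v := by
    have key : ∀ u v, B (fderiv ℝ ν x u) (fderiv ℝ z x v) =
        -B (ν x) (fderiv ℝ (fun y => fderiv ℝ z y v) x u) := by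
      intro u v
      have h1 := h.fderiv_zero_of_eq hx (fun y hy => h.normal y hy v) u
      rw [fderiv_bilin B (h.diff_z' hx v) (h.diff_ν hx), hB.symm, hB.symm (fderiv ℝ z x v)] at h1
      linarith
    rw [key, key, h.z''_comm hx]
  imm := h.imm x hx
  hopf := h.hopf x hx

variable [FiniteDimensional ℝ V] [FiniteDimensional ℝ E]
  (hB : IsPseudoHermitian B J ε) (hσ : σ * σ = 1) (hd : finrank ℝ V = finrank ℝ E + 3)
include hB hσ hd

omit [FiniteDimensional ℝ V] [FiniteDimensional ℝ E] hσ hd hB in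
lemma contDiffAt_contact (u : E) : ContDiffAt ℝ ∞ (fun y => B (fderiv ℝ z y u) (J (ν y))) x :=
  (B.contDiff.contDiffAt.comp x (h.contDiffAt_z' hx u)).clm_apply
    (J.contDiff.contDiffAt.comp x (h.contDiffAt_ν hx))

omit [FiniteDimensional ℝ V] [FiniteDimensional ℝ E] hσ hd hB in
lemma fderiv_contact (u v : E) : fderiv ℝ (fun y => B (fderiv ℝ z y u) (J (ν y))) x v =
    B (fderiv ℝ (fun y => fderiv ℝ z y u) x v) (J (ν x)) +
      B (fderiv ℝ z x u) (J (fderiv ℝ ν x v)) := by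
  rw [fderiv_bilin B (h.diff_z' hx u) (differentiableAt_clm_comp J (h.diff_ν hx)),
    fderiv_clm_comp_apply J (h.diff_ν hx)]

/-- The contact form `μ = ⟨dz, J ν⟩` does not vanish at any point. -/
lemma exists_contact_ne : ∃ ξ, B (fderiv ℝ z x ξ) (J (ν x)) ≠ 0 := by
  obtain ⟨ξ, t, hξ⟩ := (h.jet hx hB).exists_structureVector hB hσ hd
  refine ⟨ξ, ?_⟩
  rw [(h.jet hx hB).B_Jν_structureVector hB hξ]
  intro h0
  have : σ = 0 := by linarith
  simp [this] at hσ

/-- The Hopf identity, evaluated where the contact form is nonzero, expresses `a` by smooth data. -/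
lemma contDiffAt_a : ContDiffAt ℝ ∞ a x := by
  obtain ⟨ξ, hξ⟩ := h.exists_contact_ne hx hB hσ hd
  have h0 := h.contDiffAt_contact hx ξ
  have h1 : ContDiffAt ℝ ∞ (fun y => B (fderiv ℝ ν y ξ) (J (ν y))) x :=
    (B.contDiff.contDiffAt.comp x (h.contDiffAt_ν' hx ξ)).clm_apply
    (J.contDiff.contDiffAt.comp x (h.contDiffAt_ν hx))
  have h2 : ContDiffAt ℝ ∞ (fun y => B (fderiv ℝ z y ξ) (J (z y))) x :=
    (B.contDiff.contDiffAt.comp x (h.contDiffAt_z' hx ξ)).clm_apply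
    (J.contDiff.contDiffAt.comp x (h.contDiffAt_z hx))
  have h3 := ((h1.sub ((h2.const_smul c).const_smul (ε * σ))).neg).div h0 hξ
  refine h3.congr_of_eventuallyEq ?_
  filter_upwards [h.eventually hx, h0.continuousAt.eventually_ne hξ] with y hy hy0
  have := h.hopf y hy ξ
  simp only [smul_eq_mul, Pi.div_apply]
  rw [eq_div_iff hy0]
  linarith

lemma diff_a : DifferentiableAt ℝ a x := (h.contDiffAt_a hx hB hσ hd).differentiableAt (by simp)

/-- The exterior derivative of the Hopf identity
`⟨dν, J ν⟩ - εσc ⟨dz, J z⟩ = -a ⟨dz, J ν⟩`. -/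
lemma hopf_exterior (u w : E) :
    2 * B (J (fderiv ℝ ν x u)) (fderiv ℝ ν x w) -
      2 * (ε * σ * (c * B (J (fderiv ℝ z x u)) (fderiv ℝ z x w))) =
    fderiv ℝ a x w * B (fderiv ℝ z x u) (J (ν x)) - fderiv ℝ a x u * B (fderiv ℝ z x w) (J (ν x)) -
      a x * (B (J (fderiv ℝ ν x u)) (fderiv ℝ z x w) + B (J (fderiv ℝ z x u)) (fderiv ℝ ν x w)) := by
  have key : ∀ u w, B (fderiv ℝ (fun y => fderiv ℝ ν y u) x w) (J (ν x)) +
      B (fderiv ℝ ν x u) (J (fderiv ℝ ν x w)) -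
      ε * σ * (c * (B (fderiv ℝ (fun y => fderiv ℝ z y u) x w) (J (z x)) +
        B (fderiv ℝ z x u) (J (fderiv ℝ z x w)))) +
      (fderiv ℝ a x w * B (fderiv ℝ z x u) (J (ν x)) +
        a x * (B (fderiv ℝ (fun y => fderiv ℝ z y u) x w) (J (ν x)) +
          B (fderiv ℝ z x u) (J (fderiv ℝ ν x w)))) = 0 := by
    intro u w
    have d0 := h.diff_a hx hB hσ hd
    have d1 : DifferentiableAt ℝ (fun y => B (fderiv ℝ ν y u) (J (ν y))) x :=
      (B.differentiableAt.comp x (h.diff_ν' hx u)).clm_apply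
        (differentiableAt_clm_comp J (h.diff_ν hx))
    have d2 : DifferentiableAt ℝ (fun y => B (fderiv ℝ z y u) (J (z y))) x :=
      (B.differentiableAt.comp x (h.diff_z' hx u)).clm_apply
        (differentiableAt_clm_comp J (h.diff_z hx))
    have d3 : DifferentiableAt ℝ (fun y => B (fderiv ℝ z y u) (J (ν y))) x :=
      (h.contDiffAt_contact hx u).differentiableAt (by simp)
    have h1 := h.fderiv_zero_of_eq hx (r := 0) (f := fun y => B (fderiv ℝ ν y u) (J (ν y)) -
      ε * σ * (c * B (fderiv ℝ z y u) (J (z y))) + a y * B (fderiv ℝ z y u) (J (ν y)))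
      (fun y hy => by linarith [h.hopf y hy u]) w
    have e1 : HasFDerivAt (fun y => B (fderiv ℝ ν y u) (J (ν y)) -
      ε * σ * (c * B (fderiv ℝ z y u) (J (z y))) + a y * B (fderiv ℝ z y u) (J (ν y))) _ x :=
      (d1.hasFDerivAt.sub ((d2.hasFDerivAt.const_mul c).const_mul (ε * σ))).add
        (d0.hasFDerivAt.mul d3.hasFDerivAt)
    rw [e1.fderiv] at h1
    simp only [add_apply, sub_apply, smul_apply, smul_eq_mul, h.fderiv_contact hx] at h1
    rw [fderiv_bilin B (h.diff_ν' hx u) (differentiableAt_clm_comp J (h.diff_ν hx)),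
      fderiv_clm_comp_apply J (h.diff_ν hx),
      fderiv_bilin B (h.diff_z' hx u) (differentiableAt_clm_comp J (h.diff_z hx)),
      fderiv_clm_comp_apply J (h.diff_z hx)] at h1
    rw [← h1]; ring
  -- antisymmetrize: the second derivatives of `z` and `ν` drop out
  have k1 := key u w
  have k2 := key w u
  rw [h.z''_comm hx u w, h.ν''_comm hx u w] at k1
  simp only [hB.skew]
  have s1 : ∀ p q, B p (J q) = -B q (J p) := fun p q => by rw [hB.symm, hB.skew]
  rw [s1 (fderiv ℝ ν x w) (fderiv ℝ ν x u), s1 (fderiv ℝ z x w) (fderiv ℝ z x u),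
    s1 (fderiv ℝ z x w) (fderiv ℝ ν x u)] at k2
  linear_combination k2 - k1

/-- `da ∧ μ = 0` for the contact form `μ = ⟨dz, J ν⟩`: contract the exterior derivative of the Hopf
identity with the structure vector, on which all the 2-forms involved vanish. -/
lemma da_wedge (u w : E) : fderiv ℝ a x u * B (fderiv ℝ z x w) (J (ν x)) =
    fderiv ℝ a x w * B (fderiv ℝ z x u) (J (ν x)) := by
  have hj := h.jet hx hB
  obtain ⟨ξ, t, hξ⟩ := hj.exists_structureVector hB hσ hd
  have hμ := hj.B_Jν_structureVector hB hξ
  have key : ∀ u, σ * fderiv ℝ a x u = -(fderiv ℝ a x ξ * B (fderiv ℝ z x u) (J (ν x))) := by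
    intro u
    have h1 := h.hopf_exterior hx hB hσ hd u ξ
    rw [(hj.B_J_ν'_structureVector hB hσ hd hξ).2, (hj.B_J_ν'_structureVector hB hσ hd hξ).1,
      (hj.B_J_z'_structureVector hB hξ).2, (hj.B_J_z'_structureVector hB hξ).1, hμ] at h1
    linarith
  have hσ0 : σ ≠ 0 := fun h0 => by simp [h0] at hσ
  apply mul_left_cancel₀ hσ0
  linear_combination B (fderiv ℝ z x w) (J (ν x)) * key u - B (fderiv ℝ z x u) (J (ν x)) * key w

/-- Where the differential of `a` does not vanish, the contact form is closed: `da = β μ` gives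
`dβ ∧ μ + β dμ = 0`, and `dμ` is zero in the direction of the structure vector. -/
lemma eventually_closed (ha : fderiv ℝ a x ≠ 0) : ∀ᶠ y in 𝓝 x, ∀ u w,
    B (J (fderiv ℝ ν y u)) (fderiv ℝ z y w) + B (J (fderiv ℝ z y u)) (fderiv ℝ ν y w) = 0 := by
  obtain ⟨ξ₀, hξ₀⟩ := h.exists_contact_ne hx hB hσ hd
  have hax : fderiv ℝ a x ξ₀ ≠ 0 := by
    intro h0
    apply ha
    ext u
    have := h.da_wedge hx hB hσ hd u ξ₀
    rw [h0, zero_mul] at this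
    simpa [hξ₀] using this
  have c1 : ContDiffAt ℝ ∞ (fun y => fderiv ℝ a y ξ₀) x :=
    ((h.contDiffAt_a hx hB hσ hd).fderiv_right (m := ∞) (by simp)).clm_apply contDiffAt_const
  have e1 : ∀ᶠ y in 𝓝 x, B (fderiv ℝ z y ξ₀) (J (ν y)) ≠ 0 :=
    (h.contDiffAt_contact hx ξ₀).continuousAt.eventually_ne hξ₀
  have e2 : ∀ᶠ y in 𝓝 x, fderiv ℝ a y ξ₀ ≠ 0 := c1.continuousAt.eventually_ne hax
  filter_upwards [h.eventually hx, e1, e2, (h.eventually hx).eventually_nhds,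
    e1.eventually_nhds] with y hy hμ0 ha0 hO hμ
  set β : E → ℝ := fun y => fderiv ℝ a y ξ₀ / B (fderiv ℝ z y ξ₀) (J (ν y)) with hβ
  have ca : ContDiffAt ℝ ∞ (fderiv ℝ a) y :=
    (h.contDiffAt_a hy hB hσ hd).fderiv_right (m := ∞) (by simp)
  have ca2 : ContDiffAt ℝ 2 a y := (h.contDiffAt_a hy hB hσ hd).of_le (by norm_cast)
  have dβ : DifferentiableAt ℝ β y :=
    ((ca.clm_apply contDiffAt_const).div (h.contDiffAt_contact hy ξ₀) hμ0).differentiableAt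
      (by simp)
  have hda : ∀ᶠ y in 𝓝 y, ∀ u, fderiv ℝ a y u = β y * B (fderiv ℝ z y u) (J (ν y)) := by
    filter_upwards [hO, hμ] with y hy hμ0 u
    have := h.da_wedge hy hB hσ hd u ξ₀
    simp only [hβ]
    rw [div_mul_eq_mul_div, eq_div_iff hμ0, this]
  have key : ∀ u w, fderiv ℝ β y w * B (fderiv ℝ z y u) (J (ν y)) -
      fderiv ℝ β y u * B (fderiv ℝ z y w) (J (ν y)) = β y * (B (J (fderiv ℝ ν y u)) (fderiv ℝ z y w)
        + B (J (fderiv ℝ z y u)) (fderiv ℝ ν y w)) := by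
    have k0 : ∀ u w, fderiv ℝ (fderiv ℝ a) y w u = fderiv ℝ β y w * B (fderiv ℝ z y u) (J (ν y)) +
        β y * (B (fderiv ℝ (fun y => fderiv ℝ z y u) y w) (J (ν y)) +
          B (fderiv ℝ z y u) (J (fderiv ℝ ν y w))) := by
      intro u w
      have d3 : DifferentiableAt ℝ (fun y => B (fderiv ℝ z y u) (J (ν y))) y :=
        (h.contDiffAt_contact hy u).differentiableAt (by simp)
      have h1 := (hasFDerivAt_fderiv_apply ca2 u).unique
        ((dβ.hasFDerivAt.mul d3.hasFDerivAt).congr_of_eventuallyEq (hda.mono fun y hy => hy u))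
      have h2 := congrArg (fun l => l w) h1
      simp only [ContinuousLinearMap.flip_apply, add_apply, smul_apply, smul_eq_mul,
        h.fderiv_contact hy] at h2
      rw [h2]; ring
    intro u w
    have k1 := k0 u w
    have k2 := k0 w u
    rw [h.z''_comm hy u w, fderiv_fderiv_comm ca2] at k1
    have s1 : ∀ p q, B p (J q) = -B q (J p) := fun p q => by rw [hB.symm, hB.skew]
    rw [s1 (fderiv ℝ z y w) (fderiv ℝ ν y u)] at k2
    simp only [hB.skew]
    linear_combination k2 - k1
  -- contract `dβ ∧ μ + β dμ = 0` with the structure vector, which annihilates `dμ`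
  have hβ0 : β y ≠ 0 := div_ne_zero ha0 hμ0
  have hj := h.jet hy hB
  obtain ⟨ξ, t, hξ⟩ := hj.exists_structureVector hB hσ hd
  have hμξ := hj.B_Jν_structureVector hB hξ
  have hσ0 : σ ≠ 0 := fun h0 => by simp [h0] at hσ
  have key2 : ∀ u, σ * fderiv ℝ β y u = -(fderiv ℝ β y ξ * B (fderiv ℝ z y u) (J (ν y))) := by
    intro u
    have h1 := key u ξ
    rw [(hj.B_J_ν'_structureVector hB hσ hd hξ).1, (hj.B_J_z'_structureVector hB hξ).2, hμξ] at h1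
    linarith
  intro u w
  apply mul_left_cancel₀ (mul_ne_zero hσ0 hβ0)
  linear_combination (-σ) * key u w + B (fderiv ℝ z y u) (J (ν y)) * key2 w -
    B (fderiv ℝ z y w) (J (ν y)) * key2 u

end IsHopfLift
end SpaceForms

end

noncomputable section

/-! ### Smoothness of the shape operator -/

namespace SpaceForms
open Module

variable {E : Type*} [NormedAddCommGroup E] [NormedSpace ℝ E]
variable {V : Type*} [NormedAddCommGroup V] [NormedSpace ℝ V]

lemma fderiv_clm_apply_apply {F G : Type*} [NormedAddCommGroup F] [NormedSpace ℝ F]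
    [NormedAddCommGroup G] [NormedSpace ℝ G] {A : E → F →L[ℝ] G} {f : E → F} {x : E}
    (hA : DifferentiableAt ℝ A x) (hf : DifferentiableAt ℝ f x) (u : E) :
    fderiv ℝ (fun y => A y (f y)) x u = fderiv ℝ A x u (f x) + A x (fderiv ℝ f x u) := by
  rw [fderiv_clm_apply hA hf]
  simp [add_comm]

/-- Two quadratic forms whose product vanishes: if the first one is nonzero at some vector, the
second one is zero. -/
lemma bilin_self_eq_zero {b₁ b₂ : V → V → ℝ}
    (h₁ : ∀ (x y : V) (t : ℝ), b₁ (x + t • y) (x + t • y) =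
      b₁ x x + t * (2 * b₁ x y) + t ^ 2 * b₁ y y)
    (h₂ : ∀ (x y : V) (t : ℝ), b₂ (x + t • y) (x + t • y) =
      b₂ x x + t * (2 * b₂ x y) + t ^ 2 * b₂ y y)
    (h : ∀ x, b₁ x x * b₂ x x = 0) {x : V} (hx : b₁ x x ≠ 0) (y : V) : b₂ y y = 0 := by
  have key : ∀ t : ℝ, (b₁ x x + t * (2 * b₁ x y) + t ^ 2 * b₁ y y) *
      (b₂ x x + t * (2 * b₂ x y) + t ^ 2 * b₂ y y) = 0 := fun t => by
    rw [← h₁, ← h₂, h]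
  have k0 : b₂ x x = 0 := by simpa [hx] using h x
  -- the coefficients of a polynomial in `t` are combinations of four of its values
  have p1 := key 1
  have p2 := key (-1)
  have p3 := key 2
  have p4 := key (-2)
  rw [k0] at p1 p2 p3 p4
  have e1 : b₁ x x * (2 * b₂ x y) = 0 := by
    linear_combination (8 * (p1 - p2) - (p3 - p4)) / 12
  have k1 : b₂ x y = 0 := by simpa [hx] using e1
  rw [k1] at p1 p2 p3 p4
  have e2 : b₁ x x * b₂ y y = 0 := by
    linear_combination (16 * (p1 + p2) - (p3 + p4)) / 24
  simpa [hx] using e2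

namespace IsHopfLift

variable {B : V →L[ℝ] V →L[ℝ] ℝ} {J : V →L[ℝ] V} {ε c σ : ℝ} {O : Set E} {z ν : E → V} {a : E → ℝ}

lemma mono (h : IsHopfLift B J ε c σ O z ν a) {O' : Set E} (hO' : IsOpen O') (hs : O' ⊆ O) :
    IsHopfLift B J ε c σ O' z ν a where
  isOpen := hO'
  smooth_z := h.smooth_z.mono hs
  smooth_ν := h.smooth_ν.mono hs
  zz x hx := h.zz x (hs hx)
  zν x hx := h.zν x (hs hx)
  Jzν x hx := h.Jzν x (hs hx)
  νν x hx := h.νν x (hs hx)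
  normal x hx := h.normal x (hs hx)
  imm x hx := h.imm x (hs hx)
  hopf x hx := h.hopf x (hs hx)

variable [FiniteDimensional ℝ V] [FiniteDimensional ℝ E]
  (h : IsHopfLift B J ε c σ O z ν a)
  (hB : IsPseudoHermitian B J ε) (hσ : σ * σ = 1) (hd : finrank ℝ V = finrank ℝ E + 3)

/-- The projection `perpProj` at the points of `O`. -/
abbrev projAt (B : V →L[ℝ] V →L[ℝ] ℝ) (J : V →L[ℝ] V) (ε c σ : ℝ) (z ν : E → V) (x : E) :
    V →L[ℝ] V := perpProj B J ε c σ (z x) (ν x)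

/-- The operator `shape` at the points of `O`. -/
abbrev shapeAt (B : V →L[ℝ] V →L[ℝ] ℝ) (J : V →L[ℝ] V) (ε c σ : ℝ) (z ν : E → V) (x : E) :
    V →L[ℝ] V := shape B J ε c σ (z x) (ν x) (fderiv ℝ z x) (fderiv ℝ ν x)

include h

omit [FiniteDimensional ℝ E] in
lemma contDiffOn_projAt : ContDiffOn ℝ ∞ (projAt B J ε c σ z ν) O := by
  rw [contDiffOn_clm_apply]
  intro p
  have hz := h.smooth_z
  have hν := h.smooth_ν
  simp only [HopfJet.perpProj_apply]
  fun_prop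

include hB hσ hd

lemma contDiffOn_shapeAt : ContDiffOn ℝ ∞ (shapeAt B J ε c σ z ν) O := by
  have h1 : ContDiffOn ℝ ∞ (fun y => frame J (z y) (ν y) (fderiv ℝ z y)) O := by
    rw [contDiffOn_clm_apply]
    rintro ⟨u, α, β, γ⟩
    have hz := h.smooth_z
    have hν := h.smooth_ν
    have hz' : ContDiffOn ℝ ∞ (fun y => fderiv ℝ z y u) O :=
      fun y hy => (h.contDiffAt_z' hy u).contDiffWithinAt
    simp only [frame_apply]
    fun_prop
  intro x hx
  refine ContDiffAt.contDiffWithinAt (ContDiffAt.neg (ContDiffAt.clm_comp ?_ ?_))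
  · exact ((h.contDiffOn_projAt).contDiffAt (h.isOpen.mem_nhds hx)).clm_comp
      (((h.contDiffAt_ν hx).fderiv_right (m := ∞) (by simp)).clm_comp contDiffAt_const)
  · exact ((h.jet hx hB).isInvertible_frame hB hσ hd).contDiffAt_map_inverse.comp x
      (h1.contDiffAt (h.isOpen.mem_nhds hx))

variable {x : E} (hx : x ∈ O)
include hx

lemma diff_shapeAt : DifferentiableAt ℝ (shapeAt B J ε c σ z ν) x :=
  ((h.contDiffOn_shapeAt hB hσ hd).contDiffAt (h.isOpen.mem_nhds hx)).differentiableAt (by simp)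

omit [FiniteDimensional ℝ E] hB hσ hd in
lemma diff_projAt : DifferentiableAt ℝ (projAt B J ε c σ z ν) x :=
  (h.contDiffOn_projAt.contDiffAt (h.isOpen.mem_nhds hx)).differentiableAt (by simp)

omit [FiniteDimensional ℝ V] [FiniteDimensional ℝ E] hB hσ hd hx in
lemma fderiv_congr {F : Type*} [NormedAddCommGroup F] [NormedSpace ℝ F] {f g : E → F}
    (hx : x ∈ O) (hfg : ∀ y ∈ O, f y = g y) (u : E) : fderiv ℝ f x u = fderiv ℝ g x u := by
  have : f =ᶠ[𝓝 x] g := (h.eventually hx).mono hfg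
  rw [this.fderiv_eq]

omit [FiniteDimensional ℝ E] hσ hd hB in
/-- The derivative of the projection on a field in its kernel. -/
lemma fderiv_projAt_apply {f : E → V} (hf : DifferentiableAt ℝ f x)
    (h0 : ∀ y ∈ O, projAt B J ε c σ z ν y (f y) = 0) (u : E) :
    fderiv ℝ (projAt B J ε c σ z ν) x u (f x) = -projAt B J ε c σ z ν x (fderiv ℝ f x u) := by
  have h1 := h.fderiv_congr hx h0 u
  rw [fderiv_clm_apply_apply (h.diff_projAt hx) hf] at h1
  rw [eq_neg_iff_add_eq_zero, h1]; simp

/-- The derivative of the shape operator on a field in its kernel. -/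
lemma fderiv_shapeAt_apply {f : E → V} (hf : DifferentiableAt ℝ f x)
    (h0 : ∀ y ∈ O, shapeAt B J ε c σ z ν y (f y) = 0) (u : E) :
    fderiv ℝ (shapeAt B J ε c σ z ν) x u (f x) = -shapeAt B J ε c σ z ν x (fderiv ℝ f x u) := by
  have h1 := h.fderiv_congr hx h0 u
  rw [fderiv_clm_apply_apply (h.diff_shapeAt hB hσ hd hx) hf] at h1
  rw [eq_neg_iff_add_eq_zero, h1]; simp

omit hd [FiniteDimensional ℝ E] in
/-- The derivative of `P² = P`. -/
lemma projAt_fderiv_projAt_projAt (u : E) (p : V) :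
    fderiv ℝ (projAt B J ε c σ z ν) x u p =
      fderiv ℝ (projAt B J ε c σ z ν) x u (projAt B J ε c σ z ν x p) +
        projAt B J ε c σ z ν x (fderiv ℝ (projAt B J ε c σ z ν) x u p) := by
  have hP := h.diff_projAt hx
  have h1 := h.fderiv_congr hx (fun y hy => ((h.jet hy hB).perpProj_perpProj hB hσ p)) u
  rw [fderiv_clm_apply_apply hP (hP.clm_apply (differentiableAt_const p)),
    fderiv_clm_apply_apply hP (differentiableAt_const p)] at h1
  simpa using h1.symm

end IsHopfLift
end SpaceForms

end

noncomputable section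

/-! ### Derivatives of the shape operator and the Codazzi equation -/

namespace SpaceForms
open Module

variable {E : Type*} [NormedAddCommGroup E] [NormedSpace ℝ E]
variable {V : Type*} [NormedAddCommGroup V] [NormedSpace ℝ V]

namespace IsHopfLift

variable {B : V →L[ℝ] V →L[ℝ] ℝ} {J : V →L[ℝ] V} {ε c σ : ℝ} {O : Set E} {z ν : E → V} {a : E → ℝ}
variable [FiniteDimensional ℝ V] [FiniteDimensional ℝ E]
  (h : IsHopfLift B J ε c σ O z ν a) {x : E} (hx : x ∈ O)
  (hB : IsPseudoHermitian B J ε) (hσ : σ * σ = 1) (hd : finrank ℝ V = finrank ℝ E + 3)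
include h hB hσ hd hx

lemma fderiv_shapeAt_symm (u : E) (p q : V) : B (fderiv ℝ (shapeAt B J ε c σ z ν) x u p) q =
    B p (fderiv ℝ (shapeAt B J ε c σ z ν) x u q) := by
  have hA := h.diff_shapeAt hB hσ hd hx
  have h1 := h.fderiv_congr hx (fun y hy => (h.jet hy hB).shape_symm hB hσ hd p q) u
  rw [fderiv_bilin B (hA.clm_apply (differentiableAt_const p)) (differentiableAt_const q),
    fderiv_bilin B (differentiableAt_const p) (hA.clm_apply (differentiableAt_const q)),
    fderiv_clm_apply_apply hA (differentiableAt_const p),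
    fderiv_clm_apply_apply hA (differentiableAt_const q)] at h1
  simpa using h1

omit [FiniteDimensional ℝ E] hσ hd in
lemma fderiv_projAt_symm (u : E) (p q : V) : B (fderiv ℝ (projAt B J ε c σ z ν) x u p) q =
    B p (fderiv ℝ (projAt B J ε c σ z ν) x u q) := by
  have hA := h.diff_projAt hx
  have h1 := h.fderiv_congr hx (fun y _ => HopfJet.perpProj_symm hB (ε := ε) (c := c) (σ := σ)
    (z := z y) (ν := ν y) p q) u
  rw [fderiv_bilin B (hA.clm_apply (differentiableAt_const p)) (differentiableAt_const q),
    fderiv_bilin B (differentiableAt_const p) (hA.clm_apply (differentiableAt_const q)),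
    fderiv_clm_apply_apply hA (differentiableAt_const p),
    fderiv_clm_apply_apply hA (differentiableAt_const q)] at h1
  simpa using h1

omit [FiniteDimensional ℝ E] hσ hd in
lemma fderiv_projAt_J (u : E) (p : V) : fderiv ℝ (projAt B J ε c σ z ν) x u (J p) =
    J (fderiv ℝ (projAt B J ε c σ z ν) x u p) := by
  have hA := h.diff_projAt hx
  have h1 := h.fderiv_congr hx (fun y _ => HopfJet.perpProj_J hB (ε := ε) (c := c) (σ := σ)
    (z := z y) (ν := ν y) p) u
  rw [fderiv_clm_apply_apply hA (differentiableAt_const (J p)),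
    fderiv_clm_comp_apply J (hA.clm_apply (differentiableAt_const p)),
    fderiv_clm_apply_apply hA (differentiableAt_const p)] at h1
  simpa using h1

/-- The derivative of `A = P A`. -/
lemma fderiv_shapeAt_eq_left (u : E) (p : V) : fderiv ℝ (shapeAt B J ε c σ z ν) x u p =
    fderiv ℝ (projAt B J ε c σ z ν) x u (shapeAt B J ε c σ z ν x p) +
      projAt B J ε c σ z ν x (fderiv ℝ (shapeAt B J ε c σ z ν) x u p) := by
  have hA := h.diff_shapeAt hB hσ hd hx
  have hP := h.diff_projAt hx
  have h1 := h.fderiv_congr hx (fun y hy => (h.jet hy hB).perpProj_shape hB hσ p) u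
  rw [fderiv_clm_apply_apply hP (hA.clm_apply (differentiableAt_const p)),
    fderiv_clm_apply_apply hA (differentiableAt_const p)] at h1
  simpa using h1.symm

/-- The derivative of `A = A P`. -/
lemma fderiv_shapeAt_eq_right (u : E) (p : V) : fderiv ℝ (shapeAt B J ε c σ z ν) x u p =
    fderiv ℝ (shapeAt B J ε c σ z ν) x u (projAt B J ε c σ z ν x p) +
      shapeAt B J ε c σ z ν x (fderiv ℝ (projAt B J ε c σ z ν) x u p) := by
  have hA := h.diff_shapeAt hB hσ hd hx
  have hP := h.diff_projAt hx
  have h1 := h.fderiv_congr hx (fun y hy => (h.jet hy hB).shape_perpProj hB hσ hd p) u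
  rw [fderiv_clm_apply_apply hA (hP.clm_apply (differentiableAt_const p)),
    fderiv_clm_apply_apply hP (differentiableAt_const p),
    fderiv_clm_apply_apply hA (differentiableAt_const p)] at h1
  simpa using h1.symm

/-- The Codazzi equation of the hypersurface of the flat space swept out by the lift. -/
lemma fderiv_shapeAt_codazzi (u v : E) :
    fderiv ℝ (shapeAt B J ε c σ z ν) x u (fderiv ℝ z x v) +
      fderiv ℝ (projAt B J ε c σ z ν) x u (fderiv ℝ ν x v) =
    fderiv ℝ (shapeAt B J ε c σ z ν) x v (fderiv ℝ z x u) +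
      fderiv ℝ (projAt B J ε c σ z ν) x v (fderiv ℝ ν x u) := by
  have hA := h.diff_shapeAt hB hσ hd hx
  have hP := h.diff_projAt hx
  have key : ∀ u v, fderiv ℝ (shapeAt B J ε c σ z ν) x u (fderiv ℝ z x v) +
      fderiv ℝ (projAt B J ε c σ z ν) x u (fderiv ℝ ν x v) =
      -(shapeAt B J ε c σ z ν x (fderiv ℝ (fun y => fderiv ℝ z y v) x u) +
        projAt B J ε c σ z ν x (fderiv ℝ (fun y => fderiv ℝ ν y v) x u)) := by
    intro u v
    have h1 := h.fderiv_congr hx (f := fun y => shapeAt B J ε c σ z ν y (fderiv ℝ z y v) +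
      projAt B J ε c σ z ν y (fderiv ℝ ν y v)) (g := fun _ => 0)
      (fun y hy => by rw [(h.jet hy hB).shape_z' hB hσ hd]; simp) u
    rw [fderiv_fun_add (hA.clm_apply (h.diff_z' hx v)) (hP.clm_apply (h.diff_ν' hx v)), add_apply,
      fderiv_clm_apply_apply hA (h.diff_z' hx v),
      fderiv_clm_apply_apply hP (h.diff_ν' hx v)] at h1
    simp only [fderiv_fun_const, Pi.zero_apply, zero_apply] at h1
    rw [eq_neg_iff_add_eq_zero, ← h1]
    abel
  rw [key, key, h.z''_comm hx, h.ν''_comm hx]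

variable (hcl : ∀ y ∈ O, ∀ u w, B (J (fderiv ℝ ν y u)) (fderiv ℝ z y w) +
  B (J (fderiv ℝ z y u)) (fderiv ℝ ν y w) = 0)
include hcl

omit hx in
/-- When the contact form is closed, the exterior derivative of the Hopf identity reduces to the relation
`⟨J dν, dν⟩ = εσc ⟨J dz, dz⟩`, as `da ∧ μ = 0`. -/
lemma closed₂ : ∀ y ∈ O, ∀ u w, B (J (fderiv ℝ ν y u)) (fderiv ℝ ν y w) =
    ε * σ * (c * B (J (fderiv ℝ z y u)) (fderiv ℝ z y w)) := by
  intro y hy u w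
  have h1 := h.hopf_exterior hy hB hσ hd u w
  have h2 := h.da_wedge hy hB hσ hd u w
  rw [hcl y hy] at h1
  linarith

/-- The derivative of `A² = -εσc P`. -/
lemma fderiv_shapeAt_shapeAt (u : E) (p : V) :
    fderiv ℝ (shapeAt B J ε c σ z ν) x u (shapeAt B J ε c σ z ν x p) +
      shapeAt B J ε c σ z ν x (fderiv ℝ (shapeAt B J ε c σ z ν) x u p) =
    (-(ε * σ * c)) • fderiv ℝ (projAt B J ε c σ z ν) x u p := by
  have hA := h.diff_shapeAt hB hσ hd hx
  have hP := h.diff_projAt hx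
  have h1 := h.fderiv_congr hx (fun y hy => (h.jet hy hB).shape_shape hB hσ hd (hcl y hy)
    (h.closed₂ hB hσ hd hcl y hy) p) u
  rw [fderiv_clm_apply_apply hA (hA.clm_apply (differentiableAt_const p)),
    fderiv_fun_const_smul (hP.clm_apply (differentiableAt_const p)),
    smul_apply,
    fderiv_clm_apply_apply hP (differentiableAt_const p),
    fderiv_clm_apply_apply hA (differentiableAt_const p)] at h1
  simpa using h1

/-- The 1-form `τ = 2θ - εσaμ`, where `θ = c ⟨dz, J z⟩` is the connection form of the fibration of the
hyperquadric and `μ = ⟨dz, J ν⟩` is the contact form. The derivative of the shape operator turns out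
to be the rotation `τ J A` up to terms coming from the moving projection. -/
def connForm (B : V →L[ℝ] V →L[ℝ] ℝ) (J : V →L[ℝ] V) (ε c σ : ℝ) (z ν : E → V) (a : E → ℝ)
    (x : E) : E →L[ℝ] ℝ :=
  (2 * c) • (B.flip (J (z x)) ∘L fderiv ℝ z x) -
    (ε * σ * a x) • (B.flip (J (ν x)) ∘L fderiv ℝ z x)

omit h hx hB hσ hd hcl [FiniteDimensional ℝ V] [FiniteDimensional ℝ E] in
lemma connForm_apply (x v : E) : connForm B J ε c σ z ν a x v =
    2 * c * B (fderiv ℝ z x v) (J (z x)) - ε * σ * a x * B (fderiv ℝ z x v) (J (ν x)) := by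
  simp [connForm]

/-- The Codazzi equation projected to the complement of the span of `z`, `J z`, `ν`, `J ν`: the
projected derivative of `A`, diminished by `τ J A` with `τ` the form `connForm`, is symmetric in its
two tangent arguments. The terms with `τ` come from the components of `z' v` and `ν' v` along `J z`
and `J ν`. -/
lemma perp_shape_deriv_symm (u v : E) :
    projAt B J ε c σ z ν x (fderiv ℝ (shapeAt B J ε c σ z ν) x u
      (projAt B J ε c σ z ν x (fderiv ℝ z x v))) -
      connForm B J ε c σ z ν a x u • J (shapeAt B J ε c σ z ν x (fderiv ℝ z x v)) =
    projAt B J ε c σ z ν x (fderiv ℝ (shapeAt B J ε c σ z ν) x v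
      (projAt B J ε c σ z ν x (fderiv ℝ z x u))) -
      connForm B J ε c σ z ν a x v • J (shapeAt B J ε c σ z ν x (fderiv ℝ z x u)) := by
  have hj := h.jet hx hB
  have hk : ε * σ * (ε * σ) = 1 := by linear_combination σ * σ * hB.eps + hσ
  have key : ∀ u v, projAt B J ε c σ z ν x (fderiv ℝ (shapeAt B J ε c σ z ν) x u
      (projAt B J ε c σ z ν x (fderiv ℝ z x v))) +
      connForm B J ε c σ z ν a x v • J (shapeAt B J ε c σ z ν x (fderiv ℝ z x u)) =
      projAt B J ε c σ z ν x (fderiv ℝ (shapeAt B J ε c σ z ν) x u (fderiv ℝ z x v) +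
        fderiv ℝ (projAt B J ε c σ z ν) x u (fderiv ℝ ν x v)) := by
    intro u v
    have dJz := differentiableAt_clm_comp J (h.diff_z hx)
    have dJν := differentiableAt_clm_comp J (h.diff_ν hx)
    have a1 : fderiv ℝ (shapeAt B J ε c σ z ν) x u (J (z x)) =
        J (shapeAt B J ε c σ z ν x (fderiv ℝ z x u)) := by
      rw [h.fderiv_shapeAt_apply hB hσ hd hx dJz
        (fun y hy => (h.jet hy hB).shape_Jz hB hσ hd) u, fderiv_clm_comp_apply J (h.diff_z hx),
        hj.shape_J hB hσ hd (hcl x hx), neg_neg]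
    have a2 : fderiv ℝ (shapeAt B J ε c σ z ν) x u (J (ν x)) =
        (ε * σ * c) • J (projAt B J ε c σ z ν x (fderiv ℝ z x u)) := by
      rw [h.fderiv_shapeAt_apply hB hσ hd hx dJν
        (fun y hy => (h.jet hy hB).shape_Jν hB hσ hd) u, fderiv_clm_comp_apply J (h.diff_ν hx),
        hj.shape_J hB hσ hd (hcl x hx), neg_neg, ← hj.shape_perpProj hB hσ hd,
        ← neg_neg (perpProj _ _ _ _ _ _ _ (fderiv ℝ ν x u)), ← hj.shape_z' hB hσ hd, map_neg,
        hj.shape_shape hB hσ hd (hcl x hx) (h.closed₂ hB hσ hd hcl x hx)]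
      simp
    have p1 : fderiv ℝ (projAt B J ε c σ z ν) x u (J (z x)) =
        -J (projAt B J ε c σ z ν x (fderiv ℝ z x u)) := by
      rw [h.fderiv_projAt_apply hx dJz
        (fun y hy => (h.jet hy hB).perpProj_Jz hB) u, fderiv_clm_comp_apply J (h.diff_z hx),
        HopfJet.perpProj_J hB]
    have p2 : fderiv ℝ (projAt B J ε c σ z ν) x u (J (ν x)) =
        J (shapeAt B J ε c σ z ν x (fderiv ℝ z x u)) := by
      rw [h.fderiv_projAt_apply hx dJν
        (fun y hy => (h.jet hy hB).perpProj_Jν hB hσ) u, fderiv_clm_comp_apply J (h.diff_ν hx),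
        HopfJet.perpProj_J hB, hj.shape_z' hB hσ hd, map_neg]
    have p3 : projAt B J ε c σ z ν x (fderiv ℝ (projAt B J ε c σ z ν) x u
        (projAt B J ε c σ z ν x (fderiv ℝ ν x v))) = 0 := by
      have := h.projAt_fderiv_projAt_projAt hB hσ hx u
        (projAt B J ε c σ z ν x (fderiv ℝ ν x v))
      rw [hj.perpProj_perpProj hB hσ] at this
      simpa using this
    have n1 : fderiv ℝ ν x v = projAt B J ε c σ z ν x (fderiv ℝ ν x v) +
        ((c * B (fderiv ℝ z x v) (J (ν x))) • J (z x) +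
          (ε * σ * B (fderiv ℝ ν x v) (J (ν x))) • J (ν x)) := by
      rw [hj.perpProj_ν' hB]; abel
    have q1 : ∀ p, projAt B J ε c σ z ν x (J (projAt B J ε c σ z ν x p)) =
        J (projAt B J ε c σ z ν x p) := fun p => by
      rw [HopfJet.perpProj_J hB, hj.perpProj_perpProj hB hσ]
    have q2 : ∀ p, projAt B J ε c σ z ν x (J (shapeAt B J ε c σ z ν x p)) =
        J (shapeAt B J ε c σ z ν x p) := fun p => by
      rw [HopfJet.perpProj_J hB, hj.perpProj_shape hB hσ]
    have hh := hj.hopf v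
    have m1 : projAt B J ε c σ z ν x (fderiv ℝ z x v) = fderiv ℝ z x v -
        ((c * B (fderiv ℝ z x v) (J (z x))) • J (z x) +
          (ε * σ * B (fderiv ℝ z x v) (J (ν x))) • J (ν x)) := hj.perpProj_z' hB v
    rw [n1, m1]
    simp only [map_add, map_sub, map_smul, a1, a2, p1, p2, p3, q1, q2, map_neg, connForm_apply]
    match_scalars
    · ring
    · linear_combination (-(ε * σ)) * hh - (c * B (fderiv ℝ z x v) (J (z x))) * hk
    · linear_combination (-(c * B (fderiv ℝ z x v) (J (ν x)))) * hk
  have k1 := key u v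
  have k2 := key v u
  rw [h.fderiv_shapeAt_codazzi hx hB hσ hd u v, ← k2] at k1
  rw [sub_eq_sub_iff_add_eq_add, k1]

end IsHopfLift
end SpaceForms

end

noncomputable section

/-! ### Integrability and constancy of the Hopf principal curvature -/

namespace SpaceForms
open Module

variable {E : Type*} [NormedAddCommGroup E] [NormedSpace ℝ E]
variable {V : Type*} [NormedAddCommGroup V] [NormedSpace ℝ V]

namespace IsHopfLift

variable {B : V →L[ℝ] V →L[ℝ] ℝ} {J : V →L[ℝ] V} {ε c σ : ℝ} {O : Set E} {z ν : E → V} {a : E → ℝ}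
variable [FiniteDimensional ℝ V] [FiniteDimensional ℝ E]
  (h : IsHopfLift B J ε c σ O z ν a) {x : E} (hx : x ∈ O)
  (hB : IsPseudoHermitian B J ε) (hσ : σ * σ = 1) (hd : finrank ℝ V = finrank ℝ E + 3)
  (hcl : ∀ y ∈ O, ∀ u w, B (J (fderiv ℝ ν y u)) (fderiv ℝ z y w) +
    B (J (fderiv ℝ z y u)) (fderiv ℝ ν y w) = 0)
include h hx hB hσ hd hcl

/-- The covariant derivative of the shape operator in the direction `u`, corrected by a
rotation, vanishes. It is totally symmetric and anticommutes with the shape operator `A`, so that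
applying `A` to any one of its three arguments changes the result in the same way up to sign. -/
lemma perp_shape_deriv_eq (u : E) (p : V) :
    projAt B J ε c σ z ν x (fderiv ℝ (shapeAt B J ε c σ z ν) x u
      (projAt B J ε c σ z ν x p)) =
    connForm B J ε c σ z ν a x u • J (shapeAt B J ε c σ z ν x p) := by
  have hj := h.jet hx hB
  set A := shapeAt B J ε c σ z ν x with hA
  set P := projAt B J ε c σ z ν x with hP
  set A' := fderiv ℝ (shapeAt B J ε c σ z ν) x with hA'
  set τ := connForm B J ε c σ z ν a x with hτ
  have hPP : ∀ p, P (P p) = P p := hj.perpProj_perpProj hB hσ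
  have hPA : ∀ p, P (A p) = A p := hj.perpProj_shape hB hσ
  have hAP : ∀ p, A (P p) = A p := hj.shape_perpProj hB hσ hd
  have hPJ : ∀ p, P (J p) = J (P p) := fun p => HopfJet.perpProj_J hB p
  have hAJ : ∀ p, A (J p) = -J (A p) := hj.shape_J hB hσ hd (hcl x hx)
  have hAs : ∀ p q, B (A p) q = B p (A q) := hj.shape_symm hB hσ hd
  have hPs : ∀ p q, B (P p) q = B p (P q) := HopfJet.perpProj_symm hB
  have hAA : ∀ p, A (A p) = (-(ε * σ * c)) • P p :=
    hj.shape_shape hB hσ hd (hcl x hx) (h.closed₂ hB hσ hd hcl x hx)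
  have hA's : ∀ u p q, B (A' u p) q = B p (A' u q) := h.fderiv_shapeAt_symm hx hB hσ hd
  have hA'A : ∀ u p, P (A' u (A p)) = -A (A' u (P p)) := by
    intro u p
    have h1 := h.fderiv_shapeAt_shapeAt hx hB hσ hd hcl u (P p)
    have h2 := h.projAt_fderiv_projAt_projAt hB hσ hx u (P p)
    change _ = fderiv ℝ (projAt B J ε c σ z ν) x u (P (P p)) + _ at h2
    rw [hPP] at h2
    have h3 : P (fderiv ℝ (projAt B J ε c σ z ν) x u (P p)) = 0 := by simpa using h2
    have h4 := congrArg P h1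
    change P (A' u (A (P p)) + A (A' u (P p))) = _ at h4
    rw [map_add, hPA, hAP, map_smul, h3, smul_zero] at h4
    exact eq_neg_of_add_eq_zero_left h4
  -- `C` is self-adjoint, symmetric in its tangent and vector arguments, and anticommutes with `A`
  let C : E → V → V := fun u p => P (A' u (P p)) - τ u • J (A p)
  have C_def : ∀ u p, C u p = P (A' u (P p)) - τ u • J (A p) := fun _ _ => rfl
  have C_P : ∀ u p, C u (P p) = C u p := fun u p => by simp only [C_def, hPP, hAP]
  have P_C : ∀ u p, P (C u p) = C u p := fun u p => by
    simp only [C_def, map_sub, map_smul, hPP, hPJ, hPA]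
  have C_s : ∀ u p q, B (C u p) q = B p (C u q) := fun u p q => by
    simp only [C_def, map_sub, map_smul, sub_apply, smul_apply, hPs, hA's, hB.skew, hAs, hAJ,
      map_neg]
    rw [neg_neg]
  have C_A : ∀ u p, C u (A p) = -A (C u p) := fun u p => by
    simp only [C_def, map_sub, map_smul, hPA, hA'A, hAJ, hAP]
    module
  have C_z : ∀ u v, C u (fderiv ℝ z x v) = C v (fderiv ℝ z x u) :=
    h.perp_shape_deriv_symm hx hB hσ hd hcl
  have C_neg : ∀ u p, C u (-p) = -C u p := fun u p => by simp [C_def]; module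
  have key : ∀ p, C u p = 0 := by
    -- `u₁` lifts `A (z' u)`; by symmetry `C u₁ = -A (C u)`, while self-adjointness gives the
    -- opposite sign
    obtain ⟨u₁, hu₁⟩ := hj.exists_perpProj_eq hB hσ hd (A (fderiv ℝ z x u))
    change P _ = P _ at hu₁
    rw [hPA] at hu₁
    have c1 : ∀ p, C u₁ p = -A (C u p) := by
      intro p
      obtain ⟨v, hv⟩ := hj.exists_perpProj_eq hB hσ hd p
      change P _ = P _ at hv
      rw [← C_P u, ← C_P u₁, hv, C_P, C_P, C_z, ← C_P v, ← hu₁, C_A, C_z]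
    have c2 : ∀ p, A (C u p) = 0 := by
      intro p
      refine hB.nondeg _ fun q => ?_
      have e1 : B (A (C u p)) q = -B (C u₁ p) q := by rw [c1]; simp
      have e2 : B (C u₁ p) q = B (A (C u p)) q := by
        rw [C_s, c1, map_neg, ← hAs, ← C_s, C_A]; simp
      linarith
    intro p
    have h1 := congrArg A (c2 p)
    rw [hAA, P_C, map_zero, smul_eq_zero] at h1
    refine h1.resolve_left ?_
    have hc := hj.c_ne hB
    have hε : ε ≠ 0 := fun h0 => by have := hB.eps; simp [h0] at this
    have hσ0 : σ ≠ 0 := fun h0 => by simp [h0] at hσ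
    simp [hc, hε, hσ0]
  exact sub_eq_zero.mp (key p)

/-- The full derivative of the shape operator: its part in the complement, together with the terms
due to `A = P A P`. -/
lemma fderiv_shapeAt_eq (u : E) : fderiv ℝ (shapeAt B J ε c σ z ν) x u =
    connForm B J ε c σ z ν a x u • (J * shapeAt B J ε c σ z ν x) +
      fderiv ℝ (projAt B J ε c σ z ν) x u * shapeAt B J ε c σ z ν x +
      shapeAt B J ε c σ z ν x * fderiv ℝ (projAt B J ε c σ z ν) x u := by
  ext p
  simp only [add_apply, smul_apply, mul_apply_eq_comp]
  rw [← h.perp_shape_deriv_eq hx hB hσ hd hcl, h.fderiv_shapeAt_eq_left hx hB hσ hd]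
  conv_lhs => rw [h.fderiv_shapeAt_eq_right hx hB hσ hd]
  rw [map_add, (h.jet hx hB).perpProj_shape hB hσ]
  abel

omit [FiniteDimensional ℝ E] hd hcl in
/-- The product of two derivatives of the projection, on a vector `q` in its range: the derivative
maps `q` into the span of `z`, `J z`, `ν`, `J ν` and that span back. -/
lemma B_fderiv_projAt (u v : E) {q w : V} (hq : projAt B J ε c σ z ν x q = q) :
    B (fderiv ℝ (projAt B J ε c σ z ν) x u (fderiv ℝ (projAt B J ε c σ z ν) x v q)) w =
      ε * c * B (projAt B J ε c σ z ν x (fderiv ℝ z x v)) q *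
        B (projAt B J ε c σ z ν x (fderiv ℝ z x u)) w +
      c * B (J (projAt B J ε c σ z ν x (fderiv ℝ z x v))) q *
        B (J (projAt B J ε c σ z ν x (fderiv ℝ z x u))) w +
      σ * B (projAt B J ε c σ z ν x (fderiv ℝ ν x v)) q *
        B (projAt B J ε c σ z ν x (fderiv ℝ ν x u)) w +
      ε * σ * B (J (projAt B J ε c σ z ν x (fderiv ℝ ν x v))) q *
        B (J (projAt B J ε c σ z ν x (fderiv ℝ ν x u))) w := by
  have hj := h.jet hx hB
  have perp : ∀ v {q}, projAt B J ε c σ z ν x q = q →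
      projAt B J ε c σ z ν x (fderiv ℝ (projAt B J ε c σ z ν) x v q) = 0 := by
    intro v q hq
    have h2 := h.projAt_fderiv_projAt_projAt hB hσ hx v q
    rw [hq] at h2
    simpa using h2
  have b1 : ∀ v q, B (z x) (fderiv ℝ (projAt B J ε c σ z ν) x v q) =
      -B (projAt B J ε c σ z ν x (fderiv ℝ z x v)) q := fun v q => by
    rw [← h.fderiv_projAt_symm hx hB, h.fderiv_projAt_apply hx (h.diff_z hx)
      fun y hy => (h.jet hy hB).perpProj_z hB]; simp
  have b2 : ∀ v q, B (J (z x)) (fderiv ℝ (projAt B J ε c σ z ν) x v q) =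
      -B (J (projAt B J ε c σ z ν x (fderiv ℝ z x v))) q := fun v q => by
    rw [← h.fderiv_projAt_symm hx hB, h.fderiv_projAt_apply hx
      (differentiableAt_clm_comp J (h.diff_z hx))
      fun y hy => (h.jet hy hB).perpProj_Jz hB, fderiv_clm_comp_apply J (h.diff_z hx),
      HopfJet.perpProj_J hB]; simp
  have b3 : ∀ v q, B (ν x) (fderiv ℝ (projAt B J ε c σ z ν) x v q) =
      -B (projAt B J ε c σ z ν x (fderiv ℝ ν x v)) q := fun v q => by
    rw [← h.fderiv_projAt_symm hx hB, h.fderiv_projAt_apply hx (h.diff_ν hx)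
      fun y hy => (h.jet hy hB).perpProj_ν hB hσ]; simp
  have b4 : ∀ v q, B (J (ν x)) (fderiv ℝ (projAt B J ε c σ z ν) x v q) =
      -B (J (projAt B J ε c σ z ν x (fderiv ℝ ν x v))) q := fun v q => by
    rw [← h.fderiv_projAt_symm hx hB, h.fderiv_projAt_apply hx
      (differentiableAt_clm_comp J (h.diff_ν hx))
      fun y hy => (h.jet hy hB).perpProj_Jν hB hσ, fderiv_clm_comp_apply J (h.diff_ν hx),
      HopfJet.perpProj_J hB]; simp
  have e1 : fderiv ℝ (projAt B J ε c σ z ν) x v q =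
      (ε * c * B (z x) (fderiv ℝ (projAt B J ε c σ z ν) x v q)) • z x +
      (c * B (J (z x)) (fderiv ℝ (projAt B J ε c σ z ν) x v q)) • J (z x) +
      (σ * B (ν x) (fderiv ℝ (projAt B J ε c σ z ν) x v q)) • ν x +
      (ε * σ * B (J (ν x)) (fderiv ℝ (projAt B J ε c σ z ν) x v q)) • J (ν x) := by
    have h2 := perp v hq
    rw [projAt, HopfJet.perpProj_apply, sub_eq_zero] at h2
    exact h2
  rw [h.fderiv_projAt_symm hx hB, e1]
  simp only [map_add, map_smul, add_apply, smul_apply, smul_eq_mul, b1, b2, b3, b4]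
  ring

/-- The condition `d²A = 0` for the shape operator. Since `da ∧ μ = 0` and `dμ = 0`, the form `τ`
satisfies `dτ = 4c ⟨J dz, dz⟩`. -/
lemma integrability_connForm (u v : E) : (4 * c * B (J (fderiv ℝ z x u)) (fderiv ℝ z x v)) •
      (J * shapeAt B J ε c σ z ν x) =
    (fderiv ℝ (projAt B J ε c σ z ν) x u * fderiv ℝ (projAt B J ε c σ z ν) x v -
      fderiv ℝ (projAt B J ε c σ z ν) x v * fderiv ℝ (projAt B J ε c σ z ν) x u) *
      shapeAt B J ε c σ z ν x - shapeAt B J ε c σ z ν x *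
    (fderiv ℝ (projAt B J ε c σ z ν) x u * fderiv ℝ (projAt B J ε c σ z ν) x v -
      fderiv ℝ (projAt B J ε c σ z ν) x v * fderiv ℝ (projAt B J ε c σ z ν) x u) := by
  have dz := h.contDiffAt_z hx
  have dν := h.contDiffAt_ν hx
  have dz' : ContDiffAt ℝ ∞ (fderiv ℝ z) x := dz.fderiv_right (m := ∞) (by simp)
  have da := h.contDiffAt_a hx hB hσ hd
  have dτ : DifferentiableAt ℝ (connForm B J ε c σ z ν a) x := by
    have t1 : ContDiffAt ℝ ∞ (fun x => B.flip (J (z x)) ∘L fderiv ℝ z x) x :=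
      ContDiffAt.clm_comp (B.flip.contDiff.contDiffAt.comp x (J.contDiff.contDiffAt.comp x dz)) dz'
    have t2 : ContDiffAt ℝ ∞ (fun x => B.flip (J (ν x)) ∘L fderiv ℝ z x) x :=
      ContDiffAt.clm_comp (B.flip.contDiff.contDiffAt.comp x (J.contDiff.contDiffAt.comp x dν)) dz'
    exact ((t1.const_smul (2 * c)).sub
      ((contDiffAt_const (c := ε * σ).mul da).smul t2)).differentiableAt (by simp)
  have key : ∀ u v, fderiv ℝ (connForm B J ε c σ z ν a) x u v =
      2 * c * (B (fderiv ℝ (fun y => fderiv ℝ z y v) x u) (J (z x)) +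
        B (fderiv ℝ z x v) (J (fderiv ℝ z x u))) - ε * σ * (fderiv ℝ a x u *
          B (fderiv ℝ z x v) (J (ν x)) + a x * (B (fderiv ℝ (fun y => fderiv ℝ z y v) x u) (J (ν x)) +
        B (fderiv ℝ z x v) (J (fderiv ℝ ν x u)))) := by
    intro u v
    have h1 := fderiv_clm_apply_apply dτ (differentiableAt_const v) u
    simp only [fderiv_fun_const, Pi.zero_apply, zero_apply, map_zero, add_zero] at h1
    have d2 : DifferentiableAt ℝ (fun y => B (fderiv ℝ z y v) (J (z y))) x :=
      (B.differentiableAt.comp x (h.diff_z' hx v)).clm_apply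
        (differentiableAt_clm_comp J (h.diff_z hx))
    have d3 : DifferentiableAt ℝ (fun y => B (fderiv ℝ z y v) (J (ν y))) x :=
      (h.contDiffAt_contact hx v).differentiableAt (by simp)
    have e1 : HasFDerivAt (fun y => 2 * c * B (fderiv ℝ z y v) (J (z y)) -
        ε * σ * (a y * B (fderiv ℝ z y v) (J (ν y)))) _ x :=
      (d2.hasFDerivAt.const_mul (2 * c)).sub
        (((h.diff_a hx hB hσ hd).hasFDerivAt.mul d3.hasFDerivAt).const_mul (ε * σ))
    rw [← h1]
    simp only [connForm_apply, mul_assoc (ε * σ)]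
    rw [e1.fderiv]
    simp only [add_apply, sub_apply, smul_apply, smul_eq_mul, h.fderiv_contact hx]
    rw [fderiv_bilin B (h.diff_z' hx v) (differentiableAt_clm_comp J (h.diff_z hx)),
      fderiv_clm_comp_apply J (h.diff_z hx)]
    ring
  have hA2 : ContDiffAt ℝ 2 (shapeAt B J ε c σ z ν) x :=
    ((h.contDiffOn_shapeAt hB hσ hd).contDiffAt (h.isOpen.mem_nhds hx)).of_le (by norm_cast)
  have hP2 : ContDiffAt ℝ 2 (projAt B J ε c σ z ν) x :=
    (h.contDiffOn_projAt.contDiffAt (h.isOpen.mem_nhds hx)).of_le (by norm_cast)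
  rw [← integrability hA2 hP2 dτ
    ((h.eventually hx).mono fun y hy u => h.fderiv_shapeAt_eq hy hB hσ hd hcl u)
    (fun u => by ext p; simp [h.fderiv_projAt_J hx hB])]
  congr 1
  rw [key, key, h.z''_comm hx u v]
  have h1 := hcl x hx u v
  have h2 := h.da_wedge hx hB hσ hd u v
  have s1 : ∀ p q, B p (J q) = -B q (J p) := fun p q => by rw [hB.symm, hB.skew]
  rw [s1 (fderiv ℝ z x v) (fderiv ℝ z x u), s1 (fderiv ℝ z x v) (fderiv ℝ ν x u)]
  simp only [hB.skew] at h1 ⊢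
  linear_combination ε * σ * h2 + ε * σ * a x * h1

/-- The contact form of a Hopf hypersurface cannot be closed: integrability gives
`⟨X, X⟩ ⟨A X, X⟩ = 0` for all `X` in the complement, hence `A = 0`, whereas `A² ≠ 0`. -/
lemma false_of_closed (hE : 2 ≤ finrank ℝ E) : False := by
  have hj := h.jet hx hB
  set A := shapeAt B J ε c σ z ν x with hA
  set P := projAt B J ε c σ z ν x with hP
  have hPP : ∀ p, P (P p) = P p := hj.perpProj_perpProj hB hσ
  have hPA : ∀ p, P (A p) = A p := hj.perpProj_shape hB hσ
  have hAP : ∀ p, A (P p) = A p := hj.shape_perpProj hB hσ hd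
  have hPJ : ∀ p, P (J p) = J (P p) := fun p => HopfJet.perpProj_J hB p
  have hAJ : ∀ p, A (J p) = -J (A p) := hj.shape_J hB hσ hd (hcl x hx)
  have hAs : ∀ p q, B (A p) q = B p (A q) := hj.shape_symm hB hσ hd
  have hPs : ∀ p q, B (P p) q = B p (P q) := HopfJet.perpProj_symm hB
  have hAA : ∀ p, A (A p) = (-(ε * σ * c)) • P p :=
    hj.shape_shape hB hσ hd (hcl x hx) (h.closed₂ hB hσ hd hcl x hx)
  have hc := hj.c_ne hB
  have hε : ε ≠ 0 := fun h0 => by have := hB.eps; simp [h0] at this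
  have hσ0 : σ ≠ 0 := fun h0 => by simp [h0] at hσ
  -- integrability on the vector `X`, paired with `J X`, for tangent directions over `X` and `J X`
  have key : ∀ X, P X = X → B X X * B (A X) X = 0 := by
    intro X hX
    obtain ⟨u, hu, hu'⟩ := hj.exists_tangent hB hσ hd X
    obtain ⟨v, hv, hv'⟩ := hj.exists_tangent hB hσ hd (J X)
    change P X = P _ at hu
    change P (J X) = P _ at hv
    change A X = -P _ at hu'
    change A (J X) = -P _ at hv'
    rw [hX] at hu
    rw [hPJ, hX] at hv
    rw [eq_neg_iff_add_eq_zero, add_comm, ← eq_neg_iff_add_eq_zero] at hu' hv'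
    rw [hAJ, neg_neg] at hv'
    have h1 := congrArg (fun T : V →L[ℝ] V => B (T X) (J X))
      (h.integrability_connForm hx hB hσ hd hcl u v)
    have hω : B (J (fderiv ℝ z x u)) (fderiv ℝ z x v) = ε * B X X := by
      rw [← hj.B_J_perpProj_z'_z' hB]
      change B (J (P _)) (P _) = _
      rw [← hu, ← hv, hB.J_J]
    have f3 : B (A X) (A X) = -(ε * σ * c) * B X X := by
      rw [hAs, hAA, hX]; simp
    have f4 : ∀ p, B (J p) p = 0 := fun p => by rw [hB.symm, hB.J_self]
    have f5 : B (J X) (A X) = B (A X) (J X) := hB.symm _ _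
    have f7 : B (J (A X)) X = -B (A X) (J X) := hB.skew _ _
    have f6 : B X (J (A X)) = -B (A X) (J X) := by rw [hB.symm, f7]
    have f8 : B X (A X) = B (A X) X := hB.symm _ _
    have hM := fun u v q w => h.B_fderiv_projAt hx hB hσ u v (q := q) (w := w)
    change ∀ u v q w, P q = q → _ = ε * c * B (P (fderiv ℝ z x v)) q * B (P (fderiv ℝ z x u)) w +
      c * B (J (P (fderiv ℝ z x v))) q * B (J (P (fderiv ℝ z x u))) w +
      σ * B (P (fderiv ℝ ν x v)) q * B (P (fderiv ℝ ν x u)) w +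
      ε * σ * B (J (P (fderiv ℝ ν x v))) q * B (J (P (fderiv ℝ ν x u))) w at hM
    change B ((_ • (J * A)) X) (J X) = B ((_ * A - A * _) X) (J X) at h1
    simp only [smul_apply, sub_apply, mul_apply_eq_comp, hω, map_smul, smul_eq_mul, map_sub,
      hAs, hAJ, map_neg] at h1
    simp only [hB.J_J, map_neg, hM _ _ _ _ hX, hM _ _ _ _ (hPA X), ← hu, ← hv, hu', hv', hB.sq,
      neg_apply, f3, f4, f5, f6, f7, f8, hB.J_self, map_smul, smul_apply, smul_eq_mul] at h1
    have h2 := hB.eps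
    have h3 : 12 * c * (B X X * B (A X) X) = 0 := by
      linear_combination h1 - c * B X X * B (A X) X * (8 + 2 * σ ^ 2 * (ε ^ 2 + 2)) * h2 -
        4 * c * B X X * B (A X) X * hσ
    simpa [hc] using h3
  -- otherwise `z`, `J z`, `ν`, `J ν` span `V`, which has dimension at least 5
  have hr : ∃ X, P X = X ∧ B X X ≠ 0 := by
    by_contra! h0
    have hPzero : ∀ p, P p = 0 := by
      intro p
      refine hB.nondeg _ fun q => ?_
      have e1 := h0 (P p + P q) (by rw [map_add, hPP, hPP])
      have e2 := h0 (P p) (hPP p)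
      have e3 := h0 (P q) (hPP q)
      simp only [map_add, add_apply, e2, e3, hB.symm (P q) (P p)] at e1
      have e4 : B (P p) (P q) = B (P p) q := by rw [← hPs, hPP]
      linarith
    have hsurj : Function.Surjective (Fintype.linearCombination ℝ ![z x, J (z x), ν x, J (ν x)]) := by
      intro p
      have h1 := hPzero p
      simp only [hP, projAt, HopfJet.perpProj_apply, sub_eq_zero] at h1
      rw [h1]
      refine ⟨![ε * c * B (z x) p, c * B (J (z x)) p, σ * B (ν x) p, ε * σ * B (J (ν x)) p], ?_⟩
      rw [Fintype.linearCombination_apply, Fin.sum_univ_four]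
      rfl
    have := LinearMap.finrank_le_finrank_of_surjective hsurj
    simp at this
    omega
  obtain ⟨X, hX, hXX⟩ := hr
  have hs : ∀ p, B (A p) p = 0 := by
    intro p
    refine bilin_self_eq_zero (b₁ := fun x y => B (P x) y) (b₂ := fun x y => B (A x) y) (x := X)
      ?_ ?_ ?_ ?_ p
    · intro x y t
      have : B (P y) x = B (P x) y := by rw [hPs, hB.symm]
      simp only [map_add, map_smul, add_apply, smul_apply, smul_eq_mul, this]; ring
    · intro x y t
      have : B (A y) x = B (A x) y := by rw [hAs, hB.symm]
      simp only [map_add, map_smul, add_apply, smul_apply, smul_eq_mul, this]; ring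
    · intro x
      have h1 := key (P x) (hPP x)
      have e1 : B (P x) (P x) = B (P x) x := by rw [hPs, hPP, ← hPs]
      have e2 : B (A x) (P x) = B (A x) x := by rw [← hPs, hPA]
      rwa [hAP, e1, e2] at h1
    · rwa [hX]
  -- polarization; then `A = 0` contradicts `A² = -εσc P`
  have hA0 : ∀ p, A p = 0 := by
    intro p
    refine hB.nondeg _ fun q => ?_
    have e1 := hs (p + q)
    simp only [map_add, add_apply, hs] at e1
    have : B (A q) p = B (A p) q := by rw [hAs, hB.symm]
    linarith
  have h1 := hAA X
  rw [hA0, hX, eq_comm, smul_eq_zero] at h1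
  rcases h1 with h1 | h1
  · simp [hε, hσ0, hc] at h1
  · simp [h1] at hXX

omit hx hcl in
/-- The Hopf principal curvature of a lifted Hopf hypersurface has zero differential. -/
theorem fderiv_a_eq_zero (hE : 2 ≤ finrank ℝ E) (hx : x ∈ O) : fderiv ℝ a x = 0 := by
  by_contra ha
  obtain ⟨O', hcl, hO', hxO'⟩ := eventually_nhds_iff.mp
    ((h.eventually_closed hx hB hσ hd ha).and (h.eventually hx))
  exact (h.mono hO' fun y hy => (hcl y hy).2).false_of_closed hxO' hB hσ hd
    (fun y hy => (hcl y hy).1) hE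

end IsHopfLift
end SpaceForms

end

noncomputable section

/-! ### The pseudo-Hermitian form of the ambient vector space -/

namespace SpaceForms
open Module

variable {n : ℕ}

/-- Multiplication by scalars, as a continuous bilinear map. -/
def scalL (κ : Kind) (n : ℕ) : (ℝ × ℝ) →L[ℝ] Vec n →L[ℝ] Vec n :=
  LinearMap.toContinuousLinearMap
    ((LinearMap.toContinuousLinearMap (𝕜 := ℝ) (E := Vec n) (F' := Vec n)).toLinearMap ∘ₗ
      LinearMap.mk₂ ℝ (scal κ)
        (fun a b z => by funext j; ext <;> simp [scal, mul] <;> ring)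
        (fun t a z => by funext j; ext <;> simp [scal, mul] <;> ring)
        (fun a z w => by funext j; ext <;> simp [scal, mul] <;> ring)
        (fun t a z => by funext j; ext <;> simp [scal, mul] <;> ring))

@[simp] lemma scalL_apply (κ : Kind) (a : ℝ × ℝ) (z : Vec n) : scalL κ n a z = scal κ a z := rfl

/-- The real part of the pseudo-Hermitian form, as a continuous bilinear form. -/
def formL (κ : Kind) (n : ℕ) : Vec n →L[ℝ] Vec n →L[ℝ] ℝ :=
  LinearMap.toContinuousLinearMap
    ((LinearMap.toContinuousLinearMap (𝕜 := ℝ) (E := Vec n) (F' := ℝ)).toLinearMap ∘ₗ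
      LinearMap.mk₂ ℝ (form κ)
        (fun a b z => by
          simp only [form, ← Finset.sum_add_distrib]
          exact Finset.sum_congr rfl fun j _ => by simp; ring)
        (fun t a z => by
          simp only [form, smul_eq_mul, Finset.mul_sum]
          exact Finset.sum_congr rfl fun j _ => by simp; ring)
        (fun a z w => by
          simp only [form, ← Finset.sum_add_distrib]
          exact Finset.sum_congr rfl fun j _ => by simp; ring)
        (fun t a z => by
          simp only [form, smul_eq_mul, Finset.mul_sum]
          exact Finset.sum_congr rfl fun j _ => by simp; ring))

@[simp] lemma formL_apply (κ : Kind) (z w : Vec n) : formL κ n z w = form κ z w := rfl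

/-- The (para-)complex structure of the vector space, as a continuous linear map. -/
def vecJL (κ : Kind) (n : ℕ) : Vec n →L[ℝ] Vec n := scalL κ n (0, 1)

lemma vecJL_apply (κ : Kind) (z : Vec n) : vecJL κ n z = vecJ κ z := rfl

lemma isPseudoHermitian_formL (κ : Kind) (n : ℕ) :
    IsPseudoHermitian (formL κ n) (vecJL κ n) κ.eps where
  symm x y := by
    change form κ x y = form κ y x
    exact Finset.sum_congr rfl fun j _ => by ring
  nondeg x hx := by
    have hs : ∀ j, κ.sgn j ≠ 0 := fun j => by
      cases κ <;> simp only [Kind.sgn] <;> (try split_ifs) <;> norm_num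
    funext j
    have h1 := hx (Pi.single j (1, 0))
    have h2 := hx (Pi.single j (0, 1))
    simp only [formL_apply, form] at h1 h2
    rw [Finset.sum_eq_single j (by intro i _ hi; simp [Pi.single_eq_of_ne hi]) (by simp)] at h1 h2
    simp [hs j, eps_ne κ] at h1 h2
    exact Prod.ext h1 h2
  sq x := by
    funext j
    ext <;> simp [vecJL, scal, mul]
  skew x y := by
    change form κ (vecJ κ x) y = -form κ x (vecJ κ y)
    simp only [form, ← Finset.sum_neg_distrib]
    refine Finset.sum_congr rfl fun j _ => ?_
    simp [vecJ, scal, mul]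
    ring
  eps := eps_sq κ

lemma scal_eq (κ : Kind) (a : ℝ × ℝ) (z : Vec n) : scal κ a z = a.1 • z + a.2 • vecJL κ n z := by
  funext j
  ext
  · simp [vecJL, scal, mul]; ring
  · simp [vecJL, scal, mul]

lemma form_scal_scal (κ : Kind) (a : ℝ × ℝ) (z w : Vec n) :
    form κ (scal κ a z) (scal κ a w) = nu κ a * form κ z w := by
  simp only [form, Finset.mul_sum]
  refine Finset.sum_congr rfl fun j _ => ?_
  simp only [scal, mul, nu]
  ring

lemma vecJL_scal (κ : Kind) (a : ℝ × ℝ) (z : Vec n) :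
    vecJL κ n (scal κ a z) = scal κ a (vecJL κ n z) := by
  change scal κ (0, 1) _ = scal κ a (scal κ (0, 1) z)
  rw [scal_scal, scal_scal, mul_comm']

lemma finrank_vec (n : ℕ) : finrank ℝ (Vec n) = 2 * n + 2 := by
  simp [finrank_pi_fintype]; ring

/-! ### Affine coordinates and sections of the hyperquadric -/

lemma contDiff_homog (κ : Kind) (k : Fin (n + 1)) (e : ℝ × ℝ) :
    ContDiff ℝ ∞ (homog (n := n) κ k e) := by
  refine contDiff_pi.mpr fun j => ?_
  rcases Fin.eq_self_or_eq_succAbove k j with rfl | ⟨i, rfl⟩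
  · simp only [homog_self]; exact contDiff_const
  · simp only [homog_succAbove, mul]; fun_prop

lemma contDiff_form (κ : Kind) : ContDiff ℝ ∞ fun z : Vec n => form κ z z := by
  unfold form; fun_prop

lemma isOpen_nu_ne (κ : Kind) (k : Fin (n + 1)) : IsOpen {z : Vec n | nu κ (z k) ≠ 0} :=
  isOpen_ne_fun ((continuous_nu κ).comp (continuous_apply k)) continuous_const

lemma contDiffOn_affine (κ : Kind) (k : Fin (n + 1)) :
    ContDiffOn ℝ ∞ (affine κ k) {z : Vec n | nu κ (z k) ≠ 0} := by
  have h4 : ContDiff ℝ ∞ fun z : Vec n => nu κ (z k) := by simp only [nu]; fun_prop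
  have e1 : ContDiffOn ℝ ∞ (fun z : Vec n => (z k).1 / nu κ (z k)) {z | nu κ (z k) ≠ 0} :=
    ContDiffOn.div (by fun_prop) h4.contDiffOn fun z hz => hz
  have e2 : ContDiffOn ℝ ∞ (fun z : Vec n => -(z k).2 / nu κ (z k)) {z | nu κ (z k) ≠ 0} :=
    ContDiffOn.div (by fun_prop) h4.contDiffOn fun z hz => hz
  refine contDiffOn_pi.mpr fun j => ?_
  simp only [affine, mul, inv]
  fun_prop

section affine

variable {κ : Kind} {k : Fin (n + 1)} {z : Vec n}

lemma differentiableAt_affine (hz : nu κ (z k) ≠ 0) : DifferentiableAt ℝ (affine κ k) z :=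
  ((contDiffOn_affine κ k).contDiffAt ((isOpen_nu_ne κ k).mem_nhds hz)).differentiableAt (by simp)

/-- The kernel of the differential of the affine coordinates consists of the multiples of `z`. -/
lemma exists_scal_of_fderiv_affine_eq_zero (hz : nu κ (z k) ≠ 0) {v : Vec n}
    (hv : fderiv ℝ (affine κ k) z v = 0) : ∃ t, v = scal κ t z := by
  have he : nu κ (1, 0) ≠ 0 := by simp [nu]
  -- differentiate the reconstruction of `y` from its affine coordinates and its `k`-th entry
  have key : ∀ᶠ y in 𝓝 z, scal κ (y k) (homog κ k (1, 0) (affine κ k y)) = y := by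
    filter_upwards [(isOpen_nu_ne κ k).mem_nhds hz] with y hy
    rw [homog_affine κ k _ hy, scal_scal, one_mul', mul_comm', inv_mul κ hy]
    funext j; simp [scal, one_mul']
  have hH : HasFDerivAt (fun y => homog κ k (1, 0) (affine κ k y))
      ((fderiv ℝ (homog κ k (1, 0)) (affine κ k z)).comp (fderiv ℝ (affine κ k) z)) z :=
    (((contDiff_homog κ k (1, 0)).differentiable (by simp)) _).hasFDerivAt.comp z
      (differentiableAt_affine hz).hasFDerivAt
  have hk : HasFDerivAt (fun y : Vec n => y k) (ContinuousLinearMap.proj k : Vec n →L[ℝ] ℝ × ℝ) z :=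
    (ContinuousLinearMap.proj (R := ℝ) (φ := fun _ : Fin (n + 1) => ℝ × ℝ) k).hasFDerivAt
  have h1 := (scalL κ n).hasFDerivAt_of_bilinear hk hH
  have h2 := (h1.congr_of_eventuallyEq (key.mono fun y hy => hy.symm)).unique (hasFDerivAt_id z)
  have h3 := congrArg (fun l => l v) h2
  simp [ContinuousLinearMap.precompR, ContinuousLinearMap.precompL, hv] at h3
  rw [homog_affine κ k _ hz, scal_scal, one_mul', ← scalL_apply κ (z k) 0, map_zero, zero_add] at h3
  exact ⟨_, h3.symm⟩

/-- Affine coordinates are constant along the multiples of `z`. -/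
lemma fderiv_affine_scal (hz : nu κ (z k) ≠ 0) (t : ℝ × ℝ) :
    fderiv ℝ (affine κ k) z (scal κ t z) = 0 := by
  have h1 : HasFDerivAt (fun a : ℝ × ℝ => scal κ a z) ((scalL κ n).flip z) (1, 0) :=
    ((scalL κ n).flip z).hasFDerivAt
  have h0 : scal κ (1, 0) z = z := by funext j; simp [scal, one_mul']
  have h2 : HasFDerivAt (fun a : ℝ × ℝ => affine κ k (scal κ a z))
      ((fderiv ℝ (affine κ k) z).comp ((scalL κ n).flip z)) (1, 0) := by
    have hz' : HasFDerivAt (affine κ k) (fderiv ℝ (affine κ k) z) (scal κ (1, 0) z) := by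
      rw [h0]
      exact (differentiableAt_affine hz).hasFDerivAt
    exact hz'.comp (1, 0) h1
  have h3 : ∀ᶠ a in 𝓝 ((1, 0) : ℝ × ℝ), affine κ k (scal κ a z) = affine κ k z := by
    have : ∀ᶠ a in 𝓝 ((1, 0) : ℝ × ℝ), nu κ a ≠ 0 :=
      (isOpen_ne_fun (continuous_nu κ) continuous_const).mem_nhds (by simp [nu])
    filter_upwards [this] with a ha using affine_scal κ k ha hz
  have h4 := ((hasFDerivAt_const (affine κ k z) _).congr_of_eventuallyEq h3).unique h2
  have h5 := congrArg (fun l => l t) h4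
  simpa using h5.symm

/-- The differential of the scale invariance of affine coordinates. -/
lemma fderiv_affine_scal_scal (hz : nu κ (z k) ≠ 0) {t : ℝ × ℝ} (ht : nu κ t ≠ 0) (v : Vec n) :
    fderiv ℝ (affine κ k) (scal κ t z) (scal κ t v) = fderiv ℝ (affine κ k) z v := by
  have htz : nu κ (scal κ t z k) ≠ 0 := by
    simp only [scal, nu_mul]; exact mul_ne_zero ht hz
  have h1 : HasFDerivAt (fun y => affine κ k (scal κ t y))
      ((fderiv ℝ (affine κ k) (scal κ t z)).comp (scalL κ n t)) z :=
    (differentiableAt_affine htz).hasFDerivAt.comp z (scalL κ n t).hasFDerivAt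
  have h3 : ∀ᶠ y in 𝓝 z, affine κ k (scal κ t y) = affine κ k y := by
    filter_upwards [(isOpen_nu_ne κ k).mem_nhds hz] with y hy using affine_scal κ k ht hy
  have h4 := h1.unique ((differentiableAt_affine hz).hasFDerivAt.congr_of_eventuallyEq h3)
  exact congrArg (fun l => l v) h4

end affine

end SpaceForms

end

noncomputable section

/-! ### Horizontal lifts and the projected flat connection -/

namespace SpaceForms
open Module

variable {n : ℕ}

/-- The projection onto the horizontal space at `z`, that is the orthogonal of `z` and `J z`, when
`⟨z, z⟩ = ε / c`. -/
def horProj (κ : Kind) (n : ℕ) (c : ℝ) (z : Vec n) : Vec n →L[ℝ] Vec n :=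
  ContinuousLinearMap.id ℝ (Vec n) - ((κ.eps * c) • (formL κ n z).smulRight z +
    c • (formL κ n (vecJL κ n z)).smulRight (vecJL κ n z))

lemma contDiff_horProj (κ : Kind) (n : ℕ) (c : ℝ) : ContDiff ℝ ∞ (horProj κ n c) := by
  have h1 : ContDiff ℝ ∞ fun z : Vec n => (formL κ n z).smulRight z :=
    (formL κ n).contDiff.smulRight contDiff_id
  have h2 : ContDiff ℝ ∞ fun z : Vec n => (formL κ n (vecJL κ n z)).smulRight (vecJL κ n z) :=
    ((formL κ n).comp (vecJL κ n)).contDiff.smulRight (vecJL κ n).contDiff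
  exact contDiff_const.sub ((h1.const_smul (κ.eps * c)).add (h2.const_smul c))

lemma horProj_apply (κ : Kind) (c : ℝ) (z v : Vec n) : horProj κ n c z v =
    v - ((κ.eps * c * formL κ n z v) • z + (c * formL κ n (vecJL κ n z) v) • vecJL κ n z) := by
  simp [horProj, smul_smul]

/-- `s` is a smooth section over `T`, in the `k`-th affine coordinates, of the projection of the
hyperquadric. -/
structure IsSection (κ : Kind) {n : ℕ} (c : ℝ) (k : Fin (n + 1)) (T : Set (Model n))
    (s : Model n → Vec n) : Prop where
  isOpen : IsOpen T
  smooth : ContDiffOn ℝ ∞ s T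
  quadric : ∀ w ∈ T, form κ (s w) (s w) = κ.eps / c
  nu_ne : ∀ w ∈ T, nu κ (s w k) ≠ 0
  affine : ∀ w ∈ T, affine κ k (s w) = w

/-- The horizontal lift along the section `s` of tangent vectors of the space form, expressed in
affine coordinates. -/
def lift (κ : Kind) {n : ℕ} (c : ℝ) (s : Model n → Vec n) (w : Model n) : Model n →L[ℝ] Vec n :=
  (horProj κ n c (s w)).comp (fderiv ℝ s w)

/-- The Levi-Civita connection in affine coordinates: the covariant derivative at `w` in the
direction `x` of the vector field `y`. It is the projection of the derivative of the horizontal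
lift of `y` along the horizontal lift of `x`. The section differentiates along `ds(x)` instead, so
the contribution of its vertical component, along which horizontal lifts are rotated by `J`, is
subtracted. -/
def localConn (κ : Kind) {n : ℕ} (c : ℝ) (k : Fin (n + 1)) (s : Model n → Vec n)
    (y : Model n → Model n) (w x : Model n) : Model n :=
  fderiv ℝ (SpaceForms.affine κ k) (s w) (fderiv ℝ (fun w' => lift κ c s w' (y w')) w x -
    (c * formL κ n (fderiv ℝ s w x) (vecJL κ n (s w))) • vecJL κ n (lift κ c s w (y w)))

namespace IsSection

variable {κ : Kind} {c : ℝ} {k : Fin (n + 1)} {T : Set (Model n)} {s : Model n → Vec n}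
  (h : IsSection κ c k T s) {w : Model n} (hw : w ∈ T)
include h hw

lemma contDiffAt : ContDiffAt ℝ ∞ s w := h.smooth.contDiffAt (h.isOpen.mem_nhds hw)

lemma differentiableAt : DifferentiableAt ℝ s w := (h.contDiffAt hw).differentiableAt (by simp)

lemma contDiffAt_lift : ContDiffAt ℝ ∞ (lift κ c s) w :=
  ((contDiff_horProj κ n c).contDiffAt.comp w (h.contDiffAt hw)).clm_comp
    ((h.contDiffAt hw).fderiv_right (m := ∞) (by simp))

lemma differentiableAt_lift : DifferentiableAt ℝ (lift κ c s) w :=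
  (h.contDiffAt_lift hw).differentiableAt (by simp)

lemma differentiableAt_lift_apply {y : Model n → Model n} (hy : DifferentiableAt ℝ y w) :
    DifferentiableAt ℝ (fun w' => lift κ c s w' (y w')) w :=
  (h.differentiableAt_lift hw).clm_apply hy

lemma fderiv_affine (y : Model n) : fderiv ℝ (SpaceForms.affine κ k) (s w) (fderiv ℝ s w y) = y := by
  have h1 : HasFDerivAt (fun w' => SpaceForms.affine κ k (s w'))
      ((fderiv ℝ (SpaceForms.affine κ k) (s w)).comp (fderiv ℝ s w)) w :=
    (differentiableAt_affine (h.nu_ne w hw)).hasFDerivAt.comp w (h.differentiableAt hw).hasFDerivAt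
  have h2 : ∀ᶠ w' in 𝓝 w, SpaceForms.affine κ k (s w') = w' := by
    filter_upwards [h.isOpen.mem_nhds hw] with w' hw' using h.affine w' hw'
  exact congrArg (fun l => l y) (h1.unique ((hasFDerivAt_id w).congr_of_eventuallyEq h2))

lemma fderiv_affine_self : fderiv ℝ (SpaceForms.affine κ k) (s w) (s w) = 0 := by
  have := fderiv_affine_scal (h.nu_ne w hw) (1, 0)
  rwa [show scal κ (1, 0) (s w) = s w by funext j; simp [scal, one_mul']] at this

lemma fderiv_affine_vecJ : fderiv ℝ (SpaceForms.affine κ k) (s w) (vecJL κ n (s w)) = 0 :=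
  fderiv_affine_scal (h.nu_ne w hw) (0, 1)

lemma fderiv_affine_horProj (v : Vec n) :
    fderiv ℝ (SpaceForms.affine κ k) (s w) (horProj κ n c (s w) v) =
      fderiv ℝ (SpaceForms.affine κ k) (s w) v := by
  rw [horProj_apply, map_sub, map_add, map_smul, map_smul, h.fderiv_affine_self hw,
    h.fderiv_affine_vecJ hw]
  simp

lemma fderiv_affine_lift (y : Model n) :
    fderiv ℝ (SpaceForms.affine κ k) (s w) (lift κ c s w y) = y :=
  (h.fderiv_affine_horProj hw _).trans (h.fderiv_affine hw y)

lemma formL_self : formL κ n (s w) (s w) = κ.eps / c := h.quadric w hw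

lemma formL_fderiv (y : Model n) : formL κ n (s w) (fderiv ℝ s w y) = 0 := by
  have h1 := fderiv_bilin (formL κ n) (h.differentiableAt hw) (h.differentiableAt hw) y
  have h2 : (fun w' => formL κ n (s w') (s w')) =ᶠ[𝓝 w] fun _ => κ.eps / c := by
    filter_upwards [h.isOpen.mem_nhds hw] with w' hw' using h.quadric w' hw'
  rw [h2.fderiv_eq, (isPseudoHermitian_formL κ n).symm (fderiv ℝ s w y)] at h1
  simp [-formL_apply] at h1
  linarith

lemma lift_apply (y : Model n) : lift κ c s w y = fderiv ℝ s w y -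
    (c * formL κ n (fderiv ℝ s w y) (vecJL κ n (s w))) • vecJL κ n (s w) := by
  change horProj κ n c (s w) (fderiv ℝ s w y) = _
  rw [horProj_apply, h.formL_fderiv hw, (isPseudoHermitian_formL κ n).symm (vecJL κ n (s w))]
  simp

variable [NeZero c]

lemma formL_horProj (v : Vec n) : formL κ n (s w) (horProj κ n c (s w) v) = 0 := by
  have hB := isPseudoHermitian_formL κ n
  have hc : c ≠ 0 := NeZero.ne c
  rw [horProj_apply]
  simp only [map_sub, map_add, map_smul, smul_eq_mul, h.formL_self hw, hB.J_self]
  field_simp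
  linear_combination (-formL κ n (s w) v) * hB.eps

lemma formL_vecJ_horProj (v : Vec n) :
    formL κ n (vecJL κ n (s w)) (horProj κ n c (s w) v) = 0 := by
  have hB := isPseudoHermitian_formL κ n
  have hc : c ≠ 0 := NeZero.ne c
  rw [horProj_apply]
  simp only [map_sub, map_add, map_smul, smul_eq_mul, hB.J_J, h.formL_self hw,
    hB.symm (vecJL κ n (s w)) (s w), hB.J_self]
  field_simp
  linear_combination (-formL κ n (vecJL κ n (s w)) v) * hB.eps

lemma formL_lift (y : Model n) : formL κ n (s w) (lift κ c s w y) = 0 := h.formL_horProj hw _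

lemma formL_vecJ_lift (y : Model n) : formL κ n (vecJL κ n (s w)) (lift κ c s w y) = 0 :=
  h.formL_vecJ_horProj hw _

/-- A horizontal vector is determined by its image under the projection. -/
lemma eq_lift {v : Vec n} (h1 : formL κ n (s w) v = 0) (h2 : formL κ n (vecJL κ n (s w)) v = 0) :
    v = lift κ c s w (fderiv ℝ (SpaceForms.affine κ k) (s w) v) := by
  have hB := isPseudoHermitian_formL κ n
  have hc : c ≠ 0 := NeZero.ne c
  set y := fderiv ℝ (SpaceForms.affine κ k) (s w) v with hy
  have h0 : fderiv ℝ (SpaceForms.affine κ k) (s w) (v - lift κ c s w y) = 0 := by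
    rw [map_sub, h.fderiv_affine_lift hw, sub_self]
  obtain ⟨t, ht⟩ := exists_scal_of_fderiv_affine_eq_zero (h.nu_ne w hw) h0
  have e1 : formL κ n (s w) (v - lift κ c s w y) = 0 := by
    rw [map_sub, h1, h.formL_lift hw, sub_self]
  have e2 : formL κ n (vecJL κ n (s w)) (v - lift κ c s w y) = 0 := by
    rw [map_sub, h2, h.formL_vecJ_lift hw, sub_self]
  rw [ht, scal_eq] at e1 e2
  simp only [map_add, map_smul, smul_eq_mul, h.formL_self hw, hB.J_J, hB.J_self,
    hB.symm (vecJL κ n (s w)) (s w)] at e1 e2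
  have he := eps_ne κ
  have t1 : t.1 = 0 := by
    rw [mul_zero, add_zero] at e1
    exact (mul_eq_zero.mp e1).resolve_right (div_ne_zero he hc)
  have t2 : t.2 = 0 := by
    rw [mul_zero, zero_add] at e2
    exact (mul_eq_zero.mp e2).resolve_right (mul_ne_zero he (div_ne_zero he hc))
  rw [scal_eq, t1, t2] at ht
  simpa [sub_eq_zero] using ht

lemma lift_fderiv_affine (v : Vec n) :
    lift κ c s w (fderiv ℝ (SpaceForms.affine κ k) (s w) v) = horProj κ n c (s w) v := by
  have := h.eq_lift hw (h.formL_horProj hw v) (h.formL_vecJ_horProj hw v)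
  rw [h.fderiv_affine_horProj hw] at this
  exact this.symm

lemma formL_horProj_lift (v : Vec n) (y : Model n) :
    formL κ n (horProj κ n c (s w) v) (lift κ c s w y) = formL κ n v (lift κ c s w y) := by
  rw [horProj_apply]
  simp [-formL_apply, h.formL_lift hw, h.formL_vecJ_lift hw]

lemma vecJ_lift (y : Model n) : vecJL κ n (lift κ c s w y) =
    lift κ c s w (fderiv ℝ (SpaceForms.affine κ k) (s w) (vecJL κ n (lift κ c s w y))) := by
  have hB := isPseudoHermitian_formL κ n
  refine h.eq_lift hw ?_ ?_
  · have := hB.skew (s w) (lift κ c s w y)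
    rw [h.formL_vecJ_lift hw] at this
    linarith
  · rw [hB.J_J, h.formL_lift hw, mul_zero]

/-- The metric is non-degenerate. -/
lemma eq_zero_of_formL_lift {y : Model n}
    (hy : ∀ y', formL κ n (lift κ c s w y) (lift κ c s w y') = 0) : y = 0 := by
  have hB := isPseudoHermitian_formL κ n
  have : lift κ c s w y = 0 := hB.nondeg _ fun v => by
    rw [hB.symm, ← h.formL_horProj_lift hw, ← h.lift_fderiv_affine hw, hB.symm]
    exact hy _
  rw [← h.fderiv_affine_lift hw y, this, map_zero]

lemma lift_localConn (y : Model n → Model n) (x : Model n) : lift κ c s w (localConn κ c k s y w x) =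
    horProj κ n c (s w) (fderiv ℝ (fun w' => lift κ c s w' (y w')) w x -
    (c * formL κ n (fderiv ℝ s w x) (vecJL κ n (s w))) • vecJL κ n (lift κ c s w (y w))) :=
  h.lift_fderiv_affine hw _

/-- The projected flat connection is metric. -/
lemma formL_lift_localConn {y₁ y₂ : Model n → Model n} (h₁ : DifferentiableAt ℝ y₁ w)
    (h₂ : DifferentiableAt ℝ y₂ w) (x : Model n) :
    fderiv ℝ (fun w' => formL κ n (lift κ c s w' (y₁ w')) (lift κ c s w' (y₂ w'))) w x =
      formL κ n (lift κ c s w (localConn κ c k s y₁ w x)) (lift κ c s w (y₂ w)) +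
      formL κ n (lift κ c s w (y₁ w)) (lift κ c s w (localConn κ c k s y₂ w x)) := by
  have hB := isPseudoHermitian_formL κ n
  rw [fderiv_bilin (formL κ n) (h.differentiableAt_lift_apply hw h₁)
    (h.differentiableAt_lift_apply hw h₂), hB.symm (lift κ c s w (y₁ w)) (lift κ c s w _),
    h.lift_localConn hw, h.lift_localConn hw, h.formL_horProj_lift hw, h.formL_horProj_lift hw]
  simp only [map_sub, map_smul, sub_apply, smul_apply,
    smul_eq_mul, hB.skew, hB.symm (lift κ c s w (y₂ w)) (vecJL κ n _)]
  rw [hB.symm (lift κ c s w (y₁ w)) (fderiv ℝ _ w x)]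
  ring

omit [NeZero c] in
/-- The projected flat connection is torsion-free. -/
lemma localConn_sub {x y : Model n → Model n} (hx : DifferentiableAt ℝ x w)
    (hy : DifferentiableAt ℝ y w) : localConn κ c k s y w (x w) - localConn κ c k s x w (y w) =
      fderiv ℝ y w (x w) - fderiv ℝ x w (y w) := by
  have hB := isPseudoHermitian_formL κ n
  have h2 : ContDiffAt ℝ 2 s w := (h.contDiffAt hw).of_le (by norm_cast)
  have hds : DifferentiableAt ℝ (fderiv ℝ s) w :=
    (h2.fderiv_right (m := 1) (by norm_num)).differentiableAt (by norm_num)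
  have key : ∀ (x y : Model n → Model n) (hy : DifferentiableAt ℝ y w),
      localConn κ c k s y w (x w) = fderiv ℝ y w (x w) +
        fderiv ℝ (SpaceForms.affine κ k) (s w) (fderiv ℝ (fderiv ℝ s) w (x w) (y w) -
        (c * formL κ n (fderiv ℝ s w (x w)) (vecJL κ n (s w))) • vecJL κ n (fderiv ℝ s w (y w)) -
        (c * formL κ n (fderiv ℝ s w (y w)) (vecJL κ n (s w))) • vecJL κ n (fderiv ℝ s w (x w))) := by
    intro x y hy
    have e1 : (fun w' => lift κ c s w' (y w')) =ᶠ[𝓝 w] fun w' => fderiv ℝ s w' (y w') -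
        (c * formL κ n (fderiv ℝ s w' (y w')) (vecJL κ n (s w'))) • vecJL κ n (s w') := by
      filter_upwards [h.isOpen.mem_nhds hw] with w' hw' using h.lift_apply hw' _
    have d1 : HasFDerivAt (fun w' => fderiv ℝ s w' (y w'))
        ((fderiv ℝ s w).comp (fderiv ℝ y w) + (fderiv ℝ (fderiv ℝ s) w).flip (y w)) w :=
      hds.hasFDerivAt.clm_apply hy.hasFDerivAt
    have d2 : HasFDerivAt (fun w' => vecJL κ n (s w')) ((vecJL κ n).comp (fderiv ℝ s w)) w :=
      (vecJL κ n).hasFDerivAt.comp w (h.differentiableAt hw).hasFDerivAt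
    have d3 : DifferentiableAt ℝ
        (fun w' => c * formL κ n (fderiv ℝ s w' (y w')) (vecJL κ n (s w'))) w :=
      (((formL κ n).differentiableAt.comp w d1.differentiableAt).clm_apply
        d2.differentiableAt).const_mul c
    have d4 := d1.fun_sub (d3.hasFDerivAt.fun_smul d2)
    unfold localConn
    rw [e1.fderiv_eq, d4.fderiv, h.lift_apply hw]
    simp only [sub_apply, add_apply,
      ContinuousLinearMap.comp_apply, ContinuousLinearMap.flip_apply,
      smul_apply, ContinuousLinearMap.smulRight_apply, map_sub, map_add,
      map_smul, h.fderiv_affine hw, h.fderiv_affine_vecJ hw, hB.sq, map_neg, h.fderiv_affine_self hw]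
    simp only [smul_zero, neg_zero]
    module
  rw [key x y hy, key y x hx, fderiv_fderiv_comm h2 (y w) (x w)]
  simp only [map_sub]
  abel

end IsSection

end SpaceForms

end

noncomputable section

/-! ### Charts of the space form and the projection -/

namespace SpaceForms
open Module

variable {κ : Kind} {n : ℕ} {c : ℝ} [NeZero c]

/-- The section of the hyperquadric over the chart at `q₁`: the homogeneous vector with affine
coordinates `w`, scaled to the quadric. Outside the chart the square root takes a junk value. -/
def sec (q₁ : SpaceForm κ n c) (w : Model n) : Vec n :=
  Real.sqrt (κ.eps / c / form κ (homog κ (coordAt q₁) (rep q₁ (coordAt q₁)) w)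
    (homog κ (coordAt q₁) (rep q₁ (coordAt q₁)) w)) • homog κ (coordAt q₁) (rep q₁ (coordAt q₁)) w

lemma nu_rep_coordAt (q : SpaceForm κ n c) : nu κ (rep q (coordAt q)) ≠ 0 :=
  (exists_coord (Quotient.out q)).choose_spec

lemma isSection_sec (q₁ : SpaceForm κ n c) :
    IsSection κ c (coordAt q₁) (chartAt (Model n) q₁).target (sec q₁) := by
  have he := nu_rep_coordAt q₁
  have hk : ∀ w ∈ (chartAt (Model n) q₁).target, 0 < κ.eps / c *
    form κ (homog κ (coordAt q₁) (rep q₁ (coordAt q₁)) w)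
      (homog κ (coordAt q₁) (rep q₁ (coordAt q₁)) w) := fun w hw => hw
  have hnu : ∀ w ∈ (chartAt (Model n) q₁).target, nu κ (Real.sqrt (κ.eps / c / form κ
      (homog κ (coordAt q₁) (rep q₁ (coordAt q₁)) w)
      (homog κ (coordAt q₁) (rep q₁ (coordAt q₁)) w)), 0) ≠ 0 := fun w hw =>
    (pos_real κ (ratio_pos (hk w hw))).nu_pos.ne'
  refine ⟨(chartAt (Model n) q₁).open_target, ?_, fun w hw => scaled_mem hw, ?_, ?_⟩
  · intro w hw
    have h0 := hk w hw
    have h1 : form κ (homog κ (coordAt q₁) (rep q₁ (coordAt q₁)) w)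
      (homog κ (coordAt q₁) (rep q₁ (coordAt q₁)) w) ≠ 0 := right_ne_zero_of_mul h0.ne'
    have h2 := Real.sqrt_pos.mp (ratio_pos h0)
    have hf := (contDiff_form (n := n) κ).comp (contDiff_homog κ (coordAt q₁) (rep q₁ (coordAt q₁)))
    exact (((contDiffAt_const.div hf.contDiffAt h1).sqrt h2.ne').smul
      (contDiff_homog κ _ _).contDiffAt).contDiffWithinAt
  · intro w hw
    rw [sec, smul_eq_scal κ]
    simp only [scal, nu_mul, homog_self]
    exact mul_ne_zero (hnu w hw) he
  · intro w hw
    rw [sec, smul_eq_scal κ, affine_scal κ _ (hnu w hw) (by rw [homog_self]; exact he),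
      affine_homog κ _ he]

section chart

variable {q₁ q : SpaceForm κ n c} (hq : q ∈ (chartAt (Model n) q₁).source)

include hq

lemma rep_mem_chartDom : rep q ∈ chartDom κ (coordAt q₁) (rep q₁ (coordAt q₁)) := by
  have h : pr κ n c (Quotient.out q) = q := Quotient.out_eq q
  refine pr_mem_chartSource (c := c) (z := Quotient.out q) |>.mp ?_
  rw [h]
  exact hq

lemma nu_rep : nu κ (rep q (coordAt q₁)) ≠ 0 := nu_ne_of_chartDom (rep_mem_chartDom hq)

lemma chartAt_eq_affine : chartAt (Model n) q₁ q = affine κ (coordAt q₁) (rep q) := by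
  have h : pr κ n c (Quotient.out q) = q := Quotient.out_eq q
  change chartFun κ n c (coordAt q₁) q = _
  conv_lhs => rw [← h]
  exact chartFun_pr (nu_rep hq)

/-- The chosen representative of `q` differs from the section by a unit scalar. -/
lemma exists_phase : ∃ t, nu κ t = 1 ∧ rep q = scal κ t (sec q₁ (chartAt (Model n) q₁ q)) := by
  have hz := nu_rep hq
  have hs := isSection_sec q₁
  have hw := (chartAt (Model n) q₁).map_source hq
  have hc : κ.eps / c ≠ 0 := div_ne_zero (eps_ne κ) (NeZero.ne c)
  have h1 : ∃ t, sec q₁ (chartAt (Model n) q₁ q) = scal κ t (rep q) := by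
    rw [chartAt_eq_affine hq, sec, homog_affine κ _ _ hz, smul_eq_scal κ, scal_scal]
    exact ⟨_, rfl⟩
  obtain ⟨t, ht⟩ := h1
  have hnu : nu κ t = 1 := by
    have h2 := hs.quadric _ hw
    rw [ht, form_scal, show form κ (rep q) (rep q) = κ.eps / c from (Quotient.out q).2] at h2
    exact mul_right_cancel₀ hc (h2.trans (one_mul _).symm)
  refine ⟨inv κ t, by rw [nu_inv, hnu, inv_one], ?_⟩
  rw [ht, scal_scal, inv_mul κ (by rw [hnu]; exact one_ne_zero)]
  funext j; simp [scal, one_mul']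

omit hq in
lemma proj_rep (q : SpaceForm κ n c) : proj κ n c q (rep q) = q := by
  have hf : form κ (rep q) (rep q) = κ.eps / c := (Quotient.out q).2
  have hc : κ.eps / c ≠ 0 := div_ne_zero (eps_ne κ) (NeZero.ne c)
  have hp : 0 < κ.eps / c * form κ (rep q) (rep q) := by rw [hf]; exact mul_self_pos.mpr hc
  rw [proj_of_pos q hp]
  conv_rhs => rw [← Quotient.out_eq q]
  change pr κ n c _ = pr κ n c (Quotient.out q)
  congr 1
  ext1
  change Real.sqrt _ • rep q = rep q
  rw [hf, div_self hc, Real.sqrt_one, one_smul]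

/-- Near the chosen representative, the projection read in the chart at `q₁` is `affine`. -/
lemma eventually_proj : ∀ᶠ z in 𝓝 (rep q), proj κ n c q z ∈ (chartAt (Model n) q₁).source ∧
    chartAt (Model n) q₁ (proj κ n c q z) = affine κ (coordAt q₁) z := by
  have hf : form κ (rep q) (rep q) = κ.eps / c := (Quotient.out q).2
  have hc : κ.eps / c ≠ 0 := div_ne_zero (eps_ne κ) (NeZero.ne c)
  have hp : 0 < κ.eps / c * form κ (rep q) (rep q) := by rw [hf]; exact mul_self_pos.mpr hc
  filter_upwards [(isOpen_chartDom κ _ _).mem_nhds (rep_mem_chartDom hq),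
    (isOpen_lt continuous_const (continuous_const.mul (continuous_form κ))).mem_nhds hp] with z h1 h2
  have h2 : 0 < κ.eps / c * form κ z z := h2
  have h3 := pos_real κ (ratio_pos h2)
  have h4 : proj κ n c q z = pr κ n c ⟨_, scaled_mem h2⟩ := proj_of_pos q h2
  have h5 : Real.sqrt (κ.eps / c / form κ z z) • z ∈ chartDom κ (coordAt q₁) (rep q₁ (coordAt q₁)) := by
    rw [smul_eq_scal κ]; exact scal_mem_chartDom h3 h1
  rw [h4]
  refine ⟨pr_mem_chartSource.mpr h5, ?_⟩
  refine (chartFun_pr (nu_ne_of_chartDom h5)).trans ?_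
  change affine κ _ (Real.sqrt (κ.eps / c / form κ z z) • z) = _
  rw [smul_eq_scal κ, affine_scal κ _ h3.nu_pos.ne' (nu_ne_of_chartDom h1)]

lemma mdifferentiableAt_proj : MDifferentiableAt 𝓘(ℝ, Vec n) 𝓘(ℝ, Model n) (proj κ n c q) (rep q) := by
  have h1 : proj κ n c q =ᶠ[𝓝 (rep q)] (chartAt (Model n) q₁).symm ∘ affine κ (coordAt q₁) := by
    filter_upwards [eventually_proj hq] with z hz
    rw [Function.comp_apply, ← hz.2, (chartAt (Model n) q₁).left_inv hz.1]
  refine MDifferentiableAt.congr_of_eventuallyEq ?_ h1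
  refine MDifferentiableAt.comp (I' := 𝓘(ℝ, Model n)) _ ?_
    (differentiableAt_affine (nu_rep hq)).mdifferentiableAt
  refine mdifferentiableAt_atlas_symm (chart_mem_atlas _ q₁) ?_
  rw [← chartAt_eq_affine hq]
  exact (chartAt (Model n) q₁).map_source hq

omit hq in
/-- The differential at `q` of the chart at `q₁`. -/
def dcoord (q₁ q : SpaceForm κ n c) : Tan q →L[ℝ] Model n :=
  (trivializationAt (Model n) (TangentSpace 𝓘(ℝ, Model n)) q₁).continuousLinearMapAt ℝ q

omit hq in
/-- The inverse of `dcoord`. -/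
def dcoordSymm (q₁ q : SpaceForm κ n c) : Model n →L[ℝ] Tan q :=
  (trivializationAt (Model n) (TangentSpace 𝓘(ℝ, Model n)) q₁).symmL ℝ q

lemma mem_baseSet : q ∈ (trivializationAt (Model n) (TangentSpace 𝓘(ℝ, Model n)) q₁).baseSet := by
  simpa using hq

lemma dcoordSymm_dcoord (u : Tan q) : dcoordSymm q₁ q (dcoord q₁ q u) = u :=
  Bundle.Trivialization.symmL_continuousLinearMapAt _ (mem_baseSet hq) u

lemma dcoord_dcoordSymm (y : Model n) : dcoord q₁ q (dcoordSymm q₁ q y) = y :=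
  Bundle.Trivialization.continuousLinearMapAt_symmL _ (mem_baseSet hq) y

lemma dcoord_injective : Function.Injective (dcoord q₁ q) :=
  Function.LeftInverse.injective (dcoordSymm_dcoord hq)

lemma dcoord_eq_mfderiv : dcoord q₁ q = mfderiv 𝓘(ℝ, Model n) 𝓘(ℝ, Model n) (chartAt (Model n) q₁) q := by
  have := TangentBundle.continuousLinearMapAt_trivializationAt (I := 𝓘(ℝ, Model n)) hq
  simpa [dcoord] using! this

lemma mdifferentiableAt_chartAt :
    MDifferentiableAt 𝓘(ℝ, Model n) 𝓘(ℝ, Model n) (chartAt (Model n) q₁) q :=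
  mdifferentiableAt_atlas (chart_mem_atlas _ q₁) hq

/-- The differential of the projection, read in the chart at `q₁`. -/
lemma dcoord_dproj (v : Vec n) :
    dcoord q₁ q (dproj q v) = fderiv ℝ (affine κ (coordAt q₁)) (rep q) v := by
  have h1 : mfderiv 𝓘(ℝ, Vec n) 𝓘(ℝ, Model n) (chartAt (Model n) q₁ ∘ proj κ n c q) (rep q) =
      mfderiv 𝓘(ℝ, Vec n) 𝓘(ℝ, Model n) (affine κ (coordAt q₁)) (rep q) :=
    Filter.EventuallyEq.mfderiv_eq ((eventually_proj hq).mono fun z hz => hz.2)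
  rw [mfderiv_comp (I' := 𝓘(ℝ, Model n)) (rep q)
    (by rw [proj_rep]; exact mdifferentiableAt_chartAt hq) (mdifferentiableAt_proj hq)] at h1
  have h2 : ∀ q', q' = q → ∀ y : Model n,
    (mfderiv 𝓘(ℝ, Model n) 𝓘(ℝ, Model n) (chartAt (Model n) q₁) q' : Model n → Model n) y =
      (mfderiv 𝓘(ℝ, Model n) 𝓘(ℝ, Model n) (chartAt (Model n) q₁) q : Model n → Model n) y := by
    rintro _ rfl _; rfl
  rw [dcoord_eq_mfderiv hq]
  exact (h2 _ (proj_rep q) _).symm.trans (congrArg (fun l : Vec n →L[ℝ] Model n => l v)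
    (h1.trans mfderiv_eq_fderiv))

end chart

end SpaceForms

end

noncomputable section

/-! ### The metric and the complex structure in affine coordinates -/

namespace SpaceForms
open Module

variable {κ : Kind} {n : ℕ} {c : ℝ} [NeZero c]

section chart

variable {q₁ q : SpaceForm κ n c} (hq : q ∈ (chartAt (Model n) q₁).source)

include hq

/-- The horizontal lift of the definition of the metric is, up to a unit scalar, the horizontal
lift along the section. -/
lemma exists_hlift_eq : ∃ t, nu κ t = 1 ∧ rep q = scal κ t (sec q₁ (chartAt (Model n) q₁ q)) ∧
    ∀ u, hlift q u = scal κ t (lift κ c (sec q₁) (chartAt (Model n) q₁ q) (dcoord q₁ q u)) := by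
  obtain ⟨t, ht, hrep⟩ := exists_phase hq
  refine ⟨t, ht, hrep, fun u => ?_⟩
  have hs := isSection_sec q₁
  have hw := (chartAt (Model n) q₁).map_source hq
  set w := chartAt (Model n) q₁ q with hwdef
  have hnu : nu κ t ≠ 0 := by rw [ht]; exact one_ne_zero
  have hor : ∀ v, IsHorizontal q (scal κ t v) ↔
      formL κ n (sec q₁ w) v = 0 ∧ formL κ n (vecJL κ n (sec q₁ w)) v = 0 := by
    intro v
    have e1 : vecJ κ (scal κ t (sec q₁ w)) = scal κ t (vecJL κ n (sec q₁ w)) := vecJL_scal κ t _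
    rw [IsHorizontal, hrep, e1, form_scal_scal, form_scal_scal, ht, one_mul, one_mul]
    rfl
  have hd : ∀ v, dcoord q₁ q (dproj q (scal κ t v)) =
      fderiv ℝ (affine κ (coordAt q₁)) (sec q₁ w) v := by
    intro v
    rw [dcoord_dproj hq, hrep, fderiv_affine_scal_scal (hs.nu_ne w hw) hnu]
  have hex : ∃ v, IsHorizontal q v ∧ dproj q v = u := by
    refine ⟨scal κ t (lift κ c (sec q₁) w (dcoord q₁ q u)),
      (hor _).mpr ⟨hs.formL_lift hw _, hs.formL_vecJ_lift hw _⟩, dcoord_injective hq ?_⟩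
    rw [hd, hs.fderiv_affine_lift hw]
  obtain ⟨h1, h2⟩ := Classical.epsilon_spec hex
  change IsHorizontal q (hlift q u) at h1
  change dproj q (hlift q u) = u at h2
  have h3 : hlift q u = scal κ t (scal κ (inv κ t) (hlift q u)) := by
    rw [scal_scal, mul_comm' κ t, inv_mul κ hnu]
    funext j; simp [scal, one_mul']
  rw [h3] at h1 h2 ⊢
  obtain ⟨h4, h5⟩ := (hor _).mp h1
  have h6 := hs.eq_lift hw h4 h5
  rw [← hd, h2] at h6
  rw [h6]

lemma metric_eq (u v : Tan q) : metric q u v =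
    formL κ n (lift κ c (sec q₁) (chartAt (Model n) q₁ q) (dcoord q₁ q u))
      (lift κ c (sec q₁) (chartAt (Model n) q₁ q) (dcoord q₁ q v)) := by
  obtain ⟨t, ht, -, h⟩ := exists_hlift_eq hq
  rw [metric, h, h, form_scal_scal, ht, one_mul]
  rfl

lemma lift_structJ (u : Tan q) :
    lift κ c (sec q₁) (chartAt (Model n) q₁ q) (dcoord q₁ q (structJ q u)) =
      vecJL κ n (lift κ c (sec q₁) (chartAt (Model n) q₁ q) (dcoord q₁ q u)) := by
  obtain ⟨t, ht, hrep, h⟩ := exists_hlift_eq hq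
  have hs := isSection_sec q₁
  have hw := (chartAt (Model n) q₁).map_source hq
  have hnu : nu κ t ≠ 0 := by rw [ht]; exact one_ne_zero
  rw [hs.vecJ_lift hw, structJ, h, dcoord_dproj hq, hrep, ← vecJL_apply, vecJL_scal,
    fderiv_affine_scal_scal (hs.nu_ne _ hw) hnu]

end chart

/-! ### Vector fields in affine coordinates -/

/-- The vector field `Y` in the coordinates of the chart at `q₁`. -/
def coordField (q₁ : SpaceForm κ n c) (Y : Π q : SpaceForm κ n c, Tan q) (w : Model n) : Model n :=
  dcoord q₁ ((chartAt (Model n) q₁).symm w) (Y ((chartAt (Model n) q₁).symm w))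

/-- The vector field which is `y` in the coordinates of the chart at `q₁`. -/
def localField (q₁ : SpaceForm κ n c) (y : Model n → Model n) (q : SpaceForm κ n c) : Tan q :=
  dcoordSymm q₁ q (y (chartAt (Model n) q₁ q))

section chart

variable {q₁ q : SpaceForm κ n c} (hq : q ∈ (chartAt (Model n) q₁).source)
include hq

lemma coordField_chartAt (Y : Π q : SpaceForm κ n c, Tan q) :
    coordField q₁ Y (chartAt (Model n) q₁ q) = dcoord q₁ q (Y q) := by
  rw [coordField, (chartAt (Model n) q₁).left_inv hq]

lemma dcoord_localField (y : Model n → Model n) :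
    dcoord q₁ q (localField q₁ y q) = y (chartAt (Model n) q₁ q) :=
  dcoord_dcoordSymm hq _

lemma vfDiffAt_iff {Y : Π q : SpaceForm κ n c, Tan q} : VFDiffAt Y q ↔
    MDifferentiableAt 𝓘(ℝ, Model n) 𝓘(ℝ, Model n) (fun p => dcoord q₁ p (Y p)) q := by
  have h := (trivializationAt (Model n) (TangentSpace 𝓘(ℝ, Model n)) q₁).mdifferentiableAt_section_iff
    𝓘(ℝ, Model n) Y (mem_baseSet hq)
  refine Iff.trans h (Filter.EventuallyEq.mdifferentiableAt_iff ?_)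
  filter_upwards [(chartAt (Model n) q₁).open_source.mem_nhds hq] with p hp
  exact (Bundle.Trivialization.continuousLinearMapAt_apply_of_mem ℝ _ (mem_baseSet hp) _).symm

lemma differentiableAt_coordField {Y : Π q : SpaceForm κ n c, Tan q} (hY : VFDiffAt Y q) :
    DifferentiableAt ℝ (coordField q₁ Y) (chartAt (Model n) q₁ q) := by
  have hw := (chartAt (Model n) q₁).map_source hq
  have h1 := (vfDiffAt_iff hq).mp hY
  rw [← mdifferentiableAt_iff_differentiableAt]
  have h2 : MDifferentiableAt 𝓘(ℝ, Model n) 𝓘(ℝ, Model n) (chartAt (Model n) q₁).symm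
    (chartAt (Model n) q₁ q) := mdifferentiableAt_atlas_symm (chart_mem_atlas _ q₁) hw
  exact MDifferentiableAt.comp_of_eq _ h1 h2 ((chartAt (Model n) q₁).left_inv hq)

lemma vfDiffAt_localField {y : Model n → Model n}
    (hy : DifferentiableAt ℝ y (chartAt (Model n) q₁ q)) : VFDiffAt (localField q₁ y) q := by
  rw [vfDiffAt_iff hq]
  have h1 : MDifferentiableAt 𝓘(ℝ, Model n) 𝓘(ℝ, Model n) (y ∘ chartAt (Model n) q₁) q :=
    MDifferentiableAt.comp _ hy.mdifferentiableAt (mdifferentiableAt_chartAt hq)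
  refine h1.congr_of_eventuallyEq ?_
  filter_upwards [(chartAt (Model n) q₁).open_source.mem_nhds hq] with p hp
  exact dcoord_localField hp y

lemma mfderiv_chartAt_symm_inverse :
    (mfderiv 𝓘(ℝ, Model n) 𝓘(ℝ, Model n) (chartAt (Model n) q₁).symm
      (chartAt (Model n) q₁ q)).inverse = dcoord q₁ ((chartAt (Model n) q₁).symm (chartAt (Model n) q₁ q)) := by
  have hw := (chartAt (Model n) q₁).map_source hq
  have hp := (chartAt (Model n) q₁).map_target hw
  have h1 := (mdifferentiable_chart (I := 𝓘(ℝ, Model n)) q₁).comp_symm_deriv hw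
  rw [← dcoord_eq_mfderiv hp] at h1
  refine ContinuousLinearMap.inverse_eq ?_ h1
  ext1 u
  apply dcoord_injective hp
  exact congrArg (fun l : Model n →L[ℝ] Model n => l (dcoord q₁ _ u)) h1

lemma dcoord_mlieBracket {X Y : Π q : SpaceForm κ n c, Tan q} (hX : VFDiffAt X q)
    (hY : VFDiffAt Y q) : dcoord q₁ q (VectorField.mlieBracket 𝓘(ℝ, Model n) X Y q) =
      fderiv ℝ (coordField q₁ Y) (chartAt (Model n) q₁ q) (dcoord q₁ q (X q)) -
      fderiv ℝ (coordField q₁ X) (chartAt (Model n) q₁ q) (dcoord q₁ q (Y q)) := by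
  have hw := (chartAt (Model n) q₁).map_source hq
  have hl := (chartAt (Model n) q₁).left_inv hq
  have hpull : ∀ V : Π q : SpaceForm κ n c, Tan q,
      ∀ w ∈ (chartAt (Model n) q₁).target, VectorField.mpullback 𝓘(ℝ, Model n) 𝓘(ℝ, Model n)
        (chartAt (Model n) q₁).symm V w = coordField q₁ V w := by
    intro V w hw
    have h1 := mfderiv_chartAt_symm_inverse ((chartAt (Model n) q₁).map_target hw)
    rw [(chartAt (Model n) q₁).right_inv hw] at h1
    rw [VectorField.mpullback_apply, h1]
    rfl
  have hev : ∀ V : Π q : SpaceForm κ n c, Tan q, VectorField.mpullback 𝓘(ℝ, Model n)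
      𝓘(ℝ, Model n) (chartAt (Model n) q₁).symm V =ᶠ[𝓝 (chartAt (Model n) q₁ q)] coordField q₁ V :=
    fun V => by
      filter_upwards [(chartAt (Model n) q₁).open_target.mem_nhds hw] with w hw using hpull V w hw
  have h2 : ContMDiffAt 𝓘(ℝ, Model n) 𝓘(ℝ, Model n) ∞ (chartAt (Model n) q₁).symm
    (chartAt (Model n) q₁ q) := (contMDiffOn_chart_symm (x := q₁)).contMDiffAt
      ((chartAt (Model n) q₁).open_target.mem_nhds hw)
  have h4 : (2 : ℕ∞ω) ≤ ∞ := by norm_cast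
  have : IsManifold 𝓘(ℝ, Model n) (minSmoothness ℝ 2) (SpaceForm κ n c) := by
    rw [minSmoothness_of_isRCLikeNormedField]
    exact IsManifold.of_le h4
  have h3 := VectorField.mpullback_mlieBracket (V := X) (W := Y) (by rw [hl]; exact hX)
    (by rw [hl]; exact hY) h2 (by rw [minSmoothness_of_isRCLikeNormedField]; exact h4)
  have h5 : ∀ V W : Π w : Model n, TangentSpace 𝓘(ℝ, Model n) w,
      VectorField.mlieBracket 𝓘(ℝ, Model n) V W = VectorField.lieBracket ℝ V W := fun V W => by
    rw [← VectorField.mlieBracketWithin_univ, VectorField.mlieBracketWithin_eq_lieBracketWithin]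
    exact VectorField.lieBracketWithin_univ
  have h6 := (congrFun (h5 _ _) (chartAt (Model n) q₁ q)).trans
    ((hev X).lieBracket_vectorField_eq (hev Y))
  rw [hpull _ _ hw, coordField_chartAt hq] at h3
  refine (h3.trans h6).trans ?_
  rw [VectorField.lieBracket_eq]
  simp only [coordField_chartAt hq]
  rfl

lemma mvfderiv_metric {Y Z : Π q : SpaceForm κ n c, Tan q} (hY : VFDiffAt Y q) (hZ : VFDiffAt Z q)
    (u : Tan q) : mvfderiv 𝓘(ℝ, Model n) (fun p => metric p (Y p) (Z p)) q u =
      fderiv ℝ (fun w => formL κ n (lift κ c (sec q₁) w (coordField q₁ Y w))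
        (lift κ c (sec q₁) w (coordField q₁ Z w))) (chartAt (Model n) q₁ q) (dcoord q₁ q u) := by
  have hw := (chartAt (Model n) q₁).map_source hq
  have hs := isSection_sec q₁
  have hd1 := hs.differentiableAt_lift_apply hw (differentiableAt_coordField hq hY)
  have hd2 := hs.differentiableAt_lift_apply hw (differentiableAt_coordField hq hZ)
  have hd : DifferentiableAt ℝ (fun w => formL κ n (lift κ c (sec q₁) w (coordField q₁ Y w))
      (lift κ c (sec q₁) w (coordField q₁ Z w))) (chartAt (Model n) q₁ q) :=
    ((formL κ n).differentiableAt.comp _ hd1).clm_apply hd2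
  have h1 : (fun p => metric p (Y p) (Z p)) =ᶠ[𝓝 q] (fun w => formL κ n
      (lift κ c (sec q₁) w (coordField q₁ Y w)) (lift κ c (sec q₁) w (coordField q₁ Z w))) ∘
      chartAt (Model n) q₁ := by
    filter_upwards [(chartAt (Model n) q₁).open_source.mem_nhds hq] with p hp
    rw [metric_eq hp, Function.comp_apply, coordField_chartAt hp, coordField_chartAt hp]
  have h2 := h1.mfderiv_eq (I := 𝓘(ℝ, Model n)) (I' := 𝓘(ℝ, ℝ))
  rw [mfderiv_comp (I' := 𝓘(ℝ, Model n)) q hd.mdifferentiableAt (mdifferentiableAt_chartAt hq),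
    ← dcoord_eq_mfderiv hq] at h2
  rw [← mfderiv_eq_fderiv]
  exact congrArg (fun l : Model n →L[ℝ] ℝ => l u) h2

/-- The Levi-Civita connection is the projection of the flat connection: both connections are
torsion-free and metric, so their difference `E` has `⟨E(Y, X), Z⟩` symmetric in `X`, `Y` and
skew-symmetric in `Y`, `Z`, hence vanishes. -/
lemma dcoord_cov {cov : Connection κ n c} (hcov : IsLeviCivita cov)
    {Y : Π q : SpaceForm κ n c, Tan q} (hY : VFDiffAt Y q) (u : Tan q) :
    dcoord q₁ q (cov Y q u) = localConn κ c (coordAt q₁) (sec q₁) (coordField q₁ Y)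
      (chartAt (Model n) q₁ q) (dcoord q₁ q u) := by
  obtain ⟨htor, hmet⟩ := hcov
  rw [CovariantDerivative.torsion_eq_zero_iff] at htor
  have hB := isPseudoHermitian_formL κ n
  have hs := isSection_sec q₁
  have hw := (chartAt (Model n) q₁).map_source hq
  let E : (Π q : SpaceForm κ n c, Tan q) → Tan q → Model n := fun Y u =>
    dcoord q₁ q (cov Y q u) - localConn κ c (coordAt q₁) (sec q₁) (coordField q₁ Y)
      (chartAt (Model n) q₁ q) (dcoord q₁ q u)
  let b : (Π q : SpaceForm κ n c, Tan q) → (Π q : SpaceForm κ n c, Tan q) →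
      (Π q : SpaceForm κ n c, Tan q) → ℝ := fun X Y Z =>
    formL κ n (lift κ c (sec q₁) (chartAt (Model n) q₁ q) (E Y (X q)))
      (lift κ c (sec q₁) (chartAt (Model n) q₁ q) (dcoord q₁ q (Z q)))
  have hsymm : ∀ X Y Z, VFDiffAt X q → VFDiffAt Y q → b X Y Z = b Y X Z := by
    intro X Y Z hX hY
    have h1 := congrArg (dcoord q₁ q) (htor hX hY)
    rw [dcoord_mlieBracket hq hX hY, map_sub] at h1
    have h2 := hs.localConn_sub hw (differentiableAt_coordField hq hX)
      (differentiableAt_coordField hq hY)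
    rw [coordField_chartAt hq, coordField_chartAt hq, ← h1] at h2
    have h3 : E Y (X q) = E X (Y q) := by
      simp only [E]
      rw [sub_eq_sub_iff_sub_eq_sub, h2]
    simp only [b, h3]
  have hskew : ∀ X Y Z, VFDiffAt Y q → VFDiffAt Z q → b X Y Z = -b X Z Y := by
    intro X Y Z hY hZ
    have h1 := hmet q Y Z hY hZ (X q)
    rw [mvfderiv_metric hq hY hZ, hs.formL_lift_localConn hw (differentiableAt_coordField hq hY)
      (differentiableAt_coordField hq hZ), coordField_chartAt hq, coordField_chartAt hq,
      metric_eq hq, metric_eq hq] at h1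
    simp only [b, E, map_sub, sub_apply]
    rw [hB.symm _ (lift κ c (sec q₁) _ (dcoord q₁ q (cov Z q (X q)))),
      hB.symm _ (lift κ c (sec q₁) _ (localConn κ c (coordAt q₁) (sec q₁) (coordField q₁ Z) _ _))] at h1
    linarith
  have hb : ∀ X Y Z, VFDiffAt X q → VFDiffAt Y q → VFDiffAt Z q → b X Y Z = 0 := by
    intro X Y Z hX hY hZ
    have h1 := hsymm X Y Z hX hY
    have h2 := hskew Y X Z hX hZ
    have h3 := hsymm Y Z X hY hZ
    have h4 := hskew Z Y X hY hX
    have h5 := hsymm Z X Y hZ hX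
    have h6 := hskew X Z Y hZ hY
    linarith
  have hconst : ∀ y : Model n, VFDiffAt (localField q₁ fun _ => y) q := fun y =>
    vfDiffAt_localField hq (differentiableAt_const y)
  rw [← sub_eq_zero]
  refine hs.eq_zero_of_formL_lift hw fun y' => ?_
  have h := hb (localField q₁ fun _ => dcoord q₁ q u) Y (localField q₁ fun _ => y')
    (hconst _) hY (hconst _)
  simp only [b, E, dcoord_localField hq] at h
  rw [show localField q₁ (fun _ => dcoord q₁ q u) q = u from dcoordSymm_dcoord hq u] at h
  exact h

end chart

end SpaceForms

end

noncomputable section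

/-! ### Lifts of hypersurfaces in charts -/

namespace SpaceForms
open Module

/-- A map with injective differential at `x` has, near `x`, a left inverse that is differentiable
at the image of `x`. -/
lemma exists_leftInverse_of_injective_fderiv {E M : Type*} [NormedAddCommGroup E] [NormedSpace ℝ E]
    [FiniteDimensional ℝ E] [NormedAddCommGroup M] [NormedSpace ℝ M] [FiniteDimensional ℝ M]
    {G : E → M} {x : E} (hG : ContDiffAt ℝ 1 G x) (hinj : Function.Injective (fderiv ℝ G x)) :
    ∃ r : M → E, DifferentiableAt ℝ r (G x) ∧ ∀ᶠ y in 𝓝 x, r (G y) = y := by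
  obtain ⟨l, hl⟩ := LinearMap.exists_leftInverse_of_injective (fderiv ℝ G x).toLinearMap
    (LinearMap.ker_eq_bot.mpr hinj)
  have hG' : HasStrictFDerivAt G (fderiv ℝ G x) x :=
    hG.hasStrictFDerivAt (by norm_num)
  have h1 : HasStrictFDerivAt (fun y => l.toContinuousLinearMap (G y))
      ((ContinuousLinearEquiv.refl ℝ E : E ≃L[ℝ] E) : E →L[ℝ] E) x := by
    have h2 := l.toContinuousLinearMap.hasStrictFDerivAt.comp x hG'
    have h3 : l.toContinuousLinearMap.comp (fderiv ℝ G x) =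
        ((ContinuousLinearEquiv.refl ℝ E : E ≃L[ℝ] E) : E →L[ℝ] E) := by
      ext1 u
      exact congrArg (fun f => f u) hl
    rwa [h3] at h2
  refine ⟨fun w => h1.localInverse _ _ _ (l.toContinuousLinearMap w), ?_, ?_⟩
  · exact h1.to_localInverse.differentiableAt.comp (G x) l.toContinuousLinearMap.differentiableAt
  · exact h1.eventually_left_inverse

/-- The model space of the hypersurfaces. -/
abbrev Param (n : ℕ) := EuclideanSpace ℝ (Fin (2 * n - 1))

variable {κ : Kind} {n : ℕ} {c : ℝ} [NeZero c]
variable {S : Type*} [TopologicalSpace S] [ChartedSpace (EuclideanSpace ℝ (Fin (2 * n - 1))) S]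

/-- The expression in charts of the map `F`. -/
def localMap (F : S → SpaceForm κ n c) (x₁ : S) (e : Param n) : Model n :=
  chartAt (Model n) (F x₁) (F ((chartAt (Param n) x₁).symm e))

/-- The domain of `localMap F x₁`. -/
def localDom (F : S → SpaceForm κ n c) (x₁ : S) : Set (Param n) :=
  (chartAt (Param n) x₁).target ∩
    (chartAt (Param n) x₁).symm ⁻¹'
      (F ⁻¹' (chartAt (Model n) (F x₁)).source)

/-- The normal field `N` in the coordinates of charts. -/
def localNormal (F : S → SpaceForm κ n c) (x₁ : S) (N : Π x : S, Tan (F x))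
    (e : Param n) : Model n :=
  dcoord (F x₁) (F ((chartAt (Param n) x₁).symm e))
    (N ((chartAt (Param n) x₁).symm e))

/-- The lift of the hypersurface to the hyperquadric. -/
def hypersurfaceLift (F : S → SpaceForm κ n c) (x₁ : S)
    (e : Param n) : Vec n := sec (F x₁) (localMap F x₁ e)

/-- The horizontal lift of the normal field. -/
def normalLift (F : S → SpaceForm κ n c) (x₁ : S) (N : Π x : S, Tan (F x))
    (e : Param n) : Vec n :=
  lift κ c (sec (F x₁)) (localMap F x₁ e) (localNormal F x₁ N e)

/-- The differential of the inverse of the chart at `x₁`. -/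
def chartSymmDeriv (x₁ : S) (e : Param n) :
    Param n →L[ℝ] TangentSpace (𝓡 (2 * n - 1))
      ((chartAt (Param n) x₁).symm e) :=
  mfderiv (𝓡 (2 * n - 1)) (𝓡 (2 * n - 1)) (chartAt (Param n) x₁).symm e

lemma isOpen_localDom {F : S → SpaceForm κ n c} (hF : IsNondegenerateHypersurface F) (x₁ : S) :
    IsOpen (localDom F x₁) :=
  (chartAt (Param n) x₁).isOpen_inter_preimage_symm
    ((chartAt (Model n) (F x₁)).open_source.preimage hF.smooth.continuous)

lemma chartAt_mem_localDom (F : S → SpaceForm κ n c) (x₁ : S) :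
    chartAt (Param n) x₁ x₁ ∈ localDom F x₁ := by
  refine ⟨mem_chart_target (Param n) x₁, ?_⟩
  rw [Set.mem_preimage, Set.mem_preimage, (chartAt (Param n) x₁).left_inv (mem_chart_source (Param n) x₁)]
  exact mem_chart_source _ _

section lifts

variable [IsManifold (𝓡 (2 * n - 1)) ∞ S] {F : S → SpaceForm κ n c}
  (hF : IsNondegenerateHypersurface F) {x₁ : S} {e : Param n}

include hF

lemma contDiffOn_localMap : ContDiffOn ℝ ∞ (localMap F x₁) (localDom F x₁) := by
  rw [← contMDiffOn_iff_contDiffOn]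
  have h1 : ContMDiffOn (𝓡 (2 * n - 1)) (𝓡 (2 * n - 1)) ∞
    (chartAt (Param n) x₁).symm (localDom F x₁) :=
    contMDiffOn_chart_symm.mono fun e he => he.1
  have h2 : ContMDiffOn 𝓘(ℝ, Model n) 𝓘(ℝ, Model n) ∞ (chartAt (Model n) (F x₁))
    (chartAt (Model n) (F x₁)).source := contMDiffOn_chart
  exact h2.comp (hF.smooth.comp_contMDiffOn h1) fun e he => he.2

variable (he : e ∈ localDom F x₁)

include he

lemma contDiffAt_localMap : ContDiffAt ℝ ∞ (localMap F x₁) e :=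
  (contDiffOn_localMap hF).contDiffAt ((isOpen_localDom hF x₁).mem_nhds he)

lemma differentiableAt_localMap : DifferentiableAt ℝ (localMap F x₁) e :=
  (contDiffAt_localMap hF he).differentiableAt (by simp)

omit [IsManifold (𝓡 (2 * n - 1)) ∞ S] hF in
lemma localMap_mem : localMap F x₁ e ∈ (chartAt (Model n) (F x₁)).target :=
  (chartAt (Model n) (F x₁)).map_source he.2

lemma fderiv_localMap (u : Param n) : fderiv ℝ (localMap F x₁) e u =
    dcoord (F x₁) _ (dmap F ((chartAt (Param n) x₁).symm e)
      (chartSymmDeriv x₁ e u)) := by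
  have h1 : MDifferentiableAt (𝓡 (2 * n - 1)) (𝓡 (2 * n - 1))
    (chartAt (Param n) x₁).symm e :=
    mdifferentiableAt_atlas_symm (chart_mem_atlas _ x₁) he.1
  have h2 : MDifferentiableAt (𝓡 (2 * n - 1)) 𝓘(ℝ, Model n) F
    ((chartAt (Param n) x₁).symm e) :=
    hF.smooth.mdifferentiableAt (by simp)
  have h3 := mdifferentiableAt_chartAt he.2
  have h4 := (HasMFDerivAt.comp e h3.hasMFDerivAt
    (HasMFDerivAt.comp e h2.hasMFDerivAt h1.hasMFDerivAt)).mfderiv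
  rw [← dcoord_eq_mfderiv he.2] at h4
  have h5 : mfderiv (𝓡 (2 * n - 1)) 𝓘(ℝ, Model n) (localMap F x₁) e = fderiv ℝ (localMap F x₁) e :=
    mfderiv_eq_fderiv
  exact congrArg (fun l : Param n →L[ℝ] Model n => l u) (h5.symm.trans h4)

omit hF in
lemma chartSymmDeriv_bijective : Function.Bijective (chartSymmDeriv (n := n) x₁ e) := by
  have h := (mdifferentiable_chart (I := 𝓡 (2 * n - 1)) x₁).symm.mfderiv_bijective he.1
  exact h

lemma fderiv_localMap_injective : Function.Injective (fderiv ℝ (localMap F x₁) e) := by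
  have h : (fderiv ℝ (localMap F x₁) e : _ → Model n) = dcoord (F x₁) _ ∘
      dmap F ((chartAt (Param n) x₁).symm e) ∘ chartSymmDeriv x₁ e :=
    funext fun u => fderiv_localMap hF he u
  rw [h]
  exact (dcoord_injective he.2).comp ((hF.immersion _).comp (chartSymmDeriv_bijective he).1)

lemma contDiffAt_hypersurfaceLift : ContDiffAt ℝ ∞ (hypersurfaceLift F x₁) e :=
  ((isSection_sec (F x₁)).contDiffAt (localMap_mem he)).comp e (contDiffAt_localMap hF he)

lemma fderiv_hypersurfaceLift (u : Param n) :
    fderiv ℝ (hypersurfaceLift F x₁) e u =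
      fderiv ℝ (sec (F x₁)) (localMap F x₁ e) (fderiv ℝ (localMap F x₁) e u) := by
  have h := ((isSection_sec (F x₁)).differentiableAt (localMap_mem he)).hasFDerivAt.comp e
    (differentiableAt_localMap hF he).hasFDerivAt
  change fderiv ℝ (sec (F x₁) ∘ localMap F x₁) e u = _
  rw [h.fderiv]
  rfl

lemma horProj_fderiv_hypersurfaceLift (u : Param n) :
    horProj κ n c (hypersurfaceLift F x₁ e) (fderiv ℝ (hypersurfaceLift F x₁) e u) =
      lift κ c (sec (F x₁)) (localMap F x₁ e) (fderiv ℝ (localMap F x₁) e u) := by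
  rw [fderiv_hypersurfaceLift hF he]
  rfl

omit [IsManifold (𝓡 (2 * n - 1)) ∞ S] hF in
lemma metric_eq_lift (u v : Tan (F ((chartAt (Param n) x₁).symm e))) :
    metric _ u v = formL κ n (lift κ c (sec (F x₁)) (localMap F x₁ e) (dcoord (F x₁) _ u))
      (lift κ c (sec (F x₁)) (localMap F x₁ e) (dcoord (F x₁) _ v)) :=
  metric_eq he.2 u v

variable {U : Set S} {N : Π x : S, Tan (F x)} (hN : IsUnitNormalOn F U N)

include hN

omit hF he in
lemma contDiffOn_localNormal : ContDiffOn ℝ ∞ (localNormal F x₁ N)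
    (localDom F x₁ ∩ (chartAt (Param n) x₁).symm ⁻¹' U) := by
  rw [← contMDiffOn_iff_contDiffOn]
  have h1 : ContMDiffOn (𝓡 (2 * n - 1)) (𝓡 (2 * n - 1)) ∞
    (chartAt (Param n) x₁).symm
    (localDom F x₁ ∩ (chartAt (Param n) x₁).symm ⁻¹' U) :=
    contMDiffOn_chart_symm.mono fun e he => he.1.1
  have h2 : Set.MapsTo (fun x => (⟨F x, N x⟩ : TangentBundle 𝓘(ℝ, Model n) (SpaceForm κ n c)))
      (U ∩ F ⁻¹' (chartAt (Model n) (F x₁)).source)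
      (trivializationAt (Model n) (TangentSpace 𝓘(ℝ, Model n)) (F x₁)).source := fun x hx =>
    (Bundle.Trivialization.mem_source _).mpr (mem_baseSet hx.2)
  have h3 := ((trivializationAt (Model n) (TangentSpace 𝓘(ℝ, Model n)) (F x₁)).contMDiffOn_iff h2).mp
    (hN.smooth.mono Set.inter_subset_left)
  refine (h3.2.comp h1 fun e he => ⟨he.2, he.1.2⟩).congr fun e he => ?_
  exact Bundle.Trivialization.continuousLinearMapAt_apply_of_mem ℝ _ (mem_baseSet he.1.2) _

omit he in
lemma contDiffOn_normalLift : ContDiffOn ℝ ∞ (normalLift F x₁ N)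
    (localDom F x₁ ∩ (chartAt (Param n) x₁).symm ⁻¹' U) := by
  refine ContDiffOn.clm_apply (f := fun e => lift κ c (sec (F x₁)) (localMap F x₁ e))
    (fun e he => ?_) (contDiffOn_localNormal hN)
  exact (((isSection_sec (F x₁)).contDiffAt_lift (localMap_mem he.1)).comp e
    (contDiffAt_localMap hF he.1)).contDiffWithinAt

end lifts

end SpaceForms

end

noncomputable section

/-! ### The Hopf condition for lifts -/

namespace SpaceForms
open Module

/-- The Hopf condition `∇_ξ N = -a ξ`, written as an identity of 1-forms. -/
lemma hopf_identity {V E : Type*} [NormedAddCommGroup V] [NormedSpace ℝ V] [NormedAddCommGroup E]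
    [NormedSpace ℝ E] {B : V →L[ℝ] V →L[ℝ] ℝ} {J : V →L[ℝ] V} {ε c σ : ℝ}
    (hB : IsPseudoHermitian B J ε) {z ν : V} {z' ν' : E →L[ℝ] V} {ξ : E} {a t α β : ℝ}
    (hzz : c * B z z = ε) (hzν : B z ν = 0) (hJzν : B (J z) ν = 0) (hνν : B ν ν = σ)
    (hz'z : ∀ u, B z (z' u) = 0)
    (hsymm : ∀ u v, B (ν' u) (z' v) = B (ν' v) (z' u)) (hν'Jz : ∀ u, B (ν' u) (J z) = B (J ν) (z' u))
    (hξ : z' ξ = -(ε • J ν) + t • J z)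
    (hνξ : ν' ξ = (a * ε + t) • J ν + (α • z + β • J z)) (u : E) :
    B (ν' u) (J ν) - ε * σ * (c * B (z' u) (J z)) = -(a * B (z' u) (J ν)) := by
  have hε := hB.eps
  have hJzJν : B (J z) (J ν) = 0 := by rw [hB.J_J, hzν, mul_zero]
  have hJνJz : B (J ν) (J z) = 0 := by rw [hB.symm, hJzJν]
  have hzJν : B z (J ν) = 0 := by have := hB.skew z ν; rw [hJzν] at this; linarith
  have hJνz : B (J ν) z = 0 := by rw [hB.symm, hzJν]
  have hJzJz : c * B (J z) (J z) = 1 := by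
    rw [hB.J_J]; linear_combination ε * hzz + hε
  have hβ : β = -(c * ε * ε * σ) := by
    have h1 := hν'Jz ξ
    rw [hνξ, hξ] at h1
    simp only [map_add, map_smul, map_neg, add_apply, smul_apply,
      smul_eq_mul, hJνJz, hB.J_self, hB.J_J ν ν, hνν] at h1
    linear_combination c * h1 - β * hJzJz
  have h1 := hsymm u ξ
  rw [hνξ, hξ] at h1
  simp only [map_add, map_smul, map_neg, add_apply, smul_apply, smul_eq_mul, hν'Jz, hz'z] at h1
  rw [hB.symm (z' u) (J z), hB.symm (z' u) (J ν)]
  rw [hβ] at h1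
  linear_combination (-ε) * h1 - (B (ν' u) (J ν) + a * B (J ν) (z' u) -
    ε * σ * c * B (J z) (z' u)) * hε

section lifts

variable {κ : Kind} {n : ℕ} {c : ℝ} [NeZero c]
variable {S : Type*} [TopologicalSpace S] [ChartedSpace (EuclideanSpace ℝ (Fin (2 * n - 1))) S]
variable [IsManifold (𝓡 (2 * n - 1)) ∞ S] {F : S → SpaceForm κ n c}
  (hF : IsNondegenerateHypersurface F) {x₁ : S} {e : Param n} (he : e ∈ localDom F x₁)
  {U : Set S} {N : Π x : S, Tan (F x)} (hN : IsUnitNormalOn F U N)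
  (heU : (chartAt (Param n) x₁).symm e ∈ U)

include hF he

omit [IsManifold (𝓡 (2 * n - 1)) ∞ S] hF in
lemma formL_self_hypersurfaceLift :
    formL κ n (hypersurfaceLift F x₁ e) (hypersurfaceLift F x₁ e) = κ.eps / c :=
  (isSection_sec (F x₁)).formL_self (localMap_mem he)

lemma formL_fderiv_hypersurfaceLift (u : Param n) :
    formL κ n (hypersurfaceLift F x₁ e) (fderiv ℝ (hypersurfaceLift F x₁) e u) = 0 := by
  rw [fderiv_hypersurfaceLift hF he]
  exact (isSection_sec (F x₁)).formL_fderiv (localMap_mem he) _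

omit [IsManifold (𝓡 (2 * n - 1)) ∞ S] hF in
lemma formL_normalLift : formL κ n (hypersurfaceLift F x₁ e) (normalLift F x₁ N e) = 0 :=
  (isSection_sec (F x₁)).formL_lift (localMap_mem he) _

omit [IsManifold (𝓡 (2 * n - 1)) ∞ S] hF in
lemma formL_vecJ_normalLift :
    formL κ n (vecJL κ n (hypersurfaceLift F x₁ e)) (normalLift F x₁ N e) = 0 :=
  (isSection_sec (F x₁)).formL_vecJ_lift (localMap_mem he) _

lemma formL_fderiv_lift (u : Param n) (y : Model n) :
    formL κ n (fderiv ℝ (hypersurfaceLift F x₁) e u) (lift κ c (sec (F x₁)) (localMap F x₁ e) y) =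
      formL κ n (lift κ c (sec (F x₁)) (localMap F x₁ e) (fderiv ℝ (localMap F x₁) e u))
        (lift κ c (sec (F x₁)) (localMap F x₁ e) y) := by
  rw [← horProj_fderiv_hypersurfaceLift hF he]
  exact ((isSection_sec (F x₁)).formL_horProj_lift (localMap_mem he) _ _).symm

include hN heU

lemma formL_fderiv_normalLift (u : Param n) :
    formL κ n (fderiv ℝ (hypersurfaceLift F x₁) e u) (normalLift F x₁ N e) = 0 := by
  rw [normalLift, formL_fderiv_lift hF he, fderiv_localMap hF he, localNormal, ← metric_eq_lift he]
  exact hN.normal _ heU _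

omit [IsManifold (𝓡 (2 * n - 1)) ∞ S] hF in
lemma formL_self_normalLift : formL κ n (normalLift F x₁ N e) (normalLift F x₁ N e) = 1 ∨
    formL κ n (normalLift F x₁ N e) (normalLift F x₁ N e) = -1 := by
  rw [normalLift, localNormal, ← metric_eq_lift he]
  exact hN.unit _ heU

omit [IsManifold (𝓡 (2 * n - 1)) ∞ S] he heU in
lemma isOpen_localDom_inter : IsOpen (localDom F x₁ ∩ (chartAt (Param n) x₁).symm ⁻¹' U) := by
  have h := (chartAt (Param n) x₁).isOpen_inter_preimage_symm
    (((chartAt (Model n) (F x₁)).open_source.preimage hF.smooth.continuous).inter hN.isOpen)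
  rwa [Set.preimage_inter, ← Set.inter_assoc] at h

omit [IsManifold (𝓡 (2 * n - 1)) ∞ S] in
lemma mem_nhds_localDom_inter : localDom F x₁ ∩ (chartAt (Param n) x₁).symm ⁻¹' U ∈ 𝓝 e :=
  (isOpen_localDom_inter hF hN).mem_nhds ⟨he, heU⟩

lemma contDiffAt_normalLift : ContDiffAt ℝ ∞ (normalLift F x₁ N) e :=
  (contDiffOn_normalLift hF hN).contDiffAt (mem_nhds_localDom_inter hF he hN heU)

/-- A normal field along the hypersurface extends locally to a vector field of the ambient space that
is differentiable at the point: compose its coordinates with a left inverse of the immersion. -/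
lemma exists_extension : ∃ N' : Π q : SpaceForm κ n c, Tan q,
    VFDiffAt N' (F ((chartAt (Param n) x₁).symm e)) ∧
    ∀ᶠ y in 𝓝 ((chartAt (Param n) x₁).symm e), N' (F y) = N y := by
  obtain ⟨r, hr, hrG⟩ := exists_leftInverse_of_injective_fderiv
    ((contDiffAt_localMap hF he).of_le (by norm_cast)) (fderiv_localMap_injective hF he)
  have hre : r (localMap F x₁ e) = e := hrG.self_of_nhds
  have hn : DifferentiableAt ℝ (localNormal F x₁ N) e :=
    ((contDiffOn_localNormal hN).contDiffAt
      (mem_nhds_localDom_inter hF he hN heU)).differentiableAt (by simp)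
  have hn' : DifferentiableAt ℝ (fun w => localNormal F x₁ N (r w)) (localMap F x₁ e) := by
    rw [← hre] at hn
    exact DifferentiableAt.comp (localMap F x₁ e) hn hr
  refine ⟨localField (F x₁) fun w => localNormal F x₁ N (r w), vfDiffAt_localField he.2 hn', ?_⟩
  have hc : Filter.Tendsto (chartAt (Param n) x₁) (𝓝 ((chartAt (Param n) x₁).symm e)) (𝓝 e) := by
    have := (chartAt (Param n) x₁).continuousAt ((chartAt (Param n) x₁).map_target he.1)
    rwa [ContinuousAt, (chartAt (Param n) x₁).right_inv he.1] at this
  filter_upwards [hc.eventually hrG, (chartAt (Param n) x₁).open_source.mem_nhds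
    ((chartAt (Param n) x₁).map_target he.1), (((chartAt (Model n) (F x₁)).open_source.preimage
      hF.smooth.continuous).mem_nhds he.2)] with y h1 h2 h3
  have h4 := (chartAt (Param n) x₁).left_inv h2
  have h5 : chartAt (Model n) (F x₁) (F y) = localMap F x₁ (chartAt (Param n) x₁ y) := by
    rw [localMap, h4]
  rw [localField, h5, h1, localNormal, h4]
  exact dcoordSymm_dcoord h3 _

omit hN heU in
/-- The covariant derivative of the unit normal field in terms of lifts. -/
lemma dcoord_cov_normal {cov : Connection κ n c} (hcov : IsLeviCivita cov)
    {N' : Π q : SpaceForm κ n c, Tan q} (hN' : VFDiffAt N' (F ((chartAt (Param n) x₁).symm e)))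
    (hNN' : ∀ᶠ y in 𝓝 ((chartAt (Param n) x₁).symm e), N' (F y) = N y) (u : Param n) :
    dcoord (F x₁) _ (cov N' _ (dmap F _ (chartSymmDeriv x₁ e u))) =
      fderiv ℝ (affine κ (coordAt (F x₁))) (hypersurfaceLift F x₁ e)
        (fderiv ℝ (normalLift F x₁ N) e u - (c * formL κ n (fderiv ℝ (hypersurfaceLift F x₁) e u)
          (vecJL κ n (hypersurfaceLift F x₁ e))) • vecJL κ n (normalLift F x₁ N e)) := by
  have hs := isSection_sec (F x₁)
  have hw := localMap_mem he
  have hc : ContinuousAt (chartAt (Param n) x₁).symm e :=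
    (chartAt (Param n) x₁).continuousAt_symm he.1
  have h1 : (fun w => lift κ c (sec (F x₁)) w (coordField (F x₁) N' w)) ∘ localMap F x₁ =ᶠ[𝓝 e]
      normalLift F x₁ N := by
    filter_upwards [hc.eventually hNN', (isOpen_localDom hF x₁).mem_nhds he] with e' h1 h2
    change lift κ c (sec (F x₁)) (localMap F x₁ e') (coordField (F x₁) N' (localMap F x₁ e')) = _
    rw [normalLift, localNormal, ← h1]
    exact congrArg _ (coordField_chartAt h2.2 N')
  have hd := hs.differentiableAt_lift_apply hw (differentiableAt_coordField he.2 hN')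
  have h2 := (hd.hasFDerivAt.comp e (differentiableAt_localMap hF he).hasFDerivAt).fderiv
  rw [h1.fderiv_eq] at h2
  rw [dcoord_cov he.2 hcov hN', ← fderiv_localMap hF he, localConn, h2, fderiv_hypersurfaceLift hF he,
    coordField_chartAt he.2, hNN'.self_of_nhds]
  rfl

/-- Symmetry of the second fundamental form of the lift. -/
lemma fderiv_normalLift_symm (u v : Param n) :
    formL κ n (fderiv ℝ (normalLift F x₁ N) e u) (fderiv ℝ (hypersurfaceLift F x₁) e v) =
    formL κ n (fderiv ℝ (normalLift F x₁ N) e v) (fderiv ℝ (hypersurfaceLift F x₁) e u) := by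
  have hB := isPseudoHermitian_formL κ n
  have h2 : ContDiffAt ℝ 2 (hypersurfaceLift F x₁) e :=
    (contDiffAt_hypersurfaceLift hF he).of_le (by norm_cast)
  have hν := (contDiffAt_normalLift hF he hN heU).differentiableAt (by simp)
  have key : ∀ u v, formL κ n (fderiv ℝ (normalLift F x₁ N) e u) (fderiv ℝ (hypersurfaceLift F x₁) e v) =
      -formL κ n (fderiv ℝ (fderiv ℝ (hypersurfaceLift F x₁)) e u v) (normalLift F x₁ N e) := by
    intro u v
    have h3 := hasFDerivAt_fderiv_apply h2 v
    have h4 := fderiv_bilin (formL κ n) h3.differentiableAt hν u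
    have h5 : (fun y => formL κ n (fderiv ℝ (hypersurfaceLift F x₁) y v) (normalLift F x₁ N y))
        =ᶠ[𝓝 e] fun _ => 0 := by
      filter_upwards [mem_nhds_localDom_inter hF he hN heU] with e' h'
      exact formL_fderiv_normalLift hF h'.1 hN h'.2 v
    rw [h5.fderiv_eq, h3.fderiv, hB.symm _ (fderiv ℝ (normalLift F x₁ N) e u)] at h4
    simp only [fderiv_fun_const, Pi.zero_apply, zero_apply, ContinuousLinearMap.flip_apply] at h4
    linarith
  rw [key, key, fderiv_fderiv_comm h2]

lemma fderiv_normalLift_vecJ (u : Param n) :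
    formL κ n (fderiv ℝ (normalLift F x₁ N) e u) (vecJL κ n (hypersurfaceLift F x₁ e)) =
    formL κ n (vecJL κ n (normalLift F x₁ N e)) (fderiv ℝ (hypersurfaceLift F x₁) e u) := by
  have hB := isPseudoHermitian_formL κ n
  have hz := (contDiffAt_hypersurfaceLift hF he).differentiableAt (by simp)
  have hν := (contDiffAt_normalLift hF he hN heU).differentiableAt (by simp)
  have h4 := fderiv_bilin (formL κ n) (differentiableAt_clm_comp (vecJL κ n) hz) hν u
  have h5 : (fun y => formL κ n (vecJL κ n (hypersurfaceLift F x₁ y)) (normalLift F x₁ N y))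
      =ᶠ[𝓝 e] fun _ => 0 := by
    filter_upwards [mem_nhds_localDom_inter hF he hN heU] with e' h'
    exact formL_vecJ_normalLift h'.1
  rw [h5.fderiv_eq, fderiv_clm_comp_apply _ hz] at h4
  simp only [fderiv_fun_const, Pi.zero_apply, zero_apply] at h4
  rw [hB.symm, hB.skew (normalLift F x₁ N e), hB.symm (normalLift F x₁ N e)]
  linarith

/-- The Hopf condition in terms of lifts. -/
lemma hopf_of_isHopfCurvatureAt {cov : Connection κ n c} (hcov : IsLeviCivita cov) {a : ℝ}
    (ha : IsHopfCurvatureAt cov F N ((chartAt (Param n) x₁).symm e) a) {σ : ℝ}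
    (hσ : formL κ n (normalLift F x₁ N e) (normalLift F x₁ N e) = σ) (u : Param n) :
    formL κ n (fderiv ℝ (normalLift F x₁ N) e u) (vecJL κ n (normalLift F x₁ N e)) - κ.eps * σ *
      (c * formL κ n (fderiv ℝ (hypersurfaceLift F x₁) e u) (vecJL κ n (hypersurfaceLift F x₁ e))) =
    -(a * formL κ n (fderiv ℝ (hypersurfaceLift F x₁) e u) (vecJL κ n (normalLift F x₁ N e))) := by
  have hB := isPseudoHermitian_formL κ n
  have hs := isSection_sec (F x₁)
  have hw := localMap_mem he
  have hc : c ≠ 0 := NeZero.ne c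
  obtain ⟨A, ξ, hA, hξ, hAξ⟩ := ha
  obtain ⟨N', hN', hNN'⟩ := exists_extension hF he hN heU
  obtain ⟨v, rfl⟩ := (chartSymmDeriv_bijective he).2 ξ
  have hzv : horProj κ n c (hypersurfaceLift F x₁ e) (fderiv ℝ (hypersurfaceLift F x₁) e v) =
      -(κ.eps • vecJL κ n (normalLift F x₁ N e)) := by
    rw [horProj_fderiv_hypersurfaceLift hF he, fderiv_localMap hF he, hξ, map_smul, map_smul]
    have := lift_structJ he.2 (N ((chartAt (Param n) x₁).symm e))
    rw [neg_smul]
    exact congrArg (fun x => -(κ.eps • x)) this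
  -- the Weingarten formula in the direction of the structure vector, lifted to the hyperquadric
  have hcov1 := congrArg (dcoord (F x₁) _) (hA N' hN' hNN' (chartSymmDeriv x₁ e v))
  rw [dcoord_cov_normal hF he hcov hN' hNN', hAξ, map_neg, map_smul, map_smul,
    ← fderiv_localMap hF he] at hcov1
  have hcov2 := congrArg (lift κ c (sec (F x₁)) (localMap F x₁ e)) hcov1
  rw [map_neg, map_smul, ← horProj_fderiv_hypersurfaceLift hF he, hzv] at hcov2
  have hcov3 := (hs.lift_fderiv_affine hw _).symm.trans hcov2
  set t := c * formL κ n (fderiv ℝ (hypersurfaceLift F x₁) e v) (vecJL κ n (hypersurfaceLift F x₁ e))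
    with ht
  have hJν : horProj κ n c (sec (F x₁) (localMap F x₁ e)) (vecJL κ n (normalLift F x₁ N e)) =
      vecJL κ n (normalLift F x₁ N e) := by
    have h1 := hs.vecJ_lift hw (localNormal F x₁ N e)
    rw [hs.lift_fderiv_affine hw] at h1
    exact h1.symm
  rw [map_sub, map_smul, hJν, horProj_apply] at hcov3
  rw [horProj_apply, formL_fderiv_hypersurfaceLift hF he, hB.symm (vecJL κ n _), ← ht] at hzv
  refine hopf_identity hB (t := t) (ξ := v) (a := a)
    (α := κ.eps * c * formL κ n (hypersurfaceLift F x₁ e) (fderiv ℝ (normalLift F x₁ N) e v))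
    (β := c * formL κ n (vecJL κ n (hypersurfaceLift F x₁ e)) (fderiv ℝ (normalLift F x₁ N) e v))
    ?_ (formL_normalLift he) (formL_vecJ_normalLift he) hσ
    (formL_fderiv_hypersurfaceLift hF he) (fderiv_normalLift_symm hF he hN heU)
    (fderiv_normalLift_vecJ hF he hN heU) ?_ ?_ u
  · rw [formL_self_hypersurfaceLift he]; field_simp
  · rw [← hzv]; module
  · have h2 := sub_eq_iff_eq_add.mp (sub_eq_iff_eq_add.mp hcov3)
    refine h2.trans ?_
    change _ + _ + (_ • hypersurfaceLift F x₁ e + _ • vecJL κ n (hypersurfaceLift F x₁ e)) = _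
    congr 1
    module

end lifts

end SpaceForms

end

noncomputable section

/-! ### Existence and uniqueness up to sign of unit normal fields -/

namespace SpaceForms
open Module

variable {E : Type*} [NormedAddCommGroup E] [NormedSpace ℝ E] [FiniteDimensional ℝ E]
variable {V : Type*} [NormedAddCommGroup V] [NormedSpace ℝ V] [FiniteDimensional ℝ V]
variable {B : V →L[ℝ] V →L[ℝ] ℝ} {J : V →L[ℝ] V} {ε c : ℝ}

/-- The square of the Hopf principal curvature does not depend on the unit normal field: two of
them differ by a factor `γ` with `γ² = 1`, whose derivative vanishes. -/
lemma IsHopfLift.sq_eq (hB : IsPseudoHermitian B J ε) (hd : finrank ℝ V = finrank ℝ E + 3)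
    {σ₁ σ₂ : ℝ} (hσ₁ : σ₁ * σ₁ = 1) (hσ₂ : σ₂ * σ₂ = 1) {O₁ O₂ : Set E} {z ν₁ ν₂ : E → V}
    {a₁ a₂ : E → ℝ} (h₁ : IsHopfLift B J ε c σ₁ O₁ z ν₁ a₁) (h₂ : IsHopfLift B J ε c σ₂ O₂ z ν₂ a₂)
    {x : E} (hx₁ : x ∈ O₁) (hx₂ : x ∈ O₂) : a₁ x ^ 2 = a₂ x ^ 2 := by
  have key : ∀ y ∈ O₁ ∩ O₂, ν₂ y = (σ₁ * B (ν₁ y) (ν₂ y)) • ν₁ y := by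
    rintro y ⟨hy₁, hy₂⟩
    refine hB.ext fun w => ?_
    obtain ⟨u, α, β, γ, rfl⟩ := (h₁.jet hy₁ hB).exists_decomp hB hσ₁ hd w
    have e1 := h₁.normal y hy₁ u
    have e2 := h₂.normal y hy₂ u
    have e3 := h₁.zν y hy₁
    have e4 := h₂.zν y hy₂
    have e5 := h₁.Jzν y hy₁
    have e6 := h₂.Jzν y hy₂
    rw [hB.symm] at e1 e2 e3 e4 e5 e6
    simp only [map_add, map_smul, smul_apply, smul_eq_mul, e1, e2, e3, e4, e5, e6, h₁.νν y hy₁,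
      hB.symm (ν₂ y) (ν₁ y)]
    linear_combination (-γ * B (ν₁ y) (ν₂ y)) * hσ₁
  have hsq : ∀ y ∈ O₁ ∩ O₂, σ₂ = (σ₁ * B (ν₁ y) (ν₂ y)) ^ 2 * σ₁ := by
    intro y hy
    have := h₂.νν y hy.2
    rw [key y hy] at this
    simp only [map_smul, smul_apply, smul_eq_mul, h₁.νν y hy.1] at this
    linear_combination -this
  have hσ : σ₂ = σ₁ := by
    have h := hsq x ⟨hx₁, hx₂⟩
    have e0 := sq_nonneg (σ₁ * B (ν₁ x) (ν₂ x))
    rcases mul_self_eq_one_iff.mp hσ₁ with e1 | e1 <;> rcases mul_self_eq_one_iff.mp hσ₂ with e2 | e2 <;>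
      rw [e1, e2] at h ⊢ <;> rw [e1] at e0 <;> linarith
  have hσ0 : σ₁ ≠ 0 := fun h => by rw [h] at hσ₁; norm_num at hσ₁
  have hg1 : ∀ y ∈ O₁ ∩ O₂, (σ₁ * B (ν₁ y) (ν₂ y)) ^ 2 = 1 := by
    intro y hy
    have := hsq y hy
    rw [hσ] at this
    exact mul_right_cancel₀ hσ0 (by rw [← this, one_mul])
  have hO : O₁ ∩ O₂ ∈ 𝓝 x := (h₁.isOpen.inter h₂.isOpen).mem_nhds ⟨hx₁, hx₂⟩
  have hν₁ := h₁.diff_ν hx₁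
  have hν₂ := h₂.diff_ν hx₂
  set γ : E → ℝ := fun y => σ₁ * B (ν₁ y) (ν₂ y) with hγ
  have hγd : DifferentiableAt ℝ γ x :=
    ((B.differentiableAt.comp x hν₁).clm_apply hν₂).const_mul σ₁
  have hγ0 : γ x ≠ 0 := fun h => by
    have := hg1 x ⟨hx₁, hx₂⟩
    change γ x ^ 2 = 1 at this
    rw [h] at this; norm_num at this
  have hγ' : fderiv ℝ γ x = 0 := by
    have h1 : (fun y => γ y * γ y) =ᶠ[𝓝 x] fun _ => 1 := by
      filter_upwards [hO] with y hy
      rw [← sq]; exact hg1 y hy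
    have h2 := (hγd.hasFDerivAt.fun_mul hγd.hasFDerivAt).fderiv
    rw [h1.fderiv_eq, fderiv_fun_const, ← two_smul ℝ, Pi.zero_apply, eq_comm, smul_eq_zero] at h2
    simpa [hγ0] using h2
  have hν : ∀ u, fderiv ℝ ν₂ x u = γ x • fderiv ℝ ν₁ x u := by
    intro u
    have h1 : ν₂ =ᶠ[𝓝 x] fun y => γ y • ν₁ y := by
      filter_upwards [hO] with y hy using key y hy
    rw [h1.fderiv_eq, (hγd.hasFDerivAt.fun_smul hν₁.hasFDerivAt).fderiv, hγ']
    simp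
  obtain ⟨ξ, hξ⟩ := h₁.exists_contact_ne hx₁ hB hσ₁ hd
  have e1 := h₁.hopf x hx₁ ξ
  have e2 := h₂.hopf x hx₂ ξ
  have hg := hg1 x ⟨hx₁, hx₂⟩
  change γ x ^ 2 = 1 at hg
  have hk : ν₂ x = γ x • ν₁ x := key x ⟨hx₁, hx₂⟩
  rw [hν, hk, hσ] at e2
  simp only [map_smul, smul_apply, smul_eq_mul] at e2
  have e3 : (a₁ x - γ x * a₂ x) * B (fderiv ℝ z x ξ) (J (ν₁ x)) = 0 := by
    linear_combination e1 - e2 + B (fderiv ℝ ν₁ x ξ) (J (ν₁ x)) * hg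
  have e4 := (mul_eq_zero.mp e3).resolve_right hξ
  rw [sub_eq_zero.mp e4, mul_pow, hg, one_mul]

/-- A tangent hyperplane on which the horizontal part of the form is non-degenerate has a non-null
normal vector. The hypothesis `hnd` is this non-degeneracy: a horizontal vector tangent to the lift,
written as `z' u + β J z`, vanishes if it is orthogonal to all tangent vectors. -/
lemma exists_normal_vector (hB : IsPseudoHermitian B J ε) (hd : finrank ℝ V = finrank ℝ E + 3)
    {z : V} {z' : E →L[ℝ] V} (hzz : c * B z z = ε) (hz'z : ∀ u, B z (z' u) = 0)
    (hnd : ∀ u (β : ℝ), (∀ v, B (z' u + β • J z) (z' v) = 0) → B (z' u + β • J z) (J z) = 0 → u = 0) :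
    ∃ ν, (∀ u, B ν (z' u) = 0) ∧ B ν z = 0 ∧ B ν (J z) = 0 ∧ B ν ν ≠ 0 ∧
      (frame J z ν z').IsInvertible := by
  have hε : ε ≠ 0 := fun h => by have := hB.eps; rw [h] at this; norm_num at this
  have hz : B z z ≠ 0 := fun h => by rw [h, mul_zero] at hzz; exact hε hzz.symm
  have hJz : B (J z) (J z) ≠ 0 := by rw [hB.J_J]; exact mul_ne_zero hε hz
  have hJzz : B (J z) z = 0 := by rw [hB.symm, hB.J_self]
  let T : V →ₗ[ℝ] Dual ℝ E × ℝ × ℝ :=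
    ((LinearMap.lcomp ℝ ℝ z'.toLinearMap) ∘ₗ ContinuousLinearMap.coeLM ℝ ∘ₗ B.toLinearMap).prod
      ((B.flip z).toLinearMap.prod (B.flip (J z)).toLinearMap)
  have hT : LinearMap.ker T ≠ ⊥ := LinearMap.ker_ne_bot_of_finrank_lt (by
    simp [Subspace.dual_finrank_eq, hd])
  obtain ⟨ν, hν, hν0⟩ := (Submodule.ne_bot_iff _).mp hT
  rw [LinearMap.mem_ker] at hν
  have h1 : ∀ u, B ν (z' u) = 0 := fun u => congrArg (fun p => p.1 u) hν
  have h2 : B ν z = 0 := congrArg (fun p => p.2.1) hν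
  have h3 : B ν (J z) = 0 := congrArg (fun p => p.2.2) hν
  have hinj : Function.Injective (frame J z ν z') := by
    rw [injective_iff_map_eq_zero]
    rintro ⟨u, α, β, γ⟩ h0
    rw [frame_apply] at h0
    have hp : ∀ w, B ν w = 0 → B (z' u + (α • z + β • J z)) w = 0 := by
      intro w hw
      have := congrArg (fun y => B y w) h0
      simp only [map_add, map_smul, add_apply, smul_apply, smul_eq_mul, hw, map_zero,
        zero_apply] at this ⊢
      linarith
    have hα : α = 0 := by
      have := hp z h2
      simpa [hB.symm (z' u) z, hz'z, hJzz, hz] using this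
    subst hα
    simp only [zero_smul, zero_add] at hp h0
    have hu : u = 0 := hnd u β (fun v => hp _ (h1 v)) (hp _ h3)
    subst hu
    have hβ : β = 0 := by
      have := hp _ h3
      simpa [hJz] using this
    subst hβ
    have hγ : γ = 0 := by simpa [hν0] using h0
    simp [hγ]
  have hdim : finrank ℝ (E × ℝ × ℝ × ℝ) = finrank ℝ V := by simp [hd]
  have hsurj : Function.Surjective (frame J z ν z') :=
    (LinearMap.injective_iff_surjective_of_finrank_eq_finrank
      (f := (frame J z ν z').toLinearMap) hdim).mp hinj
  refine ⟨ν, h1, h2, h3, fun h4 => hν0 (hB.nondeg ν fun w => ?_),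
    ⟨(LinearEquiv.ofBijective (frame J z ν z').toLinearMap
      ⟨hinj, hsurj⟩).toContinuousLinearEquiv, by ext <;> rfl⟩⟩
  obtain ⟨⟨u, α, β, γ⟩, rfl⟩ := hsurj w
  rw [frame_apply]
  simp [h1, h2, h3, h4]

/-- A non-null normal vector extends to a smooth local unit normal field. -/
lemma exists_unit_normal_field (hB : IsPseudoHermitian B J ε) {O : Set E} (hO : IsOpen O) {z : E → V}
    (hz : ContDiffOn ℝ ∞ z O) {x : E} (hx : x ∈ O) {ν₀ : V} (h1 : ∀ u, B ν₀ (fderiv ℝ z x u) = 0)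
    (h2 : B ν₀ (z x) = 0) (h3 : B ν₀ (J (z x)) = 0) (h4 : B ν₀ ν₀ ≠ 0)
    (hfr : (frame J (z x) ν₀ (fderiv ℝ z x)).IsInvertible) :
    ∃ (O' : Set E) (ν : E → V), IsOpen O' ∧ x ∈ O' ∧ O' ⊆ O ∧ ContDiffOn ℝ ∞ ν O' ∧ ∀ y ∈ O',
      (B (ν y) (ν y) = 1 ∨ B (ν y) (ν y) = -1) ∧ B (z y) (ν y) = 0 ∧ B (J (z y)) (ν y) = 0 ∧
      ∀ u, B (fderiv ℝ z y u) (ν y) = 0 := by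
  have hBinv : B.IsInvertible := by
    have hinj : Function.Injective B := (injective_iff_map_eq_zero B).mpr fun v hv =>
      hB.nondeg v fun y => by rw [hv]; rfl
    have hdim : finrank ℝ V = finrank ℝ (V →L[ℝ] ℝ) := by
      rw [← Subspace.dual_finrank_eq]
      exact (LinearMap.toContinuousLinearMap (𝕜 := ℝ) (E := V) (F' := ℝ)).finrank_eq
    have hsurj := (LinearMap.injective_iff_surjective_of_finrank_eq_finrank
      (f := B.toLinearMap) hdim).mp hinj
    exact ⟨(LinearEquiv.ofBijective B.toLinearMap ⟨hinj, hsurj⟩).toContinuousLinearEquiv, by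
      ext; rfl⟩
  have hBB : ∀ l, B (B.inverse l) = l := hBinv.self_apply_inverse
  let fr : E → E × ℝ × ℝ × ℝ →L[ℝ] V := fun y => frame J (z y) ν₀ (fderiv ℝ z y)
  have hfr_smooth : ContDiffOn ℝ ∞ fr O := by
    rw [contDiffOn_clm_apply]
    rintro ⟨u, α, β, γ⟩
    have hz' : ContDiffOn ℝ ∞ (fun y => fderiv ℝ z y u) O :=
      (hz.fderiv_of_isOpen hO (m := ∞) (by simp)).clm_apply contDiffOn_const
    simp only [fr, frame_apply]
    fun_prop
  let pr4 : E × ℝ × ℝ × ℝ →L[ℝ] ℝ := (ContinuousLinearMap.snd ℝ ℝ ℝ).comp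
    ((ContinuousLinearMap.snd ℝ ℝ (ℝ × ℝ)).comp (ContinuousLinearMap.snd ℝ E (ℝ × ℝ × ℝ)))
  -- `μ y` represents the last coordinate of the frame, so it is orthogonal to the other vectors
  let μ : E → V := fun y => B.inverse (pr4.comp (fr y).inverse)
  have hμ : ∀ y, (fr y).IsInvertible → ∀ u α β γ, B (μ y) (fr y (u, α, β, γ)) = γ := by
    intro y hy u α β γ
    simp only [μ, hBB, ContinuousLinearMap.comp_apply, hy.inverse_apply_self]
    rfl
  have hinv : ∀ᶠ y in 𝓝 x, (fr y).IsInvertible := by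
    obtain ⟨A, hA⟩ := hfr
    have h5 := A.nhds
    rw [hA] at h5
    exact (hfr_smooth.continuousOn.continuousAt (hO.mem_nhds hx)).eventually h5
  have hμx : B (μ x) (μ x) ≠ 0 := by
    have h5 : μ x = (B ν₀ ν₀)⁻¹ • ν₀ := by
      refine hB.ext fun w => ?_
      obtain ⟨⟨u, α, β, γ⟩, rfl⟩ : ∃ p, fr x p = w := ⟨_, hfr.self_apply_inverse w⟩
      rw [hμ x hfr]
      simp only [fr, frame_apply, map_add, map_smul, smul_apply, smul_eq_mul, h1, h2, h3]
      field_simp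
      ring
    rw [h5]
    simp [h4]
  -- `τ` is the sign of `⟨μ, μ⟩`
  obtain ⟨τ, hτ, hτμ⟩ : ∃ τ : ℝ, (τ = 1 ∨ τ = -1) ∧ 0 < τ * B (μ x) (μ x) := by
    rcases lt_or_gt_of_ne hμx with h5 | h5
    · exact ⟨-1, Or.inr rfl, by linarith⟩
    · exact ⟨1, Or.inl rfl, by linarith⟩
  have hμ_smooth : ∀ y ∈ O, (fr y).IsInvertible → ContDiffAt ℝ ∞ μ y := by
    intro y hy hyi
    exact B.inverse.contDiff.contDiffAt.comp y (contDiffAt_const.clm_comp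
      (hyi.contDiffAt_map_inverse.comp y (hfr_smooth.contDiffAt (hO.mem_nhds hy))))
  have hpos : ∀ᶠ y in 𝓝 x, 0 < τ * B (μ y) (μ y) := by
    have h5 := (hμ_smooth x hx hfr).continuousAt
    have h6 : ContinuousAt (fun y => τ * B (μ y) (μ y)) x :=
      continuousAt_const.mul ((B.continuous.continuousAt.comp h5).clm_apply h5)
    exact h6.eventually_const_lt hτμ
  obtain ⟨O', hO', hO'o, hxO'⟩ := eventually_nhds_iff.mp (hinv.and (hpos.and (hO.mem_nhds hx)))
  refine ⟨O', fun y => (Real.sqrt (τ * B (μ y) (μ y)))⁻¹ • μ y, hO'o, hxO',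
    fun y hy => (hO' y hy).2.2, fun y hy => ?_, fun y hy => ?_⟩
  · obtain ⟨h5, h6, h7⟩ := hO' y hy
    have h8 := hμ_smooth y h7 h5
    have h9 : ContDiffAt ℝ ∞ (fun y => τ * B (μ y) (μ y)) y :=
      contDiffAt_const.mul ((B.contDiff.contDiffAt.comp y h8).clm_apply h8)
    exact (((h9.sqrt h6.ne').inv (Real.sqrt_pos.mpr h6).ne').smul h8).contDiffWithinAt
  · obtain ⟨h5, h6, h7⟩ := hO' y hy
    have e1 : ∀ u, B (μ y) (fderiv ℝ z y u) = 0 := fun u => by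
      simpa [fr] using hμ y h5 u 0 0 0
    have e2 : B (μ y) (z y) = 0 := by simpa [fr] using hμ y h5 0 1 0 0
    have e3 : B (μ y) (J (z y)) = 0 := by simpa [fr] using hμ y h5 0 0 1 0
    have e4 := Real.sq_sqrt h6.le
    have e5 := (Real.sqrt_pos.mpr h6).ne'
    refine ⟨?_, ?_, ?_, fun u => ?_⟩
    · have e6 : B ((Real.sqrt (τ * B (μ y) (μ y)))⁻¹ • μ y)
          ((Real.sqrt (τ * B (μ y) (μ y)))⁻¹ • μ y) = τ := by
        simp only [map_smul, smul_apply, smul_eq_mul]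
        rw [← mul_assoc, ← mul_inv, ← sq, e4]
        have : B (μ y) (μ y) ≠ 0 := fun h => by rw [h, mul_zero] at h6; exact lt_irrefl _ h6
        have hττ : τ * τ = 1 := by rcases hτ with rfl | rfl <;> norm_num
        have hτ0 : τ ≠ 0 := fun h => by rw [h] at hττ; norm_num at hττ
        field_simp
        linarith
      rw [e6]; exact hτ
    · rw [hB.symm]; simp [e2]
    · rw [hB.symm]; simp [e3]
    · rw [hB.symm]; simp [e1]

end SpaceForms

end

noncomputable section

/-! ### Local constancy of the Hopf principal curvature -/

namespace SpaceForms
open Module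

variable {κ : Kind} {n : ℕ} {c : ℝ} [NeZero c]
variable {S : Type*} [TopologicalSpace S] [ChartedSpace (EuclideanSpace ℝ (Fin (2 * n - 1))) S]
variable [IsManifold (𝓡 (2 * n - 1)) ∞ S] {F : S → SpaceForm κ n c}
  (hF : IsNondegenerateHypersurface F)

lemma finrank_vec_eq (hn : 2 ≤ n) : finrank ℝ (Vec n) = finrank ℝ (Param n) + 3 := by
  rw [finrank_vec, finrank_euclideanSpace_fin]; omega

lemma two_le_finrank_param (hn : 2 ≤ n) : 2 ≤ finrank ℝ (Param n) := by
  rw [finrank_euclideanSpace_fin]; omega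

include hF

/-- A Hopf hypersurface with a unit normal field lifts, near each point, to the hyperquadric. -/
lemma exists_isHopfLift {cov : Connection κ n c} (hcov : IsLeviCivita cov) {U : Set S}
    {N : Π x : S, Tan (F x)} (hN : IsUnitNormalOn F U N) {a : S → ℝ}
    (ha : ∀ x ∈ U, IsHopfCurvatureAt cov F N x (a x)) {x₁ : S} (hx₁ : x₁ ∈ U) :
    ∃ (O : Set (Param n)) (σ : ℝ), chartAt (Param n) x₁ x₁ ∈ O ∧
      O ⊆ (chartAt (Param n) x₁).target ∧ σ * σ = 1 ∧
      IsHopfLift (formL κ n) (vecJL κ n) κ.eps c σ O (hypersurfaceLift F x₁) (normalLift F x₁ N)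
        (a ∘ (chartAt (Param n) x₁).symm) := by
  have hc : c ≠ 0 := NeZero.ne c
  set D := localDom F x₁ ∩ (chartAt (Param n) x₁).symm ⁻¹' U with hD
  have hDo : IsOpen D := isOpen_localDom_inter hF hN
  have hxD : chartAt (Param n) x₁ x₁ ∈ D := by
    refine ⟨chartAt_mem_localDom F x₁, ?_⟩
    rw [Set.mem_preimage, (chartAt (Param n) x₁).left_inv (mem_chart_source (Param n) x₁)]
    exact hx₁
  set f : Param n → ℝ := fun e => formL κ n (normalLift F x₁ N e) (normalLift F x₁ N e) with hf
  have hfc : ContinuousOn f D := fun e he => by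
    have h1 := (contDiffAt_normalLift hF he.1 hN he.2).continuousAt
    exact (((formL κ n).continuous.continuousAt.comp h1).clm_apply h1).continuousWithinAt
  have hf1 : ∀ e ∈ D, f e = 1 ∨ f e = -1 := fun e he => formL_self_normalLift he.1 hN he.2
  obtain ⟨σ, hσ⟩ : ∃ σ, f (chartAt (Param n) x₁ x₁) = σ := ⟨_, rfl⟩
  have hσ1 : σ = 1 ∨ σ = -1 := hσ ▸ hf1 _ hxD
  have hσσ : σ * σ = 1 := mul_self_eq_one_iff.mpr hσ1
  -- the set where the normal has the same causal character as at `x₁`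
  have hO : IsOpen (D ∩ f ⁻¹' {t | 0 < σ * t}) :=
    hfc.isOpen_inter_preimage hDo (isOpen_lt continuous_const (by fun_prop))
  have hfσ : ∀ e ∈ D ∩ f ⁻¹' {t | 0 < σ * t}, f e = σ := by
    rintro e ⟨he, h1⟩
    change 0 < σ * f e at h1
    rcases hσ1 with rfl | rfl <;> rcases hf1 e he with h2 | h2 <;> rw [h2] at h1 ⊢ <;>
      norm_num at h1
  refine ⟨D ∩ f ⁻¹' {t | 0 < σ * t}, σ, ⟨hxD, ?_⟩, fun e he => he.1.1.1, hσσ, hO, ?_, ?_, ?_, ?_,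
    ?_, hfσ, ?_, ?_, ?_⟩
  · change 0 < σ * f _
    rw [hσ, hσσ]; exact one_pos
  · exact fun e he => (contDiffAt_hypersurfaceLift hF he.1.1).contDiffWithinAt
  · exact (contDiffOn_normalLift hF hN).mono Set.inter_subset_left
  · intro e he
    rw [formL_self_hypersurfaceLift he.1.1]; field_simp
  · exact fun e he => formL_normalLift he.1.1
  · exact fun e he => formL_vecJ_normalLift he.1.1
  · exact fun e he u => formL_fderiv_normalLift hF he.1.1 hN he.1.2 u
  · intro e he u β h1
    have hs := isSection_sec (F x₁)
    have hw := localMap_mem he.1.1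
    refine (injective_iff_map_eq_zero (fderiv ℝ (localMap F x₁) e)).mp
      (fderiv_localMap_injective hF he.1.1) u ?_
    rw [fderiv_hypersurfaceLift hF he.1.1] at h1
    have h2 := congrArg (fderiv ℝ (affine κ (coordAt (F x₁))) (sec (F x₁) (localMap F x₁ e))) h1
    rw [hs.fderiv_affine hw, map_smul] at h2
    rw [h2]
    exact (congrArg (fun y => β • y) (hs.fderiv_affine_vecJ hw)).trans (smul_zero β)
  · intro e he u
    exact hopf_of_isHopfCurvatureAt hF he.1.1 hN he.1.2 hcov (ha _ he.1.2) (hfσ e he) u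

/-- The Hopf principal curvature is locally constant. -/
lemma eventually_hopfCurvature_eq (hn : 2 ≤ n) {cov : Connection κ n c} (hcov : IsLeviCivita cov)
    {U : Set S} {N : Π x : S, Tan (F x)} (hN : IsUnitNormalOn F U N) {a : S → ℝ}
    (ha : ∀ x ∈ U, IsHopfCurvatureAt cov F N x (a x)) {x₁ : S} (hx₁ : x₁ ∈ U) :
    ∀ᶠ x in 𝓝 x₁, a x = a x₁ := by
  obtain ⟨O, σ, hxO, -, hσ, h⟩ := exists_isHopfLift hF hcov hN ha hx₁
  have hB := isPseudoHermitian_formL κ n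
  obtain ⟨r, hr, hball⟩ := Metric.isOpen_iff.mp h.isOpen _ hxO
  obtain ⟨b, hb⟩ := Metric.isOpen_ball.exists_is_const_of_fderiv_eq_zero
    (convex_ball (chartAt (Param n) x₁ x₁) r).isPreconnected
    (fun e he => (h.diff_a (hball he) hB hσ (finrank_vec_eq hn)).differentiableWithinAt)
    (fun e he => h.fderiv_a_eq_zero hB hσ (finrank_vec_eq hn) (two_le_finrank_param hn) (hball he))
  have h1 : ∀ᶠ x in 𝓝 x₁, chartAt (Param n) x₁ x ∈ Metric.ball (chartAt (Param n) x₁ x₁) r :=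
    ((chartAt (Param n) x₁).continuousAt (mem_chart_source (Param n) x₁)).eventually
      (Metric.ball_mem_nhds _ hr)
  have h2 : ∀ᶠ x in 𝓝 x₁, a x = b := by
    filter_upwards [h1, chart_source_mem_nhds (Param n) x₁] with x hx hx'
    have := hb _ hx
    rwa [Function.comp_apply, (chartAt (Param n) x₁).left_inv hx'] at this
  have h3 := h2.self_of_nhds
  filter_upwards [h2] with x hx
  rw [hx, h3]

/-- Up to sign, the Hopf principal curvature at a point does not depend on the unit normal field. -/
lemma hopfCurvature_sq_eq (hn : 2 ≤ n) {cov : Connection κ n c} (hcov : IsLeviCivita cov)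
    {U₁ U₂ : Set S} {N₁ N₂ : Π x : S, Tan (F x)} (hN₁ : IsUnitNormalOn F U₁ N₁)
    (hN₂ : IsUnitNormalOn F U₂ N₂) {a₁ a₂ : S → ℝ}
    (ha₁ : ∀ x ∈ U₁, IsHopfCurvatureAt cov F N₁ x (a₁ x))
    (ha₂ : ∀ x ∈ U₂, IsHopfCurvatureAt cov F N₂ x (a₂ x)) {x : S} (hx₁ : x ∈ U₁) (hx₂ : x ∈ U₂) :
    a₁ x ^ 2 = a₂ x ^ 2 := by
  obtain ⟨O₁, σ₁, hxO₁, -, hσ₁, h₁⟩ := exists_isHopfLift hF hcov hN₁ ha₁ hx₁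
  obtain ⟨O₂, σ₂, hxO₂, -, hσ₂, h₂⟩ := exists_isHopfLift hF hcov hN₂ ha₂ hx₂
  have := h₁.sq_eq (isPseudoHermitian_formL κ n) (finrank_vec_eq hn) hσ₁ hσ₂ h₂ hxO₁ hxO₂
  simpa only [Function.comp_apply,
    (chartAt (Param n) x).left_inv (mem_chart_source (Param n) x)] using this

/-- Unit normal fields exist near each point. -/
lemma exists_isUnitNormalOn (hn : 2 ≤ n) (x₁ : S) :
    ∃ (U : Set S) (N : Π x : S, Tan (F x)), x₁ ∈ U ∧ IsUnitNormalOn F U N := by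
  have hB := isPseudoHermitian_formL κ n
  have hc : c ≠ 0 := NeZero.ne c
  have hs := isSection_sec (F x₁)
  have he₁ := chartAt_mem_localDom F x₁
  have hz : ContDiffOn ℝ ∞ (hypersurfaceLift F x₁) (localDom F x₁) := fun e he =>
    (contDiffAt_hypersurfaceLift hF he).contDiffWithinAt
  have hzz : c * formL κ n (hypersurfaceLift F x₁ (chartAt (Param n) x₁ x₁))
      (hypersurfaceLift F x₁ (chartAt (Param n) x₁ x₁)) = κ.eps := by
    rw [formL_self_hypersurfaceLift he₁]; field_simp
  obtain ⟨ν₀, h1, h2, h3, h4, h5⟩ := exists_normal_vector hB (finrank_vec_eq hn) hzz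
    (formL_fderiv_hypersurfaceLift hF he₁) (by
      intro u β h1 h2
      have hp : horProj κ n c (hypersurfaceLift F x₁ (chartAt (Param n) x₁ x₁))
          (fderiv ℝ (hypersurfaceLift F x₁) (chartAt (Param n) x₁ x₁) u) =
          fderiv ℝ (hypersurfaceLift F x₁) (chartAt (Param n) x₁ x₁) u +
            β • vecJL κ n (hypersurfaceLift F x₁ (chartAt (Param n) x₁ x₁)) := by
        have h3 : c * formL κ n (vecJL κ n (hypersurfaceLift F x₁ (chartAt (Param n) x₁ x₁)))
            (vecJL κ n (hypersurfaceLift F x₁ (chartAt (Param n) x₁ x₁))) = 1 := by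
          rw [hB.J_J]; linear_combination κ.eps * hzz + eps_sq κ
        simp only [map_add, map_smul, add_apply, smul_apply, smul_eq_mul] at h2
        have h4 : c * formL κ n (vecJL κ n (hypersurfaceLift F x₁ (chartAt (Param n) x₁ x₁)))
            (fderiv ℝ (hypersurfaceLift F x₁) (chartAt (Param n) x₁ x₁) u) = -β := by
          rw [hB.symm]; linear_combination c * h2 - β * h3
        rw [horProj_apply, formL_fderiv_hypersurfaceLift hF he₁, h4]
        module
      have h3 : chartSymmDeriv x₁ (chartAt (Param n) x₁ x₁) u = 0 := by
        refine hF.nondegenerate _ _ fun w => ?_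
        obtain ⟨v, rfl⟩ := (chartSymmDeriv_bijective he₁).2 w
        rw [metric_eq_lift he₁, ← fderiv_localMap hF he₁, ← fderiv_localMap hF he₁,
          hB.symm, ← formL_fderiv_lift hF he₁, ← horProj_fderiv_hypersurfaceLift hF he₁, hp, hB.symm]
        exact h1 v
      exact (injective_iff_map_eq_zero (chartSymmDeriv x₁ (chartAt (Param n) x₁ x₁))).mp
        (chartSymmDeriv_bijective he₁).1 u h3)
  obtain ⟨O, ν, hO, hxO, hOs, hν, hνO⟩ := exists_unit_normal_field hB (isOpen_localDom hF x₁) hz he₁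
    h1 h2 h3 h4 h5
  let y : Param n → Model n := fun e =>
    fderiv ℝ (affine κ (coordAt (F x₁))) (hypersurfaceLift F x₁ e) (ν e)
  let N : Π x : S, Tan (F x) := fun x => dcoordSymm (F x₁) (F x) (y (chartAt (Param n) x₁ x))
  have hlift : ∀ e ∈ O, lift κ c (sec (F x₁)) (localMap F x₁ e) (y e) = ν e := fun e he =>
    (hs.eq_lift (localMap_mem (hOs he)) (hνO e he).2.1 (hνO e he).2.2.1).symm
  have hU : ∀ x ∈ (chartAt (Param n) x₁).source ∩ chartAt (Param n) x₁ ⁻¹' O,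
      ∃ e ∈ O, x = (chartAt (Param n) x₁).symm e ∧ chartAt (Param n) x₁ x = e := fun x hx =>
    ⟨_, hx.2, ((chartAt (Param n) x₁).left_inv hx.1).symm, rfl⟩
  have hN : ∀ e ∈ O, lift κ c (sec (F x₁)) (localMap F x₁ e)
      (dcoord (F x₁) _ (N ((chartAt (Param n) x₁).symm e))) = ν e := by
    intro e he
    rw [← hlift e he]
    congr 1
    rw [dcoord_dcoordSymm (hOs he).2, (chartAt (Param n) x₁).right_inv (hOs he).1]
  have hy : ContDiffOn ℝ ∞ y O := by
    refine ContDiffOn.clm_apply (fun e he => ?_) hν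
    have h6 : ContDiffAt ℝ ∞ (affine κ (coordAt (F x₁))) (hypersurfaceLift F x₁ e) :=
      (contDiffOn_affine κ _).contDiffAt
        ((isOpen_nu_ne κ _).mem_nhds (hs.nu_ne _ (localMap_mem (hOs he))))
    exact ((h6.fderiv_right (m := ∞) (by simp)).comp e
      (contDiffAt_hypersurfaceLift hF (hOs he))).contDiffWithinAt
  refine ⟨(chartAt (Param n) x₁).source ∩ chartAt (Param n) x₁ ⁻¹' O, N,
    ⟨mem_chart_source (Param n) x₁, hxO⟩, (chartAt (Param n) x₁).isOpen_inter_preimage hO, ?_, ?_, ?_⟩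
  · have hm : Set.MapsTo (fun x => (⟨F x, N x⟩ : TangentBundle 𝓘(ℝ, Model n) (SpaceForm κ n c)))
        ((chartAt (Param n) x₁).source ∩ chartAt (Param n) x₁ ⁻¹' O)
        (trivializationAt (Model n) (TangentSpace 𝓘(ℝ, Model n)) (F x₁)).source := by
      intro x hx
      obtain ⟨e, he, rfl, -⟩ := hU x hx
      exact (Bundle.Trivialization.mem_source _).mpr (mem_baseSet (hOs he).2)
    refine ((trivializationAt (Model n) (TangentSpace 𝓘(ℝ, Model n)) (F x₁)).contMDiffOn_iff hm).mpr
      ⟨hF.smooth.contMDiffOn, ?_⟩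
    have h6 : ContMDiffOn (𝓡 (2 * n - 1)) 𝓘(ℝ, Model n) ∞ (y ∘ chartAt (Param n) x₁)
        ((chartAt (Param n) x₁).source ∩ chartAt (Param n) x₁ ⁻¹' O) :=
      (contMDiffOn_iff_contDiffOn.mpr hy).comp (contMDiffOn_chart.mono Set.inter_subset_left)
        fun x hx => hx.2
    refine h6.congr fun x hx => ?_
    obtain ⟨e, he, rfl, -⟩ := hU x hx
    refine (Bundle.Trivialization.continuousLinearMapAt_apply_of_mem ℝ _
      (mem_baseSet (hOs he).2) _).symm.trans ?_
    exact dcoord_dcoordSymm (hOs he).2 _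
  · intro x hx v
    obtain ⟨e, he, rfl, -⟩ := hU x hx
    obtain ⟨u, rfl⟩ := (chartSymmDeriv_bijective (hOs he)).2 v
    rw [metric_eq_lift (hOs he), ← fderiv_localMap hF (hOs he), ← formL_fderiv_lift hF (hOs he), hN e he]
    exact (hνO e he).2.2.2 u
  · intro x hx
    obtain ⟨e, he, rfl, -⟩ := hU x hx
    rw [metric_eq_lift (hOs he), hN e he]
    exact (hνO e he).1

end SpaceForms

end

open SpaceForms in
theorem theorem2 (κ : Kind) (n : ℕ) (hn : 2 ≤ n) (c : ℝ) [NeZero c]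
    (cov : Connection κ n c) (hcov : IsLeviCivita cov)
    {S : Type*} [TopologicalSpace S] [ChartedSpace (EuclideanSpace ℝ (Fin (2 * n - 1))) S]
    [IsManifold (𝓡 (2 * n - 1)) ∞ S] [ConnectedSpace S]
    (F : S → SpaceForm κ n c) (hF : IsNondegenerateHypersurface F) (hHopf : IsHopf cov F) :
    -- the Hopf principal curvature of every unit normal field on a connected open piece of the
    -- hypersurface is constant ...
    ∃ a₀ : ℝ, ∀ (U : Set S) (N : Π x : S, Tan (F x)) (a : S → ℝ),
      IsUnitNormalOn F U N → IsPreconnected U → (∀ x ∈ U, IsHopfCurvatureAt cov F N x (a x)) →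
      -- ... and it is the same on all pieces, up to the change of sign of `a` with `N`
      (∀ x ∈ U, a x = a₀) ∨ (∀ x ∈ U, a x = -a₀) := by
  have hex : ∀ x : S, ∃ (U : Set S) (N : Π x : S, Tan (F x)) (a : S → ℝ), x ∈ U ∧
      IsUnitNormalOn F U N ∧ ∀ y ∈ U, IsHopfCurvatureAt cov F N y (a y) := by
    intro x
    obtain ⟨U, N, hx, hN⟩ := exists_isUnitNormalOn hF hn x
    choose! a ha using hHopf U N hN
    exact ⟨U, N, a, hx, hN, ha⟩
  choose U₀ N₀ a₀ hx₀ hN₀ ha₀ using hex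
  -- the square of the Hopf principal curvature is well defined on the whole hypersurface
  have hsq : ∀ (U : Set S) (N : Π x : S, Tan (F x)) (a : S → ℝ), IsUnitNormalOn F U N →
      (∀ x ∈ U, IsHopfCurvatureAt cov F N x (a x)) → ∀ x ∈ U, a x ^ 2 = a₀ x x ^ 2 :=
    fun U N a hN ha x hx => hopfCurvature_sq_eq hF hn hcov hN (hN₀ x) ha (ha₀ x) hx (hx₀ x)
  have hloc : IsLocallyConstant fun x => a₀ x x ^ 2 := by
    rw [IsLocallyConstant.iff_eventually_eq]
    intro x
    filter_upwards [eventually_hopfCurvature_eq hF hn hcov (hN₀ x) (ha₀ x) (hx₀ x),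
      (hN₀ x).isOpen.mem_nhds (hx₀ x)] with y hy hyU
    rw [← hsq _ _ _ (hN₀ x) (ha₀ x) y hyU, hy]
  obtain ⟨x₀⟩ := (inferInstance : Nonempty S)
  refine ⟨a₀ x₀ x₀, fun U N a hN hU ha => ?_⟩
  have hconst : ∀ x ∈ U, a x ^ 2 = a₀ x₀ x₀ ^ 2 := fun x hx =>
    (hsq U N a hN ha x hx).trans (hloc.apply_eq_of_isPreconnected isPreconnected_univ
      (Set.mem_univ x) (Set.mem_univ x₀))
  by_cases h0 : a₀ x₀ x₀ = 0
  · refine Or.inl fun x hx => ?_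
    have := hconst x hx
    rw [h0] at this ⊢
    simpa using this
  · have hcont : ContinuousOn a U := fun x hx =>
      ((continuousAt_const (y := a x)).congr
        ((eventually_hopfCurvature_eq hF hn hcov hN ha hx).mono fun y hy => hy.symm)).continuousWithinAt
    exact hU.eq_or_eq_neg_of_sq_eq (g := fun _ => a₀ x₀ x₀) hcont continuousOn_const hconst
      fun _ => h0
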